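/- Let $p$ be a prime and let $(R,\mathfrak m,k)$ be a complete regular local ring of characteristic $p$ and of dimension $n$ that is $F$-finite (the Frobenius $R\to R$, $a\mapsto a^p$, is a finite ring map). Let $I\subseteq R$ be an ideal and $A=R/I$. Conventions. $R^1$ is $R$ as an $R$-$R$-bimodule, with the usual left structure and with the right structure given by the Frobenius. An $R[F]$-module is an $R$-module $M$ with an $R$-linear map $\theta_M:R^1\otimes_R M\to M$ (equivalently, with a $p$-linear map $F_M:M\to M$, $F_M(m)=\theta_M(1\otimes m)$); morphisms are the $R$-linear maps that commute with the structure maps; $M$ is unit if $\theta_M$ is an isomorphism. $R$ and $R/I$ are $R[F]$-modules via $a\mapsto a^p$. For an ideal $J$ and an $R[F]$-module $M$ the local cohomology $H^i_J(M)$ is the $i$-th cohomology of the Čech complex of $M$ on any finite system of generators of $J$, with the Frobenius action induced by $m/s\mapsto F_M(m)/s^p$ on the localizations; $H^j_J(M)=0$ for $j<0$. For an $R$-linear map $\beta:M_0\to R^1\otimes M_0$ the unit $R[F]$-module generated by $\beta$ is the direct limit of $M_0\to R^1\otimes M_0\to R^1\otimes R^1\otimes M_0\to\cdots$, the maps being $\beta$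 and its Frobenius pullbacks. For an $R[F]$-module $N$, let $\Psi_M:R^1\otimes\operatorname{Hom}_R(M,N)\to\operatorname{Hom}_R(R^1\otimes M,N)$ be the natural map $r\otimes\varphi\mapsto r\cdot\theta_N\circ(\mathrm{id}\otimes\varphi)$. Let $E$ be an injective hull of $k$. Then $E\cong H^n_{\mathfrak m}(R)$ as $R$-modules; fix any such isomorphism and give $E$ the resulting $R[F]$-structure. Put $D=\operatorname{Hom}_R(-,E)$. The extended Matlis dual of an $R[F]$-module $M$ is the direct limit $\mathcal D(M)$ of $D(M)\to D(R^1\otimes M)\to D(R^1\otimes R^1\otimes M)\to\cdots$, the maps being the duals of $\theta_M$ and its Frobenius pullbacks, with the $R[F]$-structure induced by the maps $\Psi$ (with $N=E$). Then, for all $i\ge 0$, $\mathcal D(H^i_{\mathfrak m}(R/I))$ is a unit $R[F]$-module, and $$\mathcal D(H^i_{\mathfrak m}(R/I))\cong H^{n-i}_I(R)$$ as unit $R[F]$-modules. Moreover, let $I\neq R$, let $d=\dim A$, let $c$ be the codimension of $\operatorname{Spec}A$ in $\operatorname{Spec}R$ (the height of $I$), and let $\omega_A=\operatorname{Ext}^c_R(A,R)$.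 Then $\mathcal D(H^d_{\mathfrak m}(A))\cong H^c_I(R)$ as unit $R[F]$-modules. The functor $R^1\otimes_R-$ is exact, the maps $\Psi$ (with $N=R$) induce an isomorphism $\Psi:R^1\otimes\operatorname{Ext}^c_R(A,R)\to\operatorname{Ext}^c_R(R^1\otimes A,R)$, and $H^c_I(R)$ is isomorphic, as an $R[F]$-module, to the unit $R[F]$-module generated by $$\beta:\ \omega_A=\operatorname{Ext}^c_R(A,R)\longrightarrow\operatorname{Ext}^c_R(R^1\otimes A,R)\xrightarrow{\ \Psi^{-1}\ }R^1\otimes\omega_A ,$$ where the first map is induced by $\theta_A:R^1\otimes A=R/I^{[p]}\to R/I=A$. -/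

import Mathlib

open CategoryTheory Limits Opposite

universe u

noncomputable section

namespace FrobeniusModules

/-! ### The Frobenius functor and modules with a Frobenius action -/

section Basic

variable (R : Type u) [CommRing R] (p : ℕ) [Fact p.Prime] [CharP R p]

/-- The Frobenius functor `M ↦ R¹ ⊗_R M`, i.e. base change along the Frobenius of `R`. -/
abbrev pull : ModuleCat.{u} R ⥤ ModuleCat.{u} R :=
  ModuleCat.extendScalars.{u, u, u} (frobenius R p)

/-- Restriction of scalars along the Frobenius of `R`. -/
abbrev push : ModuleCat.{u} R ⥤ ModuleCat.{u} R :=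
  ModuleCat.restrictScalars.{u, u, u} (frobenius R p)

/-- Base change along Frobenius is left adjoint to restriction along Frobenius. -/
abbrev adj : pull R p ⊣ push R p :=
  ModuleCat.extendRestrictScalarsAdj.{u, u, u} (frobenius R p)

/-- The category of `R[F]`-modules: an object is an `R`-module `a` with an `R`-linear map
`str : R¹ ⊗_R a ⟶ a`; a morphism is an `R`-linear map which commutes with the structure maps. -/
abbrev RFMod := Endofunctor.Algebra (pull R p)

variable {R p}

/-- An `R[F]`-module is unit if its structure map `R¹ ⊗_R M ⟶ M` is an isomorphism. -/
def IsUnitRF (M : RFMod R p) : Prop := IsIso M.str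

/-- The `R`-linear map `R¹ ⊗_R M ⟶ N`, `r ⊗ m ↦ r F(m)`, attached to a `p`-linear map `F`. -/
def linearize {M N : ModuleCat.{u} R} (F : M →ₛₗ[frobenius R p] N) : (pull R p).obj M ⟶ N :=
  ((adj R p).homEquiv M N).symm (ModuleCat.semilinearMapAddEquiv (frobenius R p) M N F)

/-- The `p`-linear map `m ↦ θ (1 ⊗ m)` attached to an `R`-linear map `θ : R¹ ⊗_R M ⟶ N`. -/
def delinearize {M N : ModuleCat.{u} R} (θ : (pull R p).obj M ⟶ N) : M →ₛₗ[frobenius R p] N :=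
  (ModuleCat.semilinearMapAddEquiv (frobenius R p) M N).symm ((adj R p).homEquiv M N θ)

/-- The `R[F]`-module given by a Frobenius action, i.e. a `p`-linear endomorphism. -/
def RFMod.ofAction (M : ModuleCat.{u} R) (F : M →ₛₗ[frobenius R p] M) : RFMod R p :=
  ⟨M, linearize F⟩

/-- The Frobenius action `F(m) = θ (1 ⊗ m)` of an `R[F]`-module. -/
def RFMod.action (M : RFMod R p) : M.a →ₛₗ[frobenius R p] M.a := delinearize M.str

/-- Transport of an `R[F]`-module structure along an isomorphism of `R`-modules. -/
def RFMod.transport (M : RFMod R p) {E : ModuleCat.{u} R} (e : E ≅ M.a) : RFMod R p :=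
  ⟨E, (pull R p).map e.hom ≫ M.str ≫ e.inv⟩

variable (R p) in
/-- `R` with its Frobenius. -/
def RFMod.ring : RFMod R p := .ofAction (.of R R) (LinearMap.frobenius R R p)

variable (p) in
/-- `R/I` with its Frobenius `a ↦ a ^ p`. -/
def RFMod.quot (I : Ideal R) : RFMod R p :=
  .ofAction (.of R (R ⧸ I))
    (Submodule.mapQ I I (LinearMap.frobenius R R p) fun a ha => by
      rw [Submodule.mem_comap, LinearMap.frobenius_def]
      exact I.pow_mem_of_mem ha p (Fact.out : p.Prime).pos)

lemma linearize_delinearize {M N : ModuleCat.{u} R} (θ : (pull R p).obj M ⟶ N) :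
    linearize (delinearize θ) = θ := by
  simp only [linearize, delinearize, AddEquiv.apply_symm_apply, Equiv.symm_apply_apply]

lemma delinearize_linearize {M N : ModuleCat.{u} R} (F : M →ₛₗ[frobenius R p] N) :
    delinearize (linearize F) = F := by
  simp only [linearize, delinearize, AddEquiv.symm_apply_apply, Equiv.apply_symm_apply]

lemma delinearize_injective {M N : ModuleCat.{u} R} {θ θ' : (pull R p).obj M ⟶ N}
    (h : ∀ m, delinearize θ m = delinearize θ' m) : θ = θ' := by
  rw [← linearize_delinearize θ, ← linearize_delinearize θ', LinearMap.ext h]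

@[simp]
lemma delinearize_map_comp {M' M N : ModuleCat.{u} R} (f : M' ⟶ M) (θ : (pull R p).obj M ⟶ N)
    (m : M') : delinearize ((pull R p).map f ≫ θ) m = delinearize θ (f.hom m) := by
  rfl

@[simp]
lemma delinearize_comp {M N N' : ModuleCat.{u} R} (θ : (pull R p).obj M ⟶ N) (g : N ⟶ N')
    (m : M) : delinearize (θ ≫ g) m = g.hom (delinearize θ m) := by
  rfl

@[simp]
lemma delinearize_smul {M N : ModuleCat.{u} R} (a : R) (θ : (pull R p).obj M ⟶ N)
    (m : M) : delinearize (a • θ) m = a • delinearize θ m := by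
  rfl

@[simp]
lemma delinearize_add {M N : ModuleCat.{u} R} (θ θ' : (pull R p).obj M ⟶ N)
    (m : M) : delinearize (θ + θ') m = delinearize θ m + delinearize θ' m := by
  rfl

instance : (pull R p).Additive := (adj R p).left_adjoint_additive

instance : (pull R p).PreservesProjectiveObjects where
  projective_obj hX := (adj R p).map_projective _ hX

lemma pull_map_smul {M N N' : ModuleCat.{u} R} (a : R) (f : M ⟶ N) (θ : (pull R p).obj N ⟶ N') :
    (pull R p).map (a • f) ≫ θ = frobenius R p a • ((pull R p).map f ≫ θ) := by
  apply delinearize_injective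
  intro m
  rw [delinearize_map_comp, delinearize_smul, delinearize_map_comp, ModuleCat.hom_smul,
    LinearMap.smul_apply, LinearMap.map_smulₛₗ]

end Basic

/-! ### Direct limits -/

section Colim

variable {R : Type u} [CommRing R] {p : ℕ} [Fact p.Prime] [CharP R p]

/-- The cocone on `X` with vertex the restriction of scalars of `colimit X` along Frobenius, given
by the `p`-linear maps `Xₙ → Xₙ₊₁ → colimit X` which are adjoint to the maps `t n`. -/
def colimCocone (X : ℕ ⥤ ModuleCat.{u} R)
    (t : ∀ n, (pull R p).obj (X.obj n) ⟶ X.obj (n + 1))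
    (ht : ∀ n, (pull R p).map (X.map (homOfLE (Nat.le_add_right n 1))) ≫ t (n + 1) =
      t n ≫ X.map (homOfLE (Nat.le_add_right (n + 1) 1))) : Cocone X where
  pt := (push R p).obj (colimit X)
  ι := NatTrans.ofSequence
    (fun n => (adj R p).homEquiv (X.obj n) (colimit X) (t n ≫ colimit.ι X (n + 1)))
    (fun n => by
      rw [← Adjunction.homEquiv_naturality_left, ← Category.assoc, ht, Category.assoc, colimit.w]
      exact (Category.comp_id _).symm)

/-- Let `X₀ ⟶ X₁ ⟶ X₂ ⟶ ⋯` be a directed system of `R`-modules with maps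
`t n : R¹ ⊗ Xₙ ⟶ Xₙ₊₁` which form a morphism of directed systems. The limit `X` is an
`R[F]`-module: the structure map `R¹ ⊗ X = colim (R¹ ⊗ Xₙ) ⟶ X` is the limit of the `t n`. -/
def RFMod.colim (X : ℕ ⥤ ModuleCat.{u} R)
    (t : ∀ n, (pull R p).obj (X.obj n) ⟶ X.obj (n + 1))
    (ht : ∀ n, (pull R p).map (X.map (homOfLE (Nat.le_add_right n 1))) ≫ t (n + 1) =
      t n ≫ X.map (homOfLE (Nat.le_add_right (n + 1) 1))) : RFMod R p where
  a := colimit X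
  str := ((adj R p).homEquiv (colimit X) (colimit X)).symm (colimit.desc X (colimCocone X t ht))

/-- The structure map of the limit is the limit of the maps `t n`. -/
lemma RFMod.ι_colim_str (X : ℕ ⥤ ModuleCat.{u} R)
    (t : ∀ n, (pull R p).obj (X.obj n) ⟶ X.obj (n + 1))
    (ht : ∀ n, (pull R p).map (X.map (homOfLE (Nat.le_add_right n 1))) ≫ t (n + 1) =
      t n ≫ X.map (homOfLE (Nat.le_add_right (n + 1) 1))) (n : ℕ) :
    (pull R p).map (colimit.ι X n : X.obj n ⟶ (RFMod.colim X t ht).a) ≫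
      (RFMod.colim X t ht).str = t n ≫ colimit.ι X (n + 1) := by
  apply ((adj R p).homEquiv _ _).injective
  refine (Adjunction.homEquiv_naturality_left _ _ _).trans ?_
  have h := colimit.ι_desc (colimCocone X t ht) n
  rw [← Equiv.apply_symm_apply ((adj R p).homEquiv (colimit X) (colimit X))
    (colimit.desc X (colimCocone X t ht))] at h
  exact h

variable (p) in
/-- The iterates `(R¹ ⊗ -)ⁿ M` of the Frobenius functor. -/
def pullIter (M : ModuleCat.{u} R) : ℕ → ModuleCat.{u} R
  | 0 => M
  | n + 1 => (pull R p).obj (pullIter M n)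

/-- The maps of the directed system `M ⟶ R¹ ⊗ M ⟶ R² ⊗ M ⟶ ⋯` given by `β`. -/
def pullIterUp {M : ModuleCat.{u} R} (β : M ⟶ (pull R p).obj M) :
    ∀ n, pullIter p M n ⟶ pullIter p M (n + 1)
  | 0 => β
  | n + 1 => (pull R p).map (pullIterUp β n)

/-- The maps of the inverse system `⋯ ⟶ R² ⊗ M ⟶ R¹ ⊗ M ⟶ M` given by `θ`. -/
def pullIterDown {M : ModuleCat.{u} R} (θ : (pull R p).obj M ⟶ M) :
    ∀ n, pullIter p M (n + 1) ⟶ pullIter p M n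
  | 0 => θ
  | n + 1 => (pull R p).map (pullIterDown θ n)

/-- The unit `R[F]`-module generated by `β : M ⟶ R¹ ⊗ M`: the limit of
`M ⟶ R¹ ⊗ M ⟶ R² ⊗ M ⟶ ⋯`. -/
def RFMod.generated {M : ModuleCat.{u} R} (β : M ⟶ (pull R p).obj M) : RFMod R p :=
  .colim (Functor.ofSequence (pullIterUp β)) (fun n => 𝟙 (pullIter p M (n + 1)))
    (fun n => by
      rw [Functor.ofSequence_map_homOfLE_succ, Functor.ofSequence_map_homOfLE_succ]
      exact (Category.comp_id _).trans (Category.id_comp (pullIterUp β (n + 1))).symm)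

end Colim

/-! ### Duality into an `R[F]`-module -/

section Dual

variable {R : Type u} [CommRing R] {p : ℕ} [Fact p.Prime] [CharP R p]

/-- The contravariant functor `Hom_R(-, E)`. -/
abbrev homInto (E : ModuleCat.{u} R) : (ModuleCat.{u} R)ᵒᵖ ⥤ ModuleCat.{u} R :=
  (linearYoneda R (ModuleCat.{u} R)).obj E

/-- The `p`-linear map `Hom(M, N) → Hom(R¹ ⊗ M, N)` sending `φ` to
`R¹ ⊗ M ⟶ R¹ ⊗ N ⟶ N`, for an `R[F]`-module `N`. -/
def psiAction (N : RFMod R p) (M : ModuleCat.{u} R) :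
    (homInto N.a).obj (op M) →ₛₗ[frobenius R p] (homInto N.a).obj (op ((pull R p).obj M)) where
  toFun φ := (pull R p).map (show M ⟶ N.a from φ) ≫ N.str
  map_add' φ ψ := by
    erw [Functor.map_add, Preadditive.add_comp]
    rfl
  map_smul' a φ := pull_map_smul a _ _

/-- The natural transformation `Ψ : R¹ ⊗ Hom(M, N) ⟶ Hom(R¹ ⊗ M, N)`,
`r ⊗ φ ↦ r • (R¹ ⊗ M ⟶ R¹ ⊗ N ⟶ N)`. -/
def psi (N : RFMod R p) (M : ModuleCat.{u} R) :
    (pull R p).obj ((homInto N.a).obj (op M)) ⟶ (homInto N.a).obj (op ((pull R p).obj M)) :=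
  linearize (psiAction N M)

lemma psi_naturality (N : RFMod R p) {M M' : ModuleCat.{u} R} (f : M ⟶ M') :
    (pull R p).map ((homInto N.a).map f.op) ≫ psi N M =
      psi N M' ≫ (homInto N.a).map ((pull R p).map f).op := by
  apply delinearize_injective
  intro φ
  rw [delinearize_map_comp, delinearize_comp, psi, psi, delinearize_linearize,
    delinearize_linearize]
  change (pull R p).map (f ≫ (show M' ⟶ N.a from φ)) ≫ N.str =
    (pull R p).map f ≫ (pull R p).map (show M' ⟶ N.a from φ) ≫ N.str
  rw [Functor.map_comp, Category.assoc]

/-- The map `psiAction` as a morphism from `Hom(M, N)` to the restriction of scalars of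
`Hom(R¹ ⊗ M, N)` along Frobenius. -/
def psiAdj (N : RFMod R p) (M : ModuleCat.{u} R) :
    (homInto N.a).obj (op M) ⟶
      (push R p).obj ((homInto N.a).obj (op ((pull R p).obj M))) :=
  ModuleCat.semilinearMapAddEquiv (frobenius R p) _ _ (psiAction N M)

lemma psiAdj_naturality (N : RFMod R p) {M M' : ModuleCat.{u} R} (f : M ⟶ M') :
    psiAdj N M' ≫ (push R p).map ((homInto N.a).map ((pull R p).map f).op) =
      (homInto N.a).map f.op ≫ psiAdj N M := by
  have h := congrArg ((adj R p).homEquiv _ _) (psi_naturality N f)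
  rw [Adjunction.homEquiv_naturality_left, Adjunction.homEquiv_naturality_right, psi, psi,
    linearize, linearize, Equiv.apply_symm_apply, Equiv.apply_symm_apply] at h
  exact h.symm

/-- The extension of `D = Hom_R(-, E)` to `R[F]`-modules, for an `R[F]`-module `E`:
the limit of `D(M) ⟶ D(R¹ ⊗ M) ⟶ D(R² ⊗ M) ⟶ ⋯`, with the `R[F]`-structure given by `Ψ`.
When `E` is the injective hull of the residue field of a regular local ring this is the extended
Matlis dual. -/
def RFMod.dual (E M : RFMod R p) : RFMod R p :=
  .colim (Functor.ofSequence (X := fun n => (homInto E.a).obj (op (pullIter p M.a n)))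
      (fun n => (homInto E.a).map (pullIterDown M.str n).op))
    (fun n => psi E (pullIter p M.a n))
    (fun n => by
      rw [Functor.ofSequence_map_homOfLE_succ, Functor.ofSequence_map_homOfLE_succ]
      exact psi_naturality E (pullIterDown M.str n))

end Dual

/-! ### Frobenius and homology -/

section Homology

variable {R : Type u} [CommRing R] {p : ℕ} [Fact p.Prime] [CharP R p]
variable {ι : Type} {c : ComplexShape ι}

/-- A `p`-linear map of complexes `K → L` (i.e. a map from `K` to the restriction of scalars of `L`
along Frobenius) induces `R¹ ⊗ H^i(K) ⟶ H^i(L)`. -/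
def homologyLift {K L : HomologicalComplex (ModuleCat.{u} R) c}
    (φ : K ⟶ ((push R p).mapHomologicalComplex c).obj L) (i : ι) :
    (pull R p).obj (K.homology i) ⟶ L.homology i :=
  ((adj R p).homEquiv _ _).symm
    (HomologicalComplex.homologyMap φ i ≫ ((L.sc i).mapHomologyIso (push R p)).hom)

/-- The map of complexes `Hom(P, N) → Hom(R¹ ⊗ P, N)`, `p`-linear, given by `psiAction`. -/
def psiComplex (N : RFMod R p) (P : ChainComplex (ModuleCat.{u} R) ℕ) :
    P.linearYonedaObj R N.a ⟶ ((push R p).mapHomologicalComplex _).obj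
      (ChainComplex.linearYonedaObj (((pull R p).mapHomologicalComplex _).obj P) R N.a) where
  f i := psiAdj N (P.X i)
  comm' i j _ := psiAdj_naturality N (P.d j i)

/-- `Ext^i_R(M, N)`. -/
abbrev extMod (M N : ModuleCat.{u} R) (i : ℕ) : ModuleCat.{u} R :=
  ((Ext R (ModuleCat.{u} R) i).obj (op M)).obj N

/-- The map `Ext^i(M, N) ⟶ Ext^i(R¹ ⊗ M, N)` induced by the structure map `R¹ ⊗ M ⟶ M`. For
`M = R/I` the structure map is the projection `R/I^[p] ⟶ R/I`. -/
def extStr (M : RFMod R p) (N : ModuleCat.{u} R) (i : ℕ) :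
    extMod M.a N i ⟶ extMod ((pull R p).obj M.a) N i :=
  ((Ext R (ModuleCat.{u} R) i).map M.str.op).app N

variable [PreservesFiniteLimits (pull R p)]

/-- When the Frobenius functor is exact, `Ψ` induces a natural map
`R¹ ⊗ Ext^i(M, N) ⟶ Ext^i(R¹ ⊗ M, N)` on the derived functors of `Hom(-, N)`: for a projective
resolution `P` of `M`, it is the map `R¹ ⊗ H^i(Hom(P, N)) ⟶ H^i(Hom(R¹ ⊗ P, N))`. -/
def psiExt (N : RFMod R p) (M : ModuleCat.{u} R) (i : ℕ) :
    (pull R p).obj (extMod M N.a i) ⟶ extMod ((pull R p).obj M) N.a i :=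
  (pull R p).map ((projectiveResolution M).isoExt (R := R) i N.a).hom ≫
    homologyLift (psiComplex N (projectiveResolution M).complex) i ≫
    (((pull R p).mapProjectiveResolution (projectiveResolution M)).isoExt (R := R) i N.a).inv

end Homology

/-! ### The Čech complex and local cohomology -/

section Cech

variable {R : Type u} [CommRing R]

section Localization

variable {M : Type u} [AddCommGroup M] [Module R M]

/-- The localization `M_a = M[1/a]`. -/
abbrev Away (M : Type u) [AddCommGroup M] [Module R M] (a : R) : Type u :=
  LocalizedModule (Submonoid.powers a) M

/-- If `a ∣ b` then the powers of `a` are invertible on `M_b`. -/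
lemma isUnit_end_away {a b : R} (h : a ∣ b) (s : Submonoid.powers a) :
    IsUnit (algebraMap R (Module.End R (Away M b)) s) := by
  obtain ⟨_, n, rfl⟩ := s
  have hb : IsUnit (algebraMap R (Module.End R (Away M b)) b) :=
    IsLocalizedModule.map_units (LocalizedModule.mkLinearMap (Submonoid.powers b) M)
      ⟨b, Submonoid.mem_powers b⟩
  obtain ⟨c, rfl⟩ := h
  rw [map_mul, Commute.isUnit_mul_iff (Algebra.commutes a _)] at hb
  simpa using hb.1.pow n

/-- The canonical map `M_a → M_b`, `m / s ↦ m / s`, for `a ∣ b`. -/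
def awayMap (M : Type u) [AddCommGroup M] [Module R M] {a b : R} (h : a ∣ b) :
    Away M a →ₗ[R] Away M b :=
  LocalizedModule.lift (Submonoid.powers a)
    (LocalizedModule.mkLinearMap (Submonoid.powers b) M) (isUnit_end_away h)

lemma away_hom_ext {N : Type u} [AddCommGroup N] [Module R N] {a : R}
    (hN : ∀ s : Submonoid.powers a, IsUnit (algebraMap R (Module.End R N) s))
    {f g : Away M a →ₗ[R] N}
    (h : f ∘ₗ LocalizedModule.mkLinearMap (Submonoid.powers a) M =
      g ∘ₗ LocalizedModule.mkLinearMap (Submonoid.powers a) M) : f = g :=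
  IsLocalizedModule.ext _ (LocalizedModule.mkLinearMap (Submonoid.powers a) M) hN h

lemma awayMap_comp_mk {a b : R} (h : a ∣ b) :
    awayMap M h ∘ₗ LocalizedModule.mkLinearMap (Submonoid.powers a) M =
      LocalizedModule.mkLinearMap (Submonoid.powers b) M :=
  LocalizedModule.lift_comp _ _ _

lemma awayMap_awayMap {a b c : R} (h : a ∣ b) (h' : b ∣ c) (z : Away M a) :
    awayMap M h' (awayMap M h z) = awayMap M (h.trans h') z := by
  refine LinearMap.congr_fun (f := awayMap M h' ∘ₗ awayMap M h) ?_ z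
  apply away_hom_ext (isUnit_end_away (h.trans h'))
  rw [LinearMap.comp_assoc, awayMap_comp_mk, awayMap_comp_mk, awayMap_comp_mk]

variable {p : ℕ} [Fact p.Prime] [CharP R p]

/-- The Frobenius action `m / s ↦ F(m) / s ^ p` on the localization of a module with Frobenius
action `F`. -/
def awayFrob (F : M →ₛₗ[frobenius R p] M) (a : R) : Away M a →ₛₗ[frobenius R p] Away M a where
  toFun z := z.liftOn (fun ms => LocalizedModule.mk (F ms.1) (ms.2 ^ p)) (by
    rintro ⟨m, s⟩ ⟨m', s'⟩ ⟨c, hc⟩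
    refine LocalizedModule.mk_eq.mpr ⟨c ^ p, ?_⟩
    have := congrArg F hc
    simpa [Submonoid.smul_def, frobenius_def] using this)
  map_add' z w := by
    induction z, w using LocalizedModule.induction_on₂ with
    | h m m' s s' =>
      rw [LocalizedModule.mk_add_mk, LocalizedModule.liftOn_mk, LocalizedModule.liftOn_mk,
        LocalizedModule.liftOn_mk, LocalizedModule.mk_add_mk, mul_pow]
      simp [Submonoid.smul_def, frobenius_def]
  map_smul' r z := by
    induction z using LocalizedModule.induction_on with
    | h m s =>
      rw [LocalizedModule.smul'_mk, LocalizedModule.liftOn_mk, LocalizedModule.liftOn_mk,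
        LocalizedModule.smul'_mk, LinearMap.map_smulₛₗ]

lemma awayMap_mk {a b : R} (h : a ∣ b) (m : M) (s : Submonoid.powers a) (t : Submonoid.powers b)
    (c : R) (hc : (t : R) = s * c) :
    awayMap M h (LocalizedModule.mk m s) = LocalizedModule.mk (c • m) t := by
  apply ((Module.End.isUnit_iff _).mp (isUnit_end_away (M := M) h s)).injective
  rw [Module.algebraMap_end_apply, Module.algebraMap_end_apply, ← map_smul,
    LocalizedModule.smul'_mk, LocalizedModule.smul'_mk, smul_smul, ← hc]
  have h1 : LocalizedModule.mk ((s : R) • m) s =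
      LocalizedModule.mkLinearMap (Submonoid.powers a) M m := LocalizedModule.mk_cancel s m
  have h2 : LocalizedModule.mk ((t : R) • m) t =
      LocalizedModule.mkLinearMap (Submonoid.powers b) M m := LocalizedModule.mk_cancel t m
  rw [h1, h2]
  exact LinearMap.congr_fun (awayMap_comp_mk h) m

lemma awayMap_awayFrob (F : M →ₛₗ[frobenius R p] M) {a b : R} (h : a ∣ b) (z : Away M a) :
    awayMap M h (awayFrob F a z) = awayFrob F b (awayMap M h z) := by
  induction z using LocalizedModule.induction_on with
  | h m s =>
    obtain ⟨c, hc⟩ := h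
    obtain ⟨_, n, rfl⟩ := s
    have ht : b ^ n = a ^ n * c ^ n := by rw [hc, mul_pow]
    rw [awayMap_mk ⟨c, hc⟩ m _ ⟨b ^ n, n, rfl⟩ (c ^ n) ht]
    change awayMap M _ (LocalizedModule.mk (F m) _) = LocalizedModule.mk (F (c ^ n • m)) _
    rw [awayMap_mk ⟨c, hc⟩ (F m) _ (⟨b ^ n, n, rfl⟩ ^ p) ((c ^ n) ^ p)
      (by simp [hc, mul_pow]), LinearMap.map_smulₛₗ]
    rfl

end Localization

variable {r : ℕ} (x : Fin r → R) (M : Type u) [AddCommGroup M] [Module R M]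

/-- The product `x_{s₀} ⋯ x_{s_{k-1}}` for `s₀ < ⋯ < s_{k-1}`. -/
def cechProd {k : ℕ} (s : Fin k ↪o Fin r) : R := ∏ i, x (s i)

/-- Delete the `j`-th entry of an increasing sequence. -/
def face {k : ℕ} (s : Fin (k + 1) ↪o Fin r) (j : Fin (k + 1)) : Fin k ↪o Fin r :=
  (Fin.succAboveOrderEmb j).trans s

lemma cechProd_face_dvd {k : ℕ} (s : Fin (k + 1) ↪o Fin r) (j : Fin (k + 1)) :
    cechProd x (face s j) ∣ cechProd x s :=
  ⟨x (s j), by rw [cechProd, cechProd, Fin.prod_univ_succAbove _ j, mul_comm]; rfl⟩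

/-- The degree `k` term of the Čech complex, `⨁_{s₀ < ⋯ < s_{k-1}} M_{x_{s₀} ⋯ x_{s_{k-1}}}`. -/
abbrev CechTerm (k : ℕ) : Type u := ∀ s : Fin k ↪o Fin r, Away M (cechProd x s)

/-- The Čech differential, the alternating sum of the localization maps. -/
def cechD (k : ℕ) : CechTerm x M k →ₗ[R] CechTerm x M (k + 1) :=
  LinearMap.pi fun s => ∑ j : Fin (k + 1), (-1 : R) ^ (j : ℕ) •
    (awayMap M (cechProd_face_dvd x s j) ∘ₗ LinearMap.proj (face s j))

variable {M}

lemma cechD_apply {k : ℕ} (z : CechTerm x M k) (s : Fin (k + 1) ↪o Fin r) :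
    cechD x M k z s = ∑ j : Fin (k + 1), (-1 : R) ^ (j : ℕ) •
      awayMap M (cechProd_face_dvd x s j) (z (face s j)) := by
  simp only [cechD, LinearMap.pi_apply, LinearMap.sum_apply, LinearMap.smul_apply,
    LinearMap.comp_apply, LinearMap.proj_apply]

lemma awayMap_congr {k : ℕ} (z : CechTerm x M k) {t t' : Fin k ↪o Fin r} (h : t = t') {b : R}
    (ht : cechProd x t ∣ b) (ht' : cechProd x t' ∣ b) :
    awayMap M ht (z t) = awayMap M ht' (z t') := by
  subst h
  rfl

lemma face_face {k : ℕ} (s : Fin (k + 2) ↪o Fin r) (j : Fin (k + 2)) (i : Fin (k + 1)) :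
    face (face s (j.succAbove i)) (i.predAbove j) = face (face s j) i := by
  ext l
  simp [face, Fin.succAbove_succAbove_succAbove_predAbove]

lemma sign_face {R : Type u} [CommRing R] {k : ℕ} (j : Fin (k + 2)) (i : Fin (k + 1)) :
    (-1 : R) ^ ((j.succAbove i : Fin (k + 2)) : ℕ) * (-1) ^ ((i.predAbove j : Fin (k + 1)) : ℕ) =
      -((-1) ^ (j : ℕ) * (-1) ^ (i : ℕ)) := by
  rcases lt_or_ge i.castSucc j with h | h
  · rw [Fin.succAbove_of_castSucc_lt _ _ h, Fin.predAbove_of_castSucc_lt _ _ h]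
    obtain ⟨j, rfl⟩ := Fin.exists_succ_eq.mpr (Fin.ne_zero_of_lt h)
    simp [pow_succ, mul_comm]
  · rw [Fin.succAbove_of_le_castSucc _ _ h, Fin.predAbove_of_le_castSucc _ _ h]
    simp [pow_succ, mul_comm]

lemma cechD_cechD (k : ℕ) (z : CechTerm x M k) : cechD x M (k + 1) (cechD x M k z) = 0 := by
  funext s
  rw [cechD_apply]
  simp only [cechD_apply, map_sum, map_smul, Finset.smul_sum, smul_smul, awayMap_awayMap]
  rw [← Finset.sum_product', Finset.univ_product_univ]
  refine Finset.sum_involution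
    (fun (a : Fin (k + 2) × Fin (k + 1)) _ => (a.1.succAbove a.2, a.2.predAbove a.1))
    ?_ ?_ ?_ ?_
  · rintro ⟨j, i⟩ _
    dsimp only
    rw [sign_face (R := R), awayMap_congr x z (face_face s j i) _
      ((cechProd_face_dvd x (face s j) i).trans (cechProd_face_dvd x s j)), neg_smul,
      add_neg_cancel]
  · rintro ⟨j, i⟩ _ _ h
    exact Fin.succAbove_ne j i (congrArg Prod.fst h)
  · intro _ _
    exact Finset.mem_univ _
  · rintro ⟨j, i⟩ _
    simp [Fin.succAbove_succAbove_predAbove, Fin.predAbove_predAbove_succAbove]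

/-- The Čech complex `M → ⨁ M_{x_i} → ⨁ M_{x_i x_j} → ⋯ → M_{x_1 ⋯ x_r}`. -/
def cechComplex (M : ModuleCat.{u} R) : CochainComplex (ModuleCat.{u} R) ℕ :=
  CochainComplex.of (fun k => ModuleCat.of R (CechTerm x M k))
    (fun k => ModuleCat.ofHom (cechD x M k))
    (fun k => by
      ext : 1
      refine LinearMap.ext fun z => ?_
      exact cechD_cechD x k z)

variable {p : ℕ} [Fact p.Prime] [CharP R p]

/-- The Frobenius action on the terms of the Čech complex of an `R[F]`-module. -/
def cechFrob (M : RFMod R p) (k : ℕ) :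
    CechTerm x M.a k →ₛₗ[frobenius R p] CechTerm x M.a k where
  toFun z s := awayFrob M.action _ (z s)
  map_add' z w := by
    funext s
    exact map_add _ _ _
  map_smul' a z := by
    funext s
    exact LinearMap.map_smulₛₗ _ _ _

lemma cechFrob_cechD (M : RFMod R p) (k : ℕ) (z : CechTerm x M.a k) :
    cechD x M.a k (cechFrob x M k z) = cechFrob x M (k + 1) (cechD x M.a k z) := by
  funext s
  change _ = awayFrob M.action _ (cechD x M.a k z s)
  rw [cechD_apply, cechD_apply, map_sum]
  refine Finset.sum_congr rfl fun j _ => ?_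
  rw [LinearMap.map_smulₛₗ, map_pow, map_neg, map_one, ← awayMap_awayFrob]
  rfl

/-- The Frobenius action on the Čech complex of an `R[F]`-module, as a map of complexes. -/
def cechFrobHom (M : RFMod R p) :
    cechComplex x M.a ⟶ ((push R p).mapHomologicalComplex _).obj (cechComplex x M.a) where
  f k := ModuleCat.semilinearMapAddEquiv (frobenius R p)
    (ModuleCat.of R (CechTerm x M.a k)) (ModuleCat.of R (CechTerm x M.a k)) (cechFrob x M k)
  comm' i j h := by
    obtain rfl : i + 1 = j := h
    ext z : 2
    simp only [cechComplex, Functor.mapHomologicalComplex_obj_d, CochainComplex.of_d]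
    exact cechFrob_cechD x M i z

/-- The local cohomology `H^i_J(M)` of an `R[F]`-module `M`, where `J` is the ideal generated by
the family `x`, with its induced `R[F]`-module structure: it is the `i`-th cohomology of the Čech
complex, and Frobenius acts on it through the Frobenius actions on the localizations of `M`. -/
def RFMod.localCohomology (M : RFMod R p) (i : ℕ) : RFMod R p :=
  ⟨(cechComplex x M.a).homology i, homologyLift (cechFrobHom x M) i⟩

end Cech

/-! ### Injective hulls -/

/-- `E` is an injective hull of `M`: it is injective and an essential extension of `M`. -/
def IsInjectiveHull {R : Type u} [CommRing R] (M E : Type u) [AddCommGroup M] [Module R M]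
    [AddCommGroup E] [Module R E] : Prop :=
  Module.Injective R E ∧ ∃ f : M →ₗ[R] E, Function.Injective f ∧
    ∀ N : Submodule R E, N ⊓ LinearMap.range f = ⊥ → N = ⊥

/-- The extended Matlis dual of `R[F]`-modules over a local ring `R` of dimension `n` whose maximal
ideal is generated by the family `x`. Here `E` is the injective hull of the residue field, and it
carries the `R[F]`-module structure which it gets from a chosen isomorphism `e` with the top local
cohomology module `H^n_m(R)`. -/
def extMatlisDual {R : Type u} [CommRing R] {p : ℕ} [Fact p.Prime] [CharP R p]
    {r : ℕ} {x : Fin r → R} {n : ℕ} {E : ModuleCat.{u} R}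
    (e : E ≅ ((RFMod.ring R p).localCohomology x n).a) (M : RFMod R p) : RFMod R p :=
  RFMod.dual (((RFMod.ring R p).localCohomology x n).transport e) M

end FrobeniusModules
end

open FrobeniusModules

/-! Everything rests on one explicit injective resolution of `R`. The maximal ideal is generated by
a regular sequence of length n, so the Čech complex C of `R` on n such generators has cohomology
only in degree n: it is a flat resolution of the top local cohomology, which is E. Completeness
gives Hom(E, E) = R. Hence the modules Hom(C^{n-l}, E) form an injective resolution Q of `R`
(`DualData.res`). The terms of C and the module E are unit, and the action φ ↦ θ_E ∘ (R¹ ⊗ φ) ∘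
θ_C⁻¹ makes every term of Q unit.

The cochains of R/I are C/IC, so the elements of Q^j killed by I are the homomorphisms from C^i(R/I)
to E, where i + j = n. As E is injective, H^j(Hom(R/I, Q)) is the Matlis dual of H^i_m(R/I); as Q is
an injective resolution of `R`, it is also Ext^j(R/I, R). Each application of Frobenius replaces I
by its Frobenius power, so both directed systems of the theorem compute, in the limit, the
cohomology of the I-torsion of Q. This is H^j_I(R), because Čech complexes of injective modules over
a Noetherian ring are exact in positive degrees. `FrobRes.nonempty_colim_iso` carries out this
passage to the limit once, from data at the initial stage only; `DualData.nonempty_dual_iso` and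
`nonempty_generated_iso` are its two applications.

Frobenius is handled through a finite basis b_i of `R` over its Frobenius (`exists_frobBasis`). It
exists because a regular sequence acts on the pushforward of `R` by its p-th powers, which are again
regular, and a finite module of maximal depth is free. In such a basis R¹ ⊗ M is a finite sum of
copies of M, and M is unit exactly when every element is uniquely a sum of b_i F(m_i)
(`FrobBasis.isUnitRF_iff`). Exactness of the Frobenius functor, bijectivity of Ψ and unitness of
limits, localizations, cohomology and Hom modules become computations with coordinates.

The comparisons of cohomology are zigzags in double complexes, kept as relations between
representatives. A map of double complexes carries zigzags to zigzags, so linearity and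
compatibility with Frobenius come from the same argument (`DoubleComplex.Zigzag.map`).

Two facts about regular local rings remain. The equality c + d = n follows from the vanishing of
H^k_m(R) for k < n, which produces a regular sequence in I of length at least n - d. The isomorphism
of E with H^n_m(R) follows since, for each t, the part of H^n_m(R) killed by the t-th powers of the
parameters is R modulo these powers, and the corresponding part of E has no larger length. -/

noncomputable section

namespace FrobeniusModules

/-! ### Homology classes -/

section HomologyClass

variable {R : Type u} [CommRing R] {ι : Type} {c : ComplexShape ι}

/-- The cocycle `z` represents the homology class `h`. -/
def HasClass (K : HomologicalComplex (ModuleCat.{u} R) c) (i : ι) (z : K.X i)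
    (h : K.homology i) : Prop :=
  ∃ w : K.cycles i, (K.iCycles i).hom w = z ∧ (K.homologyπ i).hom w = h

variable {K L : HomologicalComplex (ModuleCat.{u} R) c} {i : ι}

lemma HasClass.exists_rep (h : K.homology i) : ∃ z, HasClass K i z h := by
  obtain ⟨w, rfl⟩ := (ModuleCat.epi_iff_surjective (K.homologyπ i)).mp inferInstance h
  exact ⟨_, w, rfl, rfl⟩

lemma HasClass.d_eq_zero {z : K.X i} {h : K.homology i} (hz : HasClass K i z h) (j : ι) :
    (K.d i j).hom z = 0 := by
  obtain ⟨w, rfl, -⟩ := hz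
  have := congrArg (fun f => f.hom w) (K.iCycles_d i j)
  exact this

lemma HasClass.exists_of_d_eq_zero {z : K.X i} (hz : ∀ j, (K.d i j).hom z = 0) :
    ∃ h, HasClass K i z h := by
  have hz' : (K.sc i).g.hom z = 0 := hz _
  let f : ModuleCat.of R (LinearMap.ker (K.sc i).g.hom) ⟶ (K.sc i).X₂ :=
    ModuleCat.ofHom (LinearMap.ker (K.sc i).g.hom).subtype
  have hf : f ≫ (K.sc i).g = 0 := by
    ext x
    exact x.2
  refine ⟨_, ((K.sc i).liftCycles f hf).hom ⟨z, hz'⟩, ?_, rfl⟩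
  have := congrArg (fun g => g.hom ⟨z, hz'⟩) ((K.sc i).liftCycles_i f hf)
  exact this

lemma HasClass.add {z z' : K.X i} {h h' : K.homology i} (hz : HasClass K i z h)
    (hz' : HasClass K i z' h') : HasClass K i (z + z') (h + h') := by
  obtain ⟨w, rfl, rfl⟩ := hz
  obtain ⟨w', rfl, rfl⟩ := hz'
  exact ⟨w + w', map_add _ _ _, map_add _ _ _⟩

lemma HasClass.smul (a : R) {z : K.X i} {h : K.homology i} (hz : HasClass K i z h) :
    HasClass K i (a • z) (a • h) := by
  obtain ⟨w, rfl, rfl⟩ := hz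
  exact ⟨a • w, map_smul _ _ _, map_smul _ _ _⟩

lemma HasClass.zero : HasClass K i 0 0 := ⟨0, map_zero _, map_zero _⟩

lemma HasClass.neg {z : K.X i} {h : K.homology i} (hz : HasClass K i z h) :
    HasClass K i (-z) (-h) := by
  simpa using hz.smul (-1)

lemma HasClass.sub {z z' : K.X i} {h h' : K.homology i} (hz : HasClass K i z h)
    (hz' : HasClass K i z' h') : HasClass K i (z - z') (h - h') := by
  simpa [sub_eq_add_neg] using hz.add hz'.neg

lemma HasClass.sum {α : Type*} (s : Finset α) {z : α → K.X i} {h : α → K.homology i}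
    (hz : ∀ a ∈ s, HasClass K i (z a) (h a)) :
    HasClass K i (∑ a ∈ s, z a) (∑ a ∈ s, h a) := by
  classical
  induction s using Finset.induction_on with
  | empty => simpa using HasClass.zero
  | insert a s ha ih =>
    rw [Finset.sum_insert ha, Finset.sum_insert ha]
    exact (hz a (Finset.mem_insert_self a s)).add
      (ih fun b hb => hz b (Finset.mem_insert_of_mem hb))

lemma HasClass.unique {z : K.X i} {h h' : K.homology i} (hz : HasClass K i z h)
    (hz' : HasClass K i z h') : h = h' := by
  obtain ⟨w, rfl, rfl⟩ := hz
  obtain ⟨w', hw, rfl⟩ := hz'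
  rw [(ModuleCat.mono_iff_injective (K.iCycles i)).mp inferInstance hw]

lemma HasClass.of_d {j : ι} (w : K.X j) : HasClass K i ((K.d j i).hom w) 0 := by
  refine ⟨(K.toCycles j i).hom w, ?_, ?_⟩
  · exact congrArg (fun f => f.hom w) (K.toCycles_i j i)
  · exact congrArg (fun f => f.hom w) (K.toCycles_comp_homologyπ j i)

lemma HasClass.exists_of_zero {z : K.X i} (hz : HasClass K i z 0) :
    ∃ (j : ι) (w : K.X j), (K.d j i).hom w = z := by
  obtain ⟨w, rfl, hw⟩ := hz
  have hex : (ShortComplex.mk (K.toCycles (c.prev i) i) (K.homologyπ i) (by simp)).Exact :=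
    ShortComplex.exact_of_g_is_cokernel _ (K.homologyIsCokernel (c.prev i) i rfl)
  obtain ⟨v, hv⟩ := (ShortComplex.moduleCat_exact_iff _).mp hex w hw
  refine ⟨c.prev i, v, ?_⟩
  have := congrArg (fun f => f.hom v) (K.toCycles_i (c.prev i) i)
  rw [← hv]
  exact this.symm

lemma HasClass.map (f : K ⟶ L) {z : K.X i} {h : K.homology i} (hz : HasClass K i z h) :
    HasClass L i ((f.f i).hom z) ((HomologicalComplex.homologyMap f i).hom h) := by
  obtain ⟨w, rfl, rfl⟩ := hz
  refine ⟨(HomologicalComplex.cyclesMap f i).hom w, ?_, ?_⟩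
  · exact congrArg (fun g => g.hom w) (HomologicalComplex.cyclesMap_i f i)
  · exact (congrArg (fun g => g.hom w) (HomologicalComplex.homologyπ_naturality f i)).symm

/-- Both comparison isomorphisms can be computed from one left homology datum of `S` and its image
under `F`, which reduces the square to the defining squares of that datum. It is needed to follow
cocycles through restriction of scalars along Frobenius. -/
lemma homologyπ_comp_mapHomologyIso_hom {C D : Type*} [Category* C] [Category* D]
    [HasZeroMorphisms C] [HasZeroMorphisms D] (S : ShortComplex C) (F : C ⥤ D)
    [F.PreservesZeroMorphisms] [S.HasHomology] [(S.map F).HasHomology]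
    [F.PreservesLeftHomologyOf S] :
    (S.map F).homologyπ ≫ (S.mapHomologyIso F).hom =
      (S.mapCyclesIso F).hom ≫ F.map S.homologyπ := by
  set hl := S.homologyData.left
  have h1 : (S.mapHomologyIso F).hom = (hl.map F).homologyIso.hom ≫ F.map hl.homologyIso.inv :=
    congrArg Iso.hom (hl.mapHomologyIso_eq F)
  have h2 : (S.mapCyclesIso F).hom = (hl.map F).cyclesIso.hom ≫ F.map hl.cyclesIso.inv :=
    congrArg Iso.hom (hl.mapCyclesIso_eq F)
  have h3 : (S.map F).homologyπ ≫ (hl.map F).homologyIso.hom =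
      (hl.map F).cyclesIso.hom ≫ F.map hl.π := (hl.map F).homologyπ_comp_homologyIso_hom
  have h4 : hl.π ≫ hl.homologyIso.inv = hl.cyclesIso.inv ≫ S.homologyπ :=
    hl.π_comp_homologyIso_inv
  rw [h1, h2]
  refine ((Category.assoc _ _ _).symm.trans
    (congrArg (· ≫ F.map hl.homologyIso.inv) h3)).trans ((Category.assoc _ _ _).trans ?_)
  refine (congrArg ((hl.map F).cyclesIso.hom ≫ ·) ((F.map_comp _ _).symm.trans
    ((congrArg F.map h4).trans (F.map_comp _ _)))).trans ?_
  exact (Category.assoc _ _ _).symm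

variable {p : ℕ} [Fact p.Prime] [CharP R p]

/-- The Frobenius on cohomology is found by applying the p-linear chain map to a cocycle. The
actions on local cohomology and the maps Ψ on Ext are both computed this way. -/
lemma HasClass.homologyLift (φ : K ⟶ ((push R p).mapHomologicalComplex c).obj L) {z : K.X i}
    {h : K.homology i} (hz : HasClass K i z h) :
    HasClass L i ((φ.f i).hom z) (delinearize (homologyLift φ i) h) := by
  have key : delinearize (FrobeniusModules.homologyLift φ i) h =
      (((L.sc i).mapHomologyIso (push R p)).hom).hom
        ((HomologicalComplex.homologyMap φ i).hom h) := by
    rw [FrobeniusModules.homologyLift, delinearize, Equiv.apply_symm_apply]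
    rfl
  obtain ⟨w, hw, hw'⟩ := hz.map φ
  rw [key, ← hw']
  refine ⟨(((L.sc i).mapCyclesIso (push R p)).hom).hom w, ?_, ?_⟩
  · rw [← hw]
    exact congrArg (fun g => g.hom w) ((L.sc i).mapCyclesIso_hom_iCycles (push R p))
  · exact (congrArg (fun g => g.hom w) (homologyπ_comp_mapHomologyIso_hom (L.sc i) (push R p))).symm

end HomologyClass

/-! ### Bases of the ring over its Frobenius -/

section FrobBasis

variable (R : Type u) [CommRing R] (p : ℕ) [Fact p.Prime] [CharP R p]

/-- A basis of `R` as a module over itself through the Frobenius. -/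
abbrev FrobBasis (κ : Type) := Module.Basis κ R ((push R p).obj (ModuleCat.of R R))

variable {R p} {κ : Type} [Fintype κ] (B : FrobBasis R p κ)

/-- The elements of a Frobenius basis. -/
def FrobBasis.val (i : κ) : R := B i

/-- The `p`-linear map `m ↦ 1 ⊗ m`. -/
def tau (M : ModuleCat.{u} R) : M →ₛₗ[frobenius R p] (pull R p).obj M :=
  delinearize (𝟙 ((pull R p).obj M))

lemma delinearize_eq {M N : ModuleCat.{u} R} (θ : (pull R p).obj M ⟶ N) (m : M) :
    delinearize θ m = θ.hom (tau M m) := by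
  rw [tau, ← delinearize_comp, Category.id_comp]

lemma pull_map_tau {M N : ModuleCat.{u} R} (f : M ⟶ N) (m : M) :
    ((pull R p).map f).hom (tau M m) = tau N (f.hom m) := by
  rw [← delinearize_eq, tau, ← delinearize_map_comp, Category.comp_id]

-- A basis of the left tensor factor makes R¹ ⊗ M a direct sum of copies of M, and the sums on the
-- left are the coordinates of this decomposition.
open scoped Classical in
lemma FrobBasis.sum_smul_tau (M : ModuleCat.{u} R) (m : κ → M) :
    ∑ i, B.val i • tau (p := p) M (m i) =
      (TensorProduct.equivFinsuppOfBasisLeft (N := M) B).symm (Finsupp.equivFunOnFinite.symm m) := by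
  rw [TensorProduct.equivFinsuppOfBasisLeft_symm_apply, Finsupp.sum_fintype _ _ (by simp)]
  refine Finset.sum_congr rfl fun i _ => ?_
  have : tau (p := p) M (m i) =
    TensorProduct.tmul (R := R) (M := (push R p).obj (ModuleCat.of R R)) (1 : R) (m i) := rfl
  rw [this]
  refine (ModuleCat.ExtendScalars.smul_tmul (f := frobenius R p) _ _ _).trans ?_
  rw [mul_one]
  rfl

lemma FrobBasis.exists_eq_sum_tau (M : ModuleCat.{u} R) (t : (pull R p).obj M) :
    ∃ m : κ → M, t = ∑ i, B.val i • tau M (m i) := by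
  classical
  refine ⟨Finsupp.equivFunOnFinite ((TensorProduct.equivFinsuppOfBasisLeft (N := M) B) t), ?_⟩
  rw [B.sum_smul_tau, Equiv.symm_apply_apply]
  exact (LinearEquiv.symm_apply_apply _ _).symm

lemma FrobBasis.eq_zero_of_sum_tau {M : ModuleCat.{u} R} {m : κ → M}
    (h : ∑ i, B.val i • tau (p := p) M (m i) = 0) (i : κ) : m i = 0 := by
  classical
  rw [B.sum_smul_tau] at h
  have h' := (LinearEquiv.map_eq_zero_iff _).mp h
  have := DFunLike.congr_fun h' i
  simpa using this

lemma FrobBasis.exists_eq_sum (r : R) : ∃ s : κ → R, r = ∑ i, B.val i * s i ^ p := by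
  refine ⟨fun i => B.repr r i, (B.sum_repr r).symm.trans (Finset.sum_congr rfl fun i _ => ?_)⟩
  exact mul_comm (frobenius R p (B.repr r i)) (B.val i)

lemma FrobBasis.eq_zero_of_sum {s : κ → R} (h : ∑ i, B.val i * s i ^ p = 0) (i : κ) :
    s i = 0 := by
  refine Fintype.linearIndependent_iff.mp B.linearIndependent s (Eq.trans ?_ h) i
  exact Finset.sum_congr rfl fun i _ => mul_comm (frobenius R p (s i)) (B.val i)

/-- A morphism out of `R¹ ⊗ M` is an isomorphism as soon as every element of the target is uniquely
a combination of images of the elements `1 ⊗ m` with coefficients in the basis. -/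
lemma FrobBasis.isIso_of {M N : ModuleCat.{u} R} (θ : (pull R p).obj M ⟶ N)
    (hs : ∀ n : N, ∃ m : κ → M, n = ∑ i, B.val i • delinearize θ (m i))
    (hi : ∀ m : κ → M, ∑ i, B.val i • delinearize θ (m i) = 0 → ∀ i, m i = 0) : IsIso θ := by
  have key : ∀ m : κ → M, θ.hom (∑ i, B.val i • tau M (m i)) =
      ∑ i, B.val i • delinearize θ (m i) := fun m => by
    simp [delinearize_eq]
  rw [ConcreteCategory.isIso_iff_bijective]
  constructor
  · refine (injective_iff_map_eq_zero θ.hom).mpr fun t ht => ?_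
    obtain ⟨m, rfl⟩ := B.exists_eq_sum_tau M t
    rw [key] at ht
    simp [hi m ht]
  · intro n
    obtain ⟨m, rfl⟩ := hs n
    exact ⟨_, key m⟩

lemma FrobBasis.exists_eq_sum_of_isIso {M N : ModuleCat.{u} R} (θ : (pull R p).obj M ⟶ N)
    [IsIso θ] (n : N) : ∃ m : κ → M, n = ∑ i, B.val i • delinearize θ (m i) := by
  obtain ⟨t, rfl⟩ := (ConcreteCategory.isIso_iff_bijective θ).mp inferInstance |>.2 n
  obtain ⟨m, rfl⟩ := B.exists_eq_sum_tau M t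
  refine ⟨m, ?_⟩
  change θ.hom _ = _
  simp [delinearize_eq]

lemma FrobBasis.eq_zero_of_isIso {M N : ModuleCat.{u} R} (θ : (pull R p).obj M ⟶ N)
    [IsIso θ] {m : κ → M} (h : ∑ i, B.val i • delinearize θ (m i) = 0) (i : κ) : m i = 0 := by
  refine B.eq_zero_of_sum_tau (p := p) ?_ i
  apply (ConcreteCategory.isIso_iff_bijective θ).mp inferInstance |>.1
  change θ.hom _ = θ.hom 0
  simpa [delinearize_eq] using h

/-- In coordinates the structure map is (m_i) ↦ Σ b_i F(m_i). This turns unitness into an existence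
and uniqueness statement about elements. -/
lemma FrobBasis.isUnitRF_iff (M : RFMod R p) :
    IsUnitRF M ↔ (∀ n : M.a, ∃ m : κ → M.a, n = ∑ i, B.val i • M.action (m i)) ∧
      ∀ m : κ → M.a, ∑ i, B.val i • M.action (m i) = 0 → ∀ i, m i = 0 := by
  refine ⟨fun h => ?_, fun h => B.isIso_of M.str h.1 h.2⟩
  have : IsIso M.str := h
  exact ⟨B.exists_eq_sum_of_isIso M.str, fun m hm => B.eq_zero_of_isIso M.str hm⟩

lemma RFMod.action_ofAction (M : ModuleCat.{u} R) (F : M →ₛₗ[frobenius R p] M) :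
    (RFMod.ofAction M F).action = F := delinearize_linearize F

/-- A linear map which commutes with the Frobenius actions is a morphism of `R[F]`-modules. -/
def RFMod.homMk {M N : RFMod R p} (f : M.a ⟶ N.a)
    (hf : ∀ m, f.hom (M.action m) = N.action (f.hom m)) : M ⟶ N where
  f := f
  h := delinearize_injective fun m => by
    rw [delinearize_map_comp, delinearize_comp]
    exact (hf m).symm

lemma RFMod.hom_action {M N : RFMod R p} (f : M ⟶ N) (m : M.a) :
    f.f.hom (M.action m) = N.action (f.f.hom m) := by
  have := congrArg (fun g => delinearize g m) f.h
  simp only [delinearize_comp] at this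
  exact this.symm

/-- A linear equivalence which commutes with the Frobenius actions is an isomorphism of
`R[F]`-modules. -/
def RFMod.isoMk {M N : RFMod R p} (e : M.a ≃ₗ[R] N.a)
    (he : ∀ m, e (M.action m) = N.action (e m)) : M ≅ N :=
  Endofunctor.Algebra.isoMk e.toModuleIso (RFMod.homMk (M := M) (N := N) e.toModuleIso.hom he).h

/-- Evaluation of homomorphisms at an element. -/
def homEval {M N : ModuleCat.{u} R} (m : M) : (homInto N).obj (op M) →ₗ[R] N where
  toFun φ := ModuleCat.Hom.hom (show M ⟶ N from φ) m
  map_add' _ _ := rfl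
  map_smul' _ _ := rfl

lemma homEval_ext {M N : ModuleCat.{u} R} {φ ψ : (homInto N).obj (op M)}
    (h : ∀ m : M, homEval m φ = homEval m ψ) : φ = ψ :=
  ModuleCat.hom_ext (LinearMap.ext h)

lemma homEval_ext_tau {M N : ModuleCat.{u} R} {φ ψ : (homInto N).obj (op ((pull R p).obj M))}
    (h : ∀ m : M, homEval (tau M m) φ = homEval (tau M m) ψ) : φ = ψ :=
  delinearize_injective (θ := (show (pull R p).obj M ⟶ N from φ)) fun m => by
    refine (delinearize_eq (show (pull R p).obj M ⟶ N from φ) m).trans ((h m).trans ?_)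
    exact (delinearize_eq (show (pull R p).obj M ⟶ N from ψ) m).symm

lemma psi_delinearize (N : RFMod R p) (M : ModuleCat.{u} R) (φ : (homInto N.a).obj (op M)) (m : M) :
    homEval (tau M m) (delinearize (psi N M) φ) = N.action (homEval m φ) := by
  rw [psi, delinearize_linearize]
  change ((pull R p).map (show M ⟶ N.a from φ) ≫ N.str).hom (tau M m) = _
  rw [← delinearize_eq, delinearize_map_comp]
  rfl

/-- The coordinates of an element of a unit `R[F]`-module. -/
lemma FrobBasis.exists_coord {N : RFMod R p} (hN : IsUnitRF N) :
    ∃ coord : κ → N.a → N.a, (∀ n, n = ∑ i, B.val i • N.action (coord i n)) ∧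
      (∀ n n' i, coord i (n + n') = coord i n + coord i n') ∧
      ∀ (a : R) n i, coord i (a ^ p • n) = a • coord i n := by
  obtain ⟨h1, h2⟩ := (B.isUnitRF_iff N).mp hN
  choose m hm using h1
  have uniq : ∀ f g : κ → N.a, ∑ i, B.val i • N.action (f i) = ∑ i, B.val i • N.action (g i) →
      ∀ i, f i = g i := fun f g h i => by
    rw [← sub_eq_zero]
    refine h2 (fun i => f i - g i) ?_ i
    simp only [map_sub, smul_sub, Finset.sum_sub_distrib, h, sub_self]
  -- Uniqueness of the expansion forces the coordinates to be additive and p⁻¹-linear.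
  refine ⟨fun i n => m n i, hm, fun n n' => uniq _ (fun i => m n i + m n' i) ?_,
    fun a n => uniq _ (fun i => a • m n i) ?_⟩
  · simp only [map_add, smul_add, Finset.sum_add_distrib]
    rw [← hm, ← hm, ← hm]
  · rw [← hm]
    simp only [LinearMap.map_smulₛₗ, frobenius_def, smul_comm _ (a ^ p)]
    rw [← Finset.smul_sum, ← hm]

lemma FrobBasis.sum_psi_tau (N : RFMod R p) {M : ModuleCat.{u} R}
    (φ : κ → (homInto N.a).obj (op M)) (m : M) :
    homEval (tau M m) (∑ i, B.val i • delinearize (psi N M) (φ i)) =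
      ∑ i, B.val i • N.action (homEval m (φ i)) := by
  simp only [map_sum, map_smul, psi_delinearize]

/-- The coefficients of f are the maps m ↦ coord_i(f(1 ⊗ m)): a p-linear map followed by a
p⁻¹-linear one is linear. Finiteness of the basis replaces any finiteness of `M`. -/
lemma FrobBasis.isIso_psi (B : FrobBasis R p κ) {N : RFMod R p} (hN : IsUnitRF N) (M : ModuleCat.{u} R) :
    IsIso (psi N M) := by
  apply B.isIso_of
  · intro f
    obtain ⟨coord, h1, h2, h3⟩ := B.exists_coord hN
    let g : κ → M →ₗ[R] N.a := fun i =>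
      { toFun := fun m => coord i (homEval (tau M m) f)
        map_add' := fun m m' => by
          rw [← h2, map_add]
          exact congrArg _ (map_add (ModuleCat.Hom.hom (show (pull R p).obj M ⟶ N.a from f)) _ _)
        map_smul' := fun a m => by
          rw [RingHom.id_apply, ← h3, LinearMap.map_smulₛₗ]
          exact congrArg _ (map_smul (ModuleCat.Hom.hom (show (pull R p).obj M ⟶ N.a from f)) _ _) }
    let φ : κ → (homInto N.a).obj (op M) := fun i => ModuleCat.ofHom (g i)
    have hφ : ∀ i m, homEval m (φ i) = coord i (homEval (tau M m) f) := fun i m => rfl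
    refine ⟨φ, homEval_ext_tau fun m => ?_⟩
    rw [B.sum_psi_tau]
    simp only [hφ]
    exact h1 _
  · intro φ h i
    refine homEval_ext fun m => ?_
    rw [map_zero]
    refine ((B.isUnitRF_iff N).mp hN).2 (fun i => homEval m (φ i)) ?_ i
    rw [← B.sum_psi_tau, h, map_zero]

end FrobBasis

/-! ### Unit modules as direct limits -/

section ColimUnit

variable {R : Type u} [CommRing R] {p : ℕ} [Fact p.Prime] [CharP R p]
variable {X : ℕ ⥤ ModuleCat.{u} R} {t : ∀ n, (pull R p).obj (X.obj n) ⟶ X.obj (n + 1)}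
  {ht : ∀ n, (pull R p).map (X.map (homOfLE (Nat.le_add_right n 1))) ≫ t (n + 1) =
      t n ≫ X.map (homOfLE (Nat.le_add_right (n + 1) 1))}

variable (X t ht) in
/-- The canonical map to the direct limit. -/
def RFMod.colimι (n : ℕ) : X.obj n →ₗ[R] (RFMod.colim X t ht).a := (colimit.ι X n).hom

lemma RFMod.colim_action (n : ℕ) (x : X.obj n) :
    (RFMod.colim X t ht).action (RFMod.colimι X t ht n x) =
      RFMod.colimι X t ht (n + 1) (delinearize (t n) x) :=
  congrArg (fun f => delinearize f x) (RFMod.ι_colim_str X t ht n)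

lemma pull_map_comp_of_le (ht : ∀ n, (pull R p).map (X.map (homOfLE (Nat.le_add_right n 1))) ≫
      t (n + 1) = t n ≫ X.map (homOfLE (Nat.le_add_right (n + 1) 1))) {m n : ℕ} (h : m ≤ n) :
    (pull R p).map (X.map (homOfLE h)) ≫ t n =
      t m ≫ X.map (homOfLE (Nat.succ_le_succ h)) := by
  induction n, h using Nat.le_induction with
  | base =>
    rw [show homOfLE (le_refl m) = 𝟙 m from rfl, X.map_id, (pull R p).map_id, Category.id_comp]
    exact (Category.comp_id _).symm.trans (congrArg (t m ≫ ·) (X.map_id _).symm)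
  | succ n h ih =>
    rw [← homOfLE_comp h (Nat.le_add_right n 1), X.map_comp, (pull R p).map_comp, Category.assoc,
      ht, ← Category.assoc, ih, Category.assoc, ← X.map_comp, homOfLE_comp]

lemma delinearize_map_of_le (ht : ∀ n, (pull R p).map (X.map (homOfLE (Nat.le_add_right n 1))) ≫
      t (n + 1) = t n ≫ X.map (homOfLE (Nat.le_add_right (n + 1) 1))) {m n : ℕ} (h : m ≤ n)
    (x : X.obj m) : delinearize (t n) ((X.map (homOfLE h)).hom x) =
      (X.map (homOfLE (Nat.succ_le_succ h))).hom (delinearize (t m) x) := by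
  rw [← delinearize_map_comp, pull_map_comp_of_le ht, delinearize_comp]

lemma preservesColimit_forget (X : ℕ ⥤ ModuleCat.{u} R) :
    PreservesColimit X (forget (ModuleCat.{u} R)) := by
  have : PreservesFilteredColimitsOfSize.{0, 0} (forget (ModuleCat.{u} R)) :=
    preservesFilteredColimitsOfSize_shrink.{0, u, 0, u} _
  have := PreservesFilteredColimitsOfSize.preserves_filtered_colimits
    (F := forget (ModuleCat.{u} R)) ℕ
  infer_instance

lemma colimι_exists_rep (z : (RFMod.colim X t ht).a) :
    ∃ (n : ℕ) (x : X.obj n), RFMod.colimι X t ht n x = z :=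
  have := preservesColimit_forget X
  Concrete.colimit_exists_rep X z

lemma colimι_map {m n : ℕ} (h : m ≤ n) (x : X.obj m) :
    RFMod.colimι X t ht n ((X.map (homOfLE h)).hom x) = RFMod.colimι X t ht m x :=
  congrArg (fun f => f.hom x) (colimit.w X (homOfLE h))

lemma colimι_eq_zero {n : ℕ} {x : X.obj n} (h : RFMod.colimι X t ht n x = 0) :
    ∃ (k : ℕ) (hk : n ≤ k), (X.map (homOfLE hk)).hom x = 0 := by
  have := preservesColimit_forget X
  obtain ⟨k, f, g, hfg⟩ := Concrete.colimit_exists_of_rep_eq X x (0 : X.obj n)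
    (h.trans (map_zero (colimit.ι X n).hom).symm)
  have h1 : (X.map f).hom x = (X.map g).hom 0 := hfg
  rw [map_zero] at h1
  exact ⟨k, leOfHom f, h1⟩

lemma map_map_of_le {l m n : ℕ} (h : l ≤ m) (h' : m ≤ n) (x : X.obj l) :
    (X.map (homOfLE h')).hom ((X.map (homOfLE h)).hom x) =
      (X.map (homOfLE (h.trans h'))).hom x := by
  rw [← homOfLE_comp h h', X.map_comp]
  rfl

lemma colimι_exists_rep_fintype {κ : Type} [Fintype κ] (z : κ → (RFMod.colim X t ht).a) :
    ∃ (n : ℕ) (x : κ → X.obj n), ∀ i, RFMod.colimι X t ht n (x i) = z i := by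
  choose n x hx using fun i => colimι_exists_rep (z i)
  refine ⟨Finset.univ.sup n, fun i =>
    (X.map (homOfLE (Finset.le_sup (Finset.mem_univ i)))).hom (x i), fun i => ?_⟩
  rw [colimι_map, hx]

variable {κ : Type} [Fintype κ]

/-- An element of stage n is expanded after moving it to stage n + 1, where `t n` is bijective. A
relation that dies in the limit already dies at a finite stage k + 1, and bijectivity of `t k` kills
its coefficients at stage k. -/
lemma FrobBasis.isUnitRF_colim (B : FrobBasis R p κ) (hiso : ∀ n, IsIso (t n)) :
    IsUnitRF (RFMod.colim X t ht) := by
  rw [B.isUnitRF_iff]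
  constructor
  · intro z
    obtain ⟨n, x, rfl⟩ := colimι_exists_rep z
    rw [← colimι_map (Nat.le_add_right n 1)]
    obtain ⟨m, hm⟩ := B.exists_eq_sum_of_isIso (t n) ((X.map (homOfLE (Nat.le_add_right n 1))).hom x)
    refine ⟨fun i => RFMod.colimι X t ht n (m i), ?_⟩
    simp only [RFMod.colim_action]
    rw [hm, map_sum]
    simp only [map_smul]
  · intro z hz
    obtain ⟨n, x, hx⟩ := colimι_exists_rep_fintype z
    have h0 : RFMod.colimι X t ht (n + 1) (∑ i, B.val i • delinearize (t n) (x i)) = 0 := by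
      rw [← hz, map_sum]
      simp only [map_smul, ← hx, RFMod.colim_action]
    obtain ⟨k, hk, hk0⟩ := colimι_eq_zero h0
    obtain ⟨k, rfl⟩ := Nat.exists_eq_add_of_le' (Nat.one_le_of_lt hk)
    have hnk : n ≤ k := Nat.succ_le_succ_iff.mp hk
    have h1 : ∑ i, B.val i • delinearize (t k) ((X.map (homOfLE hnk)).hom (x i)) = 0 := by
      rw [← hk0, map_sum]
      simp only [map_smul, delinearize_map_of_le ht]
    intro i
    rw [← hx, ← colimι_map hnk, B.eq_zero_of_isIso (t k) h1 i, map_zero]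

/-- A criterion for a unit `R[F]`-module `Y` to be the limit of a directed system
`X₀ ⟶ X₁ ⟶ ⋯` with isomorphisms `R¹ ⊗ Xₙ ≅ Xₙ₊₁`, in terms of a map `X₀ ⟶ Y`. -/
theorem FrobBasis.nonempty_colim_iso (B : FrobBasis R p κ) (hiso : ∀ n, IsIso (t n))
    {Y : RFMod R p} (hY : IsUnitRF Y) (f : X.obj 0 ⟶ Y.a)
    (hf : ∀ (x : X.obj 0) (x' : κ → X.obj 0), (X.map (homOfLE (Nat.le_add_right 0 1))).hom x =
      ∑ i, B.val i • delinearize (t 0) (x' i) →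
      f.hom x = ∑ i, B.val i • Y.action (f.hom (x' i)))
    (P : ℕ → X.obj 0 → Prop) (hP0 : ∀ x, P 0 x → x = 0)
    (hPs : ∀ k x, P (k + 1) x → ∀ x' : κ → X.obj 0,
      (X.map (homOfLE (Nat.le_add_right 0 1))).hom x =
        ∑ i, B.val i • delinearize (t 0) (x' i) → ∀ i, P k (x' i))
    (hPf : ∀ x, f.hom x = 0 → ∃ k, P k x)
    (G : ℕ → Y.a → Prop) (hG0 : ∀ y, G 0 y → ∃ x, f.hom x = y)
    (hGs : ∀ k y, G (k + 1) y → ∃ y' : κ → Y.a, y = ∑ i, B.val i • Y.action (y' i) ∧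
      ∀ i, G k (y' i))
    (hG : ∀ y, ∃ k, G k y) :
    Nonempty (RFMod.colim X t ht ≅ Y) := by
  have hsucc : ∀ n, ∀ x : X.obj (n + 1), ∃ x' : κ → X.obj n,
      x = ∑ i, B.val i • delinearize (t n) (x' i) := fun n => B.exists_eq_sum_of_isIso (t n)
  -- The only choice compatible with Frobenius: each next map is the Frobenius pullback of the
  -- previous one, carried over by the isomorphism `t n`.
  let g : ∀ n, X.obj n ⟶ Y.a := fun n => Nat.rec (motive := fun n => X.obj n ⟶ Y.a) f
    (fun n gn => inv (t n) ≫ (pull R p).map gn ≫ Y.str) n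
  have hg0 : g 0 = f := rfl
  have hgs : ∀ n, t n ≫ g (n + 1) = (pull R p).map (g n) ≫ Y.str := fun n =>
    IsIso.hom_inv_id_assoc _ _
  have hgs' : ∀ n (x : X.obj n), (g (n + 1)).hom (delinearize (t n) x) =
      Y.action ((g n).hom x) := fun n x => by
    rw [← delinearize_comp, hgs]
    rfl
  have hgsum : ∀ n (x' : κ → X.obj n), (g (n + 1)).hom (∑ i, B.val i • delinearize (t n) (x' i)) =
      ∑ i, B.val i • Y.action ((g n).hom (x' i)) := fun n x' => by
    simp only [map_sum, map_smul, hgs']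
  have hmap : ∀ n (x : X.obj n), (g (n + 1)).hom ((X.map (homOfLE (Nat.le_add_right n 1))).hom x) =
      (g n).hom x := by
    intro n
    induction n with
    | zero =>
      intro x
      obtain ⟨x', hx'⟩ := hsucc 0 ((X.map (homOfLE (Nat.le_add_right 0 1))).hom x)
      rw [hx', hgsum]
      exact (hf x x' hx').symm
    | succ n ih =>
      intro x
      obtain ⟨x', rfl⟩ := hsucc n x
      rw [hgsum, map_sum]
      simp only [map_smul]
      have : ∀ i, (X.map (homOfLE (Nat.le_add_right (n + 1) 1))).hom (delinearize (t n) (x' i)) =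
          delinearize (t (n + 1)) ((X.map (homOfLE (Nat.le_add_right n 1))).hom (x' i)) :=
        fun i => (delinearize_map_of_le ht (Nat.le_add_right n 1) (x' i)).symm
      simp only [this]
      rw [hgsum]
      simp only [ih]
  let cc : Cocone X :=
    { pt := Y.a
      ι := NatTrans.ofSequence g (fun n => by
        ext x
        exact hmap n x) }
  let D : (RFMod.colim X t ht).a ⟶ Y.a := colimit.desc X cc
  have hD : ∀ n (x : X.obj n), D.hom (RFMod.colimι X t ht n x) = (g n).hom x := fun n x =>
    congrArg (fun f => f.hom x) (colimit.ι_desc cc n)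
  -- `P k` is designed to force vanishing at stage k: passing to the coefficients at stage 1 lowers
  -- k by one.
  have hPk : ∀ k x, P k x → (X.map (homOfLE (Nat.zero_le k))).hom x = 0 := by
    intro k
    induction k with
    | zero =>
      intro x hx
      rw [hP0 x hx, map_zero]
    | succ k ih =>
      intro x hx
      obtain ⟨x', hx'⟩ := hsucc 0 ((X.map (homOfLE (Nat.le_add_right 0 1))).hom x)
      rw [← map_map_of_le (Nat.le_add_right 0 1) (Nat.succ_le_succ (Nat.zero_le k)), hx', map_sum]
      refine Finset.sum_eq_zero fun i _ => ?_
      rw [map_smul, ← delinearize_map_of_le ht (Nat.zero_le k), ih _ (hPs k x hx x' hx' i), map_zero,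
        smul_zero]
  have hker : ∀ n (x : X.obj n), (g n).hom x = 0 → RFMod.colimι X t ht n x = 0 := by
    intro n
    induction n with
    | zero =>
      intro x hx
      obtain ⟨k, hk⟩ := hPf x hx
      rw [← colimι_map (Nat.zero_le k), hPk k x hk, map_zero]
    | succ n ih =>
      intro x hx
      obtain ⟨x', rfl⟩ := hsucc n x
      rw [hgsum] at hx
      have := ((B.isUnitRF_iff Y).mp hY).2 _ hx
      rw [map_sum]
      refine Finset.sum_eq_zero fun i _ => ?_
      rw [map_smul, ← RFMod.colim_action (ht := ht), ih _ (this i), map_zero, smul_zero]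
  -- Likewise `G k` forces `y` into the image of stage k, by induction through the coefficients of
  -- `y`.
  have hrange : ∀ k y, G k y → ∃ x : X.obj k, (g k).hom x = y := by
    intro k
    induction k with
    | zero => exact hG0
    | succ k ih =>
      intro y hy
      obtain ⟨y', rfl, hy'⟩ := hGs k y hy
      choose x' hx' using fun i => ih _ (hy' i)
      refine ⟨∑ i, B.val i • delinearize (t k) (x' i), ?_⟩
      rw [hgsum]
      simp only [hx']
  have hbij : Function.Bijective D.hom := by
    constructor
    · refine (injective_iff_map_eq_zero D.hom).mpr fun z hz => ?_
      obtain ⟨n, x, rfl⟩ := colimι_exists_rep z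
      exact hker n x ((hD n x).symm.trans hz)
    · intro y
      obtain ⟨k, hk⟩ := hG y
      obtain ⟨x, hx⟩ := hrange k y hk
      exact ⟨_, (hD k x).trans hx⟩
  refine ⟨RFMod.isoMk (M := RFMod.colim X t ht) (LinearEquiv.ofBijective D.hom hbij) fun z => ?_⟩
  obtain ⟨n, x, rfl⟩ := colimι_exists_rep z
  rw [RFMod.colim_action]
  exact (hD _ _).trans ((hgs' n x).trans (congrArg _ (hD n x).symm))

end ColimUnit

/-! ### Zigzags in double complexes -/

/-- A double complex in the first quadrant, with commuting differentials. -/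
structure DoubleComplex where
  /-- The terms. -/
  X : ℕ → ℕ → Type u
  [grp : ∀ k l, AddCommGroup (X k l)]
  /-- The horizontal differential. -/
  h : ∀ k l, X k l →+ X (k + 1) l
  /-- The vertical differential. -/
  v : ∀ k l, X k l →+ X k (l + 1)
  hh : ∀ k l z, h (k + 1) l (h k l z) = 0
  vv : ∀ k l z, v k (l + 1) (v k l z) = 0
  comm : ∀ k l z, h k (l + 1) (v k l z) = v (k + 1) l (h k l z)

attribute [instance] DoubleComplex.grp

namespace DoubleComplex

variable (C : DoubleComplex.{u})

/-- The rows are exact away from the first column. -/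
def RowExact : Prop := ∀ k l (z : C.X (k + 1) l), C.h (k + 1) l z = 0 → ∃ w, C.h k l w = z

/-- The columns are exact away from the first row. -/
def ColExact : Prop := ∀ k l (z : C.X k (l + 1)), C.v k (l + 1) z = 0 → ∃ w, C.v k l w = z

/-- `u` and `w` are the end points of a zigzag `u = v c₀`, `h c₀ = v c₁`, ..., `h cₗ = w`. -/
def Zigzag : ∀ (l k : ℕ) (_ : C.X k l) (m : ℕ) (_ : C.X m 0), Prop
  | 0, k, u, m, w => ∃ e : k = m, e ▸ u = w
  | l + 1, k, u, m, w => ∃ c : C.X k l, C.v k l c = u ∧ Zigzag l (k + 1) (C.h k l c) m w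

variable {C}

lemma Zigzag.add {l k m : ℕ} {u u' : C.X k l} {w w' : C.X m 0} (h : C.Zigzag l k u m w)
    (h' : C.Zigzag l k u' m w') : C.Zigzag l k (u + u') m (w + w') := by
  induction l generalizing k with
  | zero =>
    obtain ⟨rfl, rfl⟩ := h
    obtain ⟨-, rfl⟩ := h'
    exact ⟨rfl, rfl⟩
  | succ l ih =>
    obtain ⟨c, rfl, hc⟩ := h
    obtain ⟨c', rfl, hc'⟩ := h'
    exact ⟨c + c', map_add _ _ _, by rw [map_add]; exact ih hc hc'⟩

lemma Zigzag.map {C C' : DoubleComplex.{u}} (f : ∀ k l, C.X k l →+ C'.X k l)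
    (hf : ∀ k l z, f (k + 1) l (C.h k l z) = C'.h k l (f k l z))
    (vf : ∀ k l z, f k (l + 1) (C.v k l z) = C'.v k l (f k l z)) {l k m : ℕ} {u : C.X k l}
    {w : C.X m 0} (h : C.Zigzag l k u m w) : C'.Zigzag l k (f k l u) m (f m 0 w) := by
  induction l generalizing k with
  | zero =>
    obtain ⟨rfl, rfl⟩ := h
    exact ⟨rfl, rfl⟩
  | succ l ih =>
    obtain ⟨c, rfl, hc⟩ := h
    exact ⟨f k l c, (vf k l c).symm, by rw [← hf]; exact ih hc⟩

lemma Zigzag.neg {l k m : ℕ} {u : C.X k l} {w : C.X m 0} (h : C.Zigzag l k u m w) :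
    C.Zigzag l k (-u) m (-w) :=
  Zigzag.map (C' := C) (fun _ _ => -AddMonoidHom.id _) (by simp) (by simp) h

lemma Zigzag.sub {l k m : ℕ} {u u' : C.X k l} {w w' : C.X m 0} (h : C.Zigzag l k u m w)
    (h' : C.Zigzag l k u' m w') : C.Zigzag l k (u - u') m (w - w') := by
  rw [sub_eq_add_neg, sub_eq_add_neg]
  exact h.add h'.neg

lemma Zigzag.zero {l k m : ℕ} (e : k + l = m) : C.Zigzag l k 0 m 0 := by
  induction l generalizing k with
  | zero =>
    obtain rfl : k = m := e
    exact ⟨rfl, rfl⟩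
  | succ l ih => exact ⟨0, map_zero _, by rw [map_zero]; exact ih (by omega)⟩

lemma Zigzag.sum {α : Type*} (s : Finset α) {l k m : ℕ} (e : k + l = m) {u : α → C.X k l}
    {w : α → C.X m 0} (h : ∀ a ∈ s, C.Zigzag l k (u a) m (w a)) :
    C.Zigzag l k (∑ a ∈ s, u a) m (∑ a ∈ s, w a) := by
  classical
  induction s using Finset.induction_on with
  | empty => simpa using Zigzag.zero e
  | insert a s ha ih =>
    rw [Finset.sum_insert ha, Finset.sum_insert ha]
    exact (h a (Finset.mem_insert_self a s)).add (ih fun b hb => h b (Finset.mem_insert_of_mem hb))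

/-- Exactness of the columns supplies c with v c = u, and h c is again closed in both directions,
one row lower. -/
lemma Zigzag.exists_end (hC : C.ColExact) {l k m : ℕ} (e : k + l = m) (u : C.X k l)
    (hu : C.h k l u = 0) (vu : C.v k l u = 0) :
    ∃ w, C.Zigzag l k u m w ∧ C.h m 0 w = 0 ∧ C.v m 0 w = 0 := by
  induction l generalizing k with
  | zero =>
    obtain rfl : k = m := e
    exact ⟨u, ⟨rfl, rfl⟩, hu, vu⟩
  | succ l ih =>
    obtain ⟨c, rfl⟩ := hC k l u vu
    obtain ⟨w, hw, h1⟩ := ih (by omega) (C.h k l c) (C.hh k l c) (by rw [← C.comm, hu])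
    exact ⟨w, ⟨c, rfl, hw⟩, h1⟩

lemma Zigzag.exists_start (hR : C.RowExact) {m : ℕ} (w : C.X m 0)
    (hw : C.h m 0 w = 0) (vw : C.v m 0 w = 0) :
    ∃ u, C.Zigzag m 0 u m w ∧ C.h 0 m u = 0 ∧ C.v 0 m u = 0 := by
  have key : ∀ l k, k + l = m →
      ∃ u, C.Zigzag l k u m w ∧ C.h k l u = 0 ∧ C.v k l u = 0 := by
    intro l
    induction l with
    | zero =>
      rintro k rfl
      exact ⟨w, ⟨rfl, rfl⟩, hw, vw⟩
    | succ l ih =>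
      intro k hk
      obtain ⟨u, hu, h1, h2⟩ := ih (k + 1) (by omega)
      obtain ⟨c, rfl⟩ := hR k l u h1
      exact ⟨C.v k l c, ⟨c, rfl, hu⟩, by rw [C.comm, h2], C.vv k l c⟩
  exact key m 0 (Nat.zero_add m)

/-- `w` is a boundary in the complex of the kernels of `v` in the first row. -/
def EndBdry (C : DoubleComplex.{u}) : ∀ (m : ℕ) (_ : C.X m 0), Prop
  | 0, w => w = 0
  | m + 1, w => ∃ b : C.X m 0, C.h m 0 b = w ∧ C.v m 0 b = 0

/-- `u` is a boundary in the complex of the kernels of `h` in the first column. -/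
def StartBdry (C : DoubleComplex.{u}) : ∀ (m : ℕ) (_ : C.X 0 m), Prop
  | 0, u => u = 0
  | m + 1, u => ∃ b : C.X 0 m, C.v 0 m b = u ∧ C.h 0 m b = 0

/-- If v c = v a and h a = 0, then c - a = v e and h c = v (h e). The discrepancy thus moves along
the zigzag, again in the form v of an element with h equal to zero, until it becomes a boundary in
the first row. -/
lemma Zigzag.endBdry (hC : C.ColExact) {m m' : ℕ} {u : C.X 0 m} {w : C.X m' 0}
    (h : C.Zigzag m 0 u m' w) (hu : C.StartBdry m u) : C.EndBdry m' w := by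
  have key : ∀ l k m' (a : C.X k l) (w : C.X m' 0), C.Zigzag (l + 1) k (C.v k l a) m' w →
      C.h k l a = 0 → C.EndBdry m' w := by
    intro l
    induction l with
    | zero =>
      rintro k m' a w ⟨c, hc, rfl, rfl⟩ ha
      exact ⟨c - a, by rw [map_sub, ha, sub_zero], by rw [map_sub, hc, sub_self]⟩
    | succ l ih =>
      rintro k m' a w ⟨c, hc, hz⟩ ha
      obtain ⟨e, he⟩ := hC k l (c - a) (by rw [map_sub, hc, sub_self])
      refine ih (k + 1) m' (C.h k l e) w ?_ (C.hh k l e)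
      rw [← C.comm, he, map_sub, ha, sub_zero]
      exact hz
  cases m with
  | zero =>
    obtain ⟨rfl, rfl⟩ := h
    exact hu
  | succ m =>
    obtain ⟨a, rfl, ha⟩ := hu
    exact key m 0 m' a w h ha

/-- The mirror image, run backwards from the end with exactness of the rows. -/
lemma Zigzag.startBdry (hR : C.RowExact) {m m' : ℕ} {u : C.X 0 m} {w : C.X m' 0}
    (h : C.Zigzag m 0 u m' w) (hw : C.EndBdry m' w) : C.StartBdry m u := by
  have key : ∀ l k (u : C.X (k + 1) l) m' (b : C.X m' 0),
      C.Zigzag l (k + 1) u (m' + 1) (C.h m' 0 b) → C.v m' 0 b = 0 →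
      ∃ s, C.h k l s = u ∧ C.v k l s = 0 := by
    intro l
    induction l with
    | zero =>
      rintro k u m' b ⟨e, he⟩ hb
      obtain rfl : k = m' := Nat.succ_injective e
      exact ⟨b, he.symm, hb⟩
    | succ l ih =>
      rintro k u m' b ⟨c, rfl, hz⟩ hb
      obtain ⟨s, hs, hs'⟩ := ih (k + 1) _ m' b hz hb
      obtain ⟨e, he⟩ := hR k l (c - s) (by rw [map_sub, hs, sub_self])
      exact ⟨C.v k l e, by rw [C.comm, he, map_sub, hs', sub_zero], C.vv k l e⟩
  cases m with
  | zero =>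
    obtain ⟨rfl, rfl⟩ := h
    exact hw
  | succ m =>
    obtain ⟨c, rfl, hz⟩ := h
    cases m' with
    | zero =>
      -- A zigzag only increases the column index, so it cannot lead from a positive column to
      -- column zero.
      exfalso
      have : ∀ l k (u : C.X (k + 1) l) (w : C.X 0 0), ¬ C.Zigzag l (k + 1) u 0 w := by
        intro l
        induction l with
        | zero =>
          rintro k u w ⟨e, -⟩
          exact absurd e (Nat.succ_ne_zero k)
        | succ l ih =>
          rintro k u w ⟨c, -, hz⟩
          exact ih _ _ _ hz
      exact this _ _ _ _ hz
    | succ m' =>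
      obtain ⟨b, rfl, hb⟩ := hw
      obtain ⟨s, hs, hs'⟩ := key m 0 _ m' b hz hb
      exact ⟨c - s, by rw [map_sub, hs', sub_zero], by rw [map_sub, hs, sub_self]⟩

end DoubleComplex

/-! ### Localization at the powers of an element -/

section Away

variable {R : Type u} [CommRing R] {M N L : Type u} [AddCommGroup M] [Module R M]
  [AddCommGroup N] [Module R N] [AddCommGroup L] [Module R L]

/-- The element `m / a ^ t` of `M_a`. -/
def awayMk {a : R} (t : ℕ) (m : M) : Away M a := LocalizedModule.mk m ⟨a ^ t, t, rfl⟩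

lemma awayMk_surjective {a : R} (z : Away M a) : ∃ t m, z = awayMk t m := by
  induction z using LocalizedModule.induction_on with
  | h m s =>
    obtain ⟨_, t, rfl⟩ := s
    exact ⟨t, m, rfl⟩

lemma awayMk_pow_smul {a : R} (k t : ℕ) (m : M) :
    awayMk (a := a) (k + t) (a ^ k • m) = awayMk t m := by
  refine Eq.trans ?_ (LocalizedModule.mk_cancel_common_left
    (⟨a ^ k, k, rfl⟩ : Submonoid.powers a) ⟨a ^ t, t, rfl⟩ m)
  rw [awayMk]
  congr 1
  exact Subtype.ext (pow_add a k t)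

lemma awayMk_eq_zero {a : R} {t : ℕ} {m : M} :
    awayMk (a := a) t m = 0 ↔ ∃ k, a ^ k • m = 0 := by
  rw [awayMk, ← LocalizedModule.zero_mk (1 : Submonoid.powers a), LocalizedModule.mk_eq]
  constructor
  · rintro ⟨⟨_, k, rfl⟩, hk⟩
    refine ⟨k, ?_⟩
    simpa [Submonoid.smul_def] using hk
  · rintro ⟨k, hk⟩
    exact ⟨⟨a ^ k, k, rfl⟩, by simpa [Submonoid.smul_def] using hk⟩

lemma awayMk_add {a : R} (t : ℕ) (m m' : M) :
    awayMk (a := a) t (m + m') = awayMk t m + awayMk t m' := by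
  rw [awayMk, awayMk, awayMk, LocalizedModule.mk_add_mk, ← smul_add,
    LocalizedModule.mk_cancel_common_left]

lemma awayMk_zero {a : R} (t : ℕ) : awayMk (a := a) t (0 : M) = 0 := LocalizedModule.zero_mk _

lemma awayMk_smul {a : R} (t : ℕ) (r : R) (m : M) :
    awayMk (a := a) t (r • m) = r • awayMk t m := (LocalizedModule.smul'_mk _ _ _).symm

lemma awayMk_sum {a : R} {α : Type*} (s : Finset α) (t : ℕ) (m : α → M) :
    awayMk (a := a) t (∑ i ∈ s, m i) = ∑ i ∈ s, awayMk t (m i) := by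
  classical
  induction s using Finset.induction_on with
  | empty => exact awayMk_zero t
  | insert i s hi ih => rw [Finset.sum_insert hi, Finset.sum_insert hi, awayMk_add, ih]

lemma exists_common_awayMk {a : R} {κ : Type} [Fintype κ] (z : κ → Away M a) :
    ∃ (t : ℕ) (m : κ → M), ∀ i, z i = awayMk t (m i) := by
  choose t m hm using fun i => awayMk_surjective (z i)
  refine ⟨Finset.univ.sup t, fun i => a ^ (Finset.univ.sup t - t i) • m i, fun i => ?_⟩
  have h : t i ≤ Finset.univ.sup t := Finset.le_sup (Finset.mem_univ i)
  rw [hm, ← awayMk_pow_smul (Finset.univ.sup t - t i), Nat.sub_add_cancel h]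

lemma awayMap_awayMk {a b c : R} (h : a ∣ b) (hc : b = a * c) (t : ℕ) (m : M) :
    awayMap M h (awayMk t m) = awayMk t (c ^ t • m) :=
  awayMap_mk h m _ _ (c ^ t) (by subst hc; exact mul_pow a c t)

lemma awayMap_awayMk_zero {a b : R} (h : a ∣ b) (m : M) :
    awayMap M h (awayMk 0 m) = awayMk 0 m := by
  obtain ⟨c, hc⟩ := id h
  rw [awayMap_awayMk h hc, pow_zero, one_smul]

lemma awayMap_refl {a : R} (h : a ∣ a) (z : Away M a) : awayMap M h z = z := by
  obtain ⟨t, m, rfl⟩ := awayMk_surjective z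
  rw [awayMap_awayMk h (mul_one a).symm, one_pow, one_smul]

/-- The map `M_a → N_a` induced by a linear map. -/
def awayFun (f : M →ₗ[R] N) (a : R) : Away M a →ₗ[R] Away N a :=
  (LocalizedModule.map (Submonoid.powers a) f).restrictScalars R

lemma awayFun_awayMk (f : M →ₗ[R] N) {a : R} (t : ℕ) (m : M) :
    awayFun f a (awayMk t m) = awayMk t (f m) := LocalizedModule.map_mk _ _ _ _

lemma awayFun_awayMap (f : M →ₗ[R] N) {a b : R} (h : a ∣ b) (z : Away M a) :
    awayFun f b (awayMap M h z) = awayMap N h (awayFun f a z) := by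
  obtain ⟨c, hc⟩ := id h
  obtain ⟨t, m, rfl⟩ := awayMk_surjective z
  rw [awayMap_awayMk h hc, awayFun_awayMk, awayFun_awayMk, awayMap_awayMk h hc, map_smul]

lemma awayFun_exact (f : M →ₗ[R] N) (g : N →ₗ[R] L) (h : Function.Exact f g) (a : R) :
    Function.Exact (awayFun f a) (awayFun g a) :=
  LocalizedModule.map_exact (Submonoid.powers a) f g h

lemma awayFun_injective (f : M →ₗ[R] N) (h : Function.Injective f) (a : R) :
    Function.Injective (awayFun f a) := LocalizedModule.map_injective (Submonoid.powers a) f h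

lemma awayFun_surjective (f : M →ₗ[R] N) (h : Function.Surjective f) (a : R) :
    Function.Surjective (awayFun f a) := LocalizedModule.map_surjective (Submonoid.powers a) f h

variable {p : ℕ} [Fact p.Prime] [CharP R p]

lemma awayFrob_awayMk (F : M →ₛₗ[frobenius R p] M) {a : R} (t : ℕ) (m : M) :
    awayFrob F a (awayMk t m) = awayMk (t * p) (F m) := by
  change LocalizedModule.mk (F m) _ = LocalizedModule.mk (F m) _
  congr 1
  exact Subtype.ext (pow_mul a t p).symm

/-- The elements of `M` killed by a power of `a`. -/
def powTorsion (M : Type u) [AddCommGroup M] [Module R M] (a : R) : Submodule R M where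
  carrier := {m | ∃ k : ℕ, a ^ k • m = 0}
  zero_mem' := ⟨0, smul_zero _⟩
  add_mem' := by
    rintro m m' ⟨k, hk⟩ ⟨k', hk'⟩
    refine ⟨k + k', ?_⟩
    rw [smul_add, pow_add, mul_smul, mul_smul, smul_comm, hk, hk', smul_zero, smul_zero, add_zero]
  smul_mem' := by
    rintro r m ⟨k, hk⟩
    exact ⟨k, by rw [smul_comm, hk, smul_zero]⟩

lemma mem_powTorsion_of_fg {a : R} {P : Submodule R M} (hP : P.FG) (h : P ≤ powTorsion M a) :
    ∃ k : ℕ, ∀ m ∈ P, a ^ k • m = 0 := by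
  obtain ⟨s, rfl⟩ := hP
  choose! k hk using fun m (hm : m ∈ s) => h (Submodule.subset_span hm)
  refine ⟨s.sup k, fun m hm => ?_⟩
  induction hm using Submodule.span_induction with
  | mem m hm =>
    rw [← Nat.sub_add_cancel (Finset.le_sup hm : k m ≤ s.sup k), pow_add, mul_smul, hk m hm,
      smul_zero]
  | zero => exact smul_zero _
  | add m m' _ _ h h' => rw [smul_add, h, h', add_zero]
  | smul r m _ h => rw [smul_comm, h, smul_zero]

/-- Over a Noetherian ring, the torsion submodule of an injective module is injective. -/
theorem injective_powTorsion [IsNoetherianRing R] [hM : Module.Injective R M] (a : R) :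
    Module.Injective R (powTorsion M a) := by
  apply Module.Baer.injective
  intro A f
  have hrange : (LinearMap.range f).FG := by
    rw [LinearMap.range_eq_map]
    exact (IsNoetherian.noetherian (⊤ : Submodule R A)).map f
  obtain ⟨T, hT⟩ : ∃ T : ℕ, ∀ x, a ^ T • f x = 0 := by
    obtain ⟨T, hT⟩ := mem_powTorsion_of_fg (a := a) (hrange.map (powTorsion M a).subtype) (by
      rintro _ ⟨m, -, rfl⟩
      exact m.2)
    exact ⟨T, fun x => Subtype.ext (hT _ ⟨f x, ⟨x, rfl⟩, rfl⟩)⟩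
  -- Artin–Rees: the elements of `A` divisible by a^(k+T) are a^T times elements of `A`, and are
  -- therefore killed by `f`.
  obtain ⟨k, hk⟩ := Ideal.exists_pow_inf_eq_pow_smul (Ideal.span {a}) (A : Submodule R R)
  have key : ∀ x : A, (x : R) ∈ Ideal.span {a ^ (k + T)} → f x = 0 := by
    intro x hx
    have hx' : (x : R) ∈ Ideal.span {a} ^ (k + T) • (⊤ : Submodule R R) ⊓ (A : Submodule R R) := by
      refine ⟨?_, x.2⟩
      rwa [smul_eq_mul, Ideal.mul_top, Ideal.span_singleton_pow]
    rw [hk _ (Nat.le_add_right k T), Nat.add_sub_cancel_left, Ideal.span_singleton_pow,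
      Submodule.ideal_span_singleton_smul] at hx'
    obtain ⟨w, hw, hwx⟩ := hx'
    have : x = a ^ T • (⟨w, hw.2⟩ : A) := Subtype.ext hwx.symm
    rw [this, map_smul, hT]
  let Q := Ideal.span {a ^ (k + T)}
  let i : (A ⧸ Submodule.comap A.subtype Q) →ₗ[R] R ⧸ Q :=
    Submodule.mapQ _ _ A.subtype le_rfl
  have hi : Function.Injective i := by
    rw [← LinearMap.ker_eq_bot]
    exact (Submodule.ker_mapQ _ _ _ _).trans (by simp)
  -- Now `f` descends to A/(A ∩ Q), a submodule of R/Q. Any extension to R/Q has values killed by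
  -- a^(k+T), so it lands in the torsion submodule.
  obtain ⟨g, hg⟩ := Module.Injective.out i hi
    (Submodule.liftQ _ ((powTorsion M a).subtype ∘ₗ f) (fun x hx => by
      rw [LinearMap.mem_ker, LinearMap.comp_apply, key x hx, map_zero]))
  refine ⟨LinearMap.codRestrict _ (g ∘ₗ Submodule.mkQ Q) fun x => ⟨k + T, ?_⟩, fun x hx => ?_⟩
  · rw [LinearMap.comp_apply, ← map_smul, ← map_smul, smul_eq_mul,
      (Submodule.Quotient.mk_eq_zero Q).mpr (Ideal.mul_mem_right x Q (Ideal.subset_span rfl)) |>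
      (show Submodule.mkQ Q _ = 0 from ·), map_zero]
  · exact Subtype.ext (hg (Submodule.Quotient.mk ⟨x, hx⟩))

/-- Elements of an injective module over a Noetherian ring are divisible up to torsion. -/
lemma awayMk_zero_surjective [IsNoetherianRing R] [hM : Module.Injective R M] {a : R}
    (z : Away M a) : ∃ m, z = awayMk 0 m := by
  obtain ⟨t, m, rfl⟩ := awayMk_surjective z
  -- The annihilators of the powers of `a` stabilize, at k say. Then a^(k+t) r ↦ r a^k m is well
  -- defined on the ideal generated by a^(k+t), and it extends to `R`; the value at 1 represents m /
  -- a^t.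
  let f : ℕ →o Submodule R R :=
    ⟨fun k => LinearMap.ker (LinearMap.lsmul R R (a ^ k)), fun k l hkl r hr => by
      rw [LinearMap.mem_ker, LinearMap.lsmul_apply] at hr ⊢
      rw [← Nat.sub_add_cancel hkl, pow_add, mul_smul, hr, smul_zero]⟩
  obtain ⟨k, hk⟩ := monotone_stabilizes_iff_noetherian.mpr (inferInstance : IsNoetherian R R) f
  have hk' : LinearMap.ker (LinearMap.lsmul R R (a ^ k)) =
      LinearMap.ker (LinearMap.lsmul R R (a ^ (k + t))) := hk _ (Nat.le_add_right k t)
  let i : (R ⧸ LinearMap.ker (LinearMap.lsmul R R (a ^ (k + t)))) →ₗ[R] R :=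
    Submodule.liftQ _ (LinearMap.lsmul R R (a ^ (k + t))) le_rfl
  have hi : Function.Injective i := by
    rw [← LinearMap.ker_eq_bot]
    exact Submodule.ker_liftQ_eq_bot _ _ _ le_rfl
  obtain ⟨g, hg⟩ := Module.Injective.extension_property R M _ _ i hi
    (Submodule.liftQ _ (LinearMap.toSpanSingleton R M (a ^ k • m)) (fun r hr => by
      rw [← hk', LinearMap.mem_ker, LinearMap.lsmul_apply, smul_eq_mul] at hr
      rw [LinearMap.mem_ker, LinearMap.toSpanSingleton_apply, smul_smul, mul_comm, hr, zero_smul]))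
  have h1 : g (a ^ (k + t)) = a ^ k • m := by
    have := LinearMap.congr_fun hg (Submodule.Quotient.mk 1)
    refine Eq.trans (congrArg g ?_) (this.trans (one_smul R _))
    exact (mul_one _).symm
  refine ⟨g 1, ?_⟩
  rw [← awayMk_pow_smul k t, ← awayMk_pow_smul (k + t) 0 (g 1), ← h1, ← map_smul, smul_eq_mul,
    mul_one]
  rfl

end Away

/-! ### Functoriality and acyclicity of the Čech complex -/

section CechMap

variable {R : Type u} [CommRing R] {M N L : Type u} [AddCommGroup M] [Module R M]
  [AddCommGroup N] [Module R N] [AddCommGroup L] [Module R L]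
variable {r : ℕ} (x : Fin r → R)

/-- The map of Čech complexes induced by a linear map. -/
def cechMap (f : M →ₗ[R] N) (k : ℕ) : CechTerm x M k →ₗ[R] CechTerm x N k :=
  LinearMap.pi fun s => awayFun f (cechProd x s) ∘ₗ LinearMap.proj s

lemma cechMap_apply (f : M →ₗ[R] N) (k : ℕ) (z : CechTerm x M k) (s : Fin k ↪o Fin r) :
    cechMap x f k z s = awayFun f _ (z s) := rfl

lemma cechMap_cechD (f : M →ₗ[R] N) (k : ℕ) (z : CechTerm x M k) :
    cechMap x f (k + 1) (cechD x M k z) = cechD x N k (cechMap x f k z) := by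
  funext s
  rw [cechMap_apply, cechD_apply, cechD_apply, map_sum]
  refine Finset.sum_congr rfl fun j _ => ?_
  rw [map_smul, awayFun_awayMap, cechMap_apply]

lemma cechMap_injective (f : M →ₗ[R] N) (hf : Function.Injective f) (k : ℕ) :
    Function.Injective (cechMap x f k) := fun _ _ h =>
  funext fun s => awayFun_injective f hf _ (congrFun h s)

lemma cechMap_surjective (f : M →ₗ[R] N) (hf : Function.Surjective f) (k : ℕ) :
    Function.Surjective (cechMap x f k) := fun w => by
  choose z hz using fun s => awayFun_surjective f hf _ (w s)
  exact ⟨z, funext hz⟩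

lemma cechMap_exact (f : M →ₗ[R] N) (g : N →ₗ[R] L) (h : Function.Exact f g) (k : ℕ) :
    Function.Exact (cechMap x f k) (cechMap x g k) := by
  intro w
  constructor
  · intro hw
    choose z hz using fun s => (awayFun_exact f g h _ (w s)).mp (congrFun hw s)
    exact ⟨z, funext hz⟩
  · rintro ⟨z, rfl⟩
    exact funext fun s => (awayFun_exact f g h _ _).mpr ⟨z s, rfl⟩

lemma cechMap_zero (k : ℕ) (z : CechTerm x M k) : cechMap x (0 : M →ₗ[R] N) k z = 0 := by
  funext s
  rw [cechMap_apply]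
  obtain ⟨t, m, hm⟩ := awayMk_surjective (z s)
  rw [hm, awayFun_awayMk]
  exact awayMk_zero t

lemma cechMap_lsmul (a : R) (k : ℕ) (z : CechTerm x M k) :
    cechMap x (LinearMap.lsmul R M a) k z = a • z := by
  funext s
  rw [cechMap_apply, Pi.smul_apply]
  obtain ⟨t, m, hm⟩ := awayMk_surjective (z s)
  rw [hm, awayFun_awayMk, LinearMap.lsmul_apply, awayMk_smul]

lemma cechMap_cechFrob {p : ℕ} [Fact p.Prime] [CharP R p] {M N : RFMod R p} (f : M ⟶ N) (k : ℕ)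
    (z : CechTerm x M.a k) :
    cechMap x f.f.hom k (cechFrob x M k z) = cechFrob x N k (cechMap x f.f.hom k z) := by
  funext s
  change awayFun _ _ (awayFrob M.action _ (z s)) = awayFrob N.action _ (awayFun _ _ (z s))
  obtain ⟨t, m, hm⟩ := awayMk_surjective (z s)
  rw [hm, awayFrob_awayMk, awayFun_awayMk, awayFun_awayMk, awayFrob_awayMk, RFMod.hom_action]

/-- The map from a module to the degree zero term of its Čech complex. -/
def cechUnit (m : M) : CechTerm x M 0 := fun _ => awayMk 0 m

lemma cechProd_zero (s : Fin 0 ↪o Fin r) : cechProd x s = 1 := by simp [cechProd]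

lemma cechUnit_bijective : Function.Bijective (cechUnit x (M := M)) := by
  let s : Fin 0 ↪o Fin r := ⟨⟨Fin.elim0, fun a => a.elim0⟩, fun {a} => a.elim0⟩
  have hs : ∀ s' : Fin 0 ↪o Fin r, s' = s := fun s' => by
    ext i
    exact i.elim0
  constructor
  · intro m m' h
    have h1 : awayMk (a := cechProd x s) 0 (m - m') = 0 := by
      rw [sub_eq_add_neg, awayMk_add, ← neg_one_smul R, awayMk_smul, neg_one_smul,
        show awayMk (a := cechProd x s) 0 m = awayMk 0 m' from congrFun h s, add_neg_cancel]
    obtain ⟨k, hk⟩ := awayMk_eq_zero.mp h1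
    rwa [cechProd_zero, one_pow, one_smul, sub_eq_zero] at hk
  · intro z
    obtain ⟨t, m, hm⟩ := awayMk_surjective (z s)
    refine ⟨m, funext fun s' => ?_⟩
    rw [hs s', hm, cechUnit, ← awayMk_pow_smul t 0, cechProd_zero, one_pow, one_smul]
    rfl

lemma cechUnit_add (m m' : M) : cechUnit x (m + m') = cechUnit x m + cechUnit x m' :=
  funext fun _ => awayMk_add _ _ _

lemma cechUnit_smul (a : R) (m : M) : cechUnit x (a • m) = a • cechUnit x m :=
  funext fun _ => awayMk_smul _ _ _

lemma cechMap_cechUnit (f : M →ₗ[R] N) (m : M) :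
    cechMap x f 0 (cechUnit x m) = cechUnit x (f m) :=
  funext fun _ => awayFun_awayMk _ _ _

lemma cechFrob_cechUnit {p : ℕ} [Fact p.Prime] [CharP R p] (M : RFMod R p) (m : M.a) :
    cechFrob x M 0 (cechUnit x m) = cechUnit x (M.action m) := by
  funext s
  change awayFrob M.action _ (awayMk 0 m) = awayMk 0 _
  rw [awayFrob_awayMk, zero_mul]

lemma cechD_cechUnit_eq_zero_iff (m : M) :
    cechD x M 0 (cechUnit x m) = 0 ↔ ∀ i, ∃ k : ℕ, x i ^ k • m = 0 := by
  have h : ∀ s : Fin 1 ↪o Fin r, cechD x M 0 (cechUnit x m) s = awayMk 0 m := fun s => by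
    rw [cechD_apply, Fin.sum_univ_one]
    simp only [Fin.val_zero, pow_zero, one_smul]
    exact awayMap_awayMk_zero _ _
  have hprod : ∀ s : Fin 1 ↪o Fin r, cechProd x s = x (s 0) := fun s => by simp [cechProd]
  constructor
  · intro h0 i
    let s : Fin 1 ↪o Fin r := OrderEmbedding.ofStrictMono (fun _ => i) (fun a b hab =>
      absurd hab (by rw [Subsingleton.elim a b]; exact lt_irrefl b))
    have := (h s).symm.trans (congrFun h0 s)
    obtain ⟨k, hk⟩ := awayMk_eq_zero.mp this
    exact ⟨k, by rwa [hprod] at hk⟩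
  · intro h0
    funext s
    rw [h]
    obtain ⟨k, hk⟩ := h0 (s 0)
    exact awayMk_eq_zero.mpr ⟨k, by rwa [hprod]⟩

lemma cechTerm_eq_zero_of_lt {k : ℕ} (h : r < k) (z : CechTerm x M k) : z = 0 := by
  funext s
  exact absurd (Fintype.card_le_of_embedding s.toEmbedding) (by simpa using h)

end CechMap

/-! ### Acyclicity of the Čech complex on injective modules -/

section Acyclic

variable {R : Type u} [CommRing R] {r k : ℕ}

/-- Shift an increasing sequence by one. -/
def succEmb (s : Fin k ↪o Fin r) : Fin k ↪o Fin (r + 1) := s.trans (Fin.succOrderEmb r)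

/-- Shift an increasing sequence by one and prepend zero. -/
def consEmb (s : Fin k ↪o Fin r) : Fin (k + 1) ↪o Fin (r + 1) :=
  OrderEmbedding.ofStrictMono (Fin.cons 0 fun i => (s i).succ) (by
    intro a b hab
    induction b using Fin.cases with
    | zero => exact absurd hab (Fin.not_lt_zero a)
    | succ b =>
      induction a using Fin.cases with
      | zero => exact Fin.succ_pos _
      | succ a => simpa using hab)


@[simp] lemma succEmb_apply (s : Fin k ↪o Fin r) (i : Fin k) : succEmb s i = (s i).succ := rfl
@[simp] lemma consEmb_zero (s : Fin k ↪o Fin r) : consEmb s 0 = 0 := rfl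
@[simp] lemma consEmb_succ (s : Fin k ↪o Fin r) (i : Fin k) : consEmb s i.succ = (s i).succ := rfl

lemma succEmb_injective : Function.Injective (succEmb : (Fin k ↪o Fin r) → _) := by
  intro s s' h
  refine DFunLike.ext _ _ fun i => ?_
  have := DFunLike.congr_fun h i
  simpa using this

lemma succEmb_ne_consEmb (s : Fin (k + 1) ↪o Fin r) (s' : Fin k ↪o Fin r) :
    succEmb s ≠ consEmb s' := fun h => by
  have := DFunLike.congr_fun h 0
  simp at this

lemma exists_succEmb {s : Fin k ↪o Fin (r + 1)} (h : ∀ i, s i ≠ 0) : ∃ s', s = succEmb s' := by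
  refine ⟨OrderEmbedding.ofStrictMono (fun i => (s i).pred (h i)) fun a b hab => ?_, ?_⟩
  · exact Fin.pred_lt_pred_iff.mpr (s.strictMono hab)
  · refine DFunLike.ext _ _ fun i => ?_
    exact (Fin.succ_pred (s i) (h i)).symm

/-- An index sequence either avoids 0 or starts with it. This splits the Čech complex into the one
on the remaining elements and its localization at `x 0`. -/
lemma exists_emb (s : Fin (k + 1) ↪o Fin (r + 1)) :
    (∃ s', s = succEmb s') ∨ ∃ s', s = consEmb s' := by
  by_cases h : s 0 = 0
  · right
    have h' : ∀ i : Fin k, s i.succ ≠ 0 := fun i hi =>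
      (Fin.succ_ne_zero i) (s.injective (hi.trans h.symm))
    refine ⟨OrderEmbedding.ofStrictMono (fun i => (s i.succ).pred (h' i)) fun a b hab => ?_, ?_⟩
    · exact Fin.pred_lt_pred_iff.mpr (s.strictMono (Fin.succ_lt_succ_iff.mpr hab))
    · refine DFunLike.ext _ _ fun i => ?_
      induction i using Fin.cases with
      | zero => exact h
      | succ i => exact (Fin.succ_pred (s i.succ) (h' i)).symm
  · left
    exact exists_succEmb fun i hi => h (le_antisymm ((s.monotone (Fin.zero_le i)).trans hi.le)
      (Fin.zero_le _))

lemma face_consEmb_zero (s : Fin k ↪o Fin r) : face (consEmb s) 0 = succEmb s := by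
  ext i
  simp [face]

lemma face_consEmb_succ (s : Fin (k + 1) ↪o Fin r) (j : Fin (k + 1)) :
    face (consEmb s) j.succ = consEmb (face s j) := by
  ext i
  induction i using Fin.cases with
  | zero => simp [face]
  | succ i => simp [face]

variable (x : Fin (r + 1) → R)

lemma cechProd_succEmb (s : Fin k ↪o Fin r) : cechProd x (succEmb s) = cechProd (Fin.tail x) s :=
  rfl

lemma cechProd_consEmb (s : Fin k ↪o Fin r) :
    cechProd x (consEmb s) = x 0 * cechProd (Fin.tail x) s := by
  rw [cechProd, Fin.prod_univ_succ]
  rfl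

lemma dvd_consEmb (s : Fin k ↪o Fin r) : cechProd (Fin.tail x) s ∣ cechProd x (consEmb s) :=
  ⟨x 0, by rw [cechProd_consEmb, mul_comm]⟩

variable {M : Type u} [AddCommGroup M] [Module R M]

open scoped Classical in
/-- Extension by zero from the Čech complex on all elements but the first. -/
def cechExt (w : CechTerm (Fin.tail x) M k) : CechTerm x M k := fun s =>
  if h : ∃ s', succEmb s' = s then
    awayMap M (by rw [← cechProd_succEmb, h.choose_spec]) (w h.choose) else 0

lemma cechExt_succEmb (w : CechTerm (Fin.tail x) M k) (s : Fin k ↪o Fin r) :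
    cechExt x w (succEmb s) = w s := by
  have h : ∃ s', succEmb s' = succEmb s := ⟨s, rfl⟩
  rw [cechExt, dif_pos h]
  have hs : h.choose = s := succEmb_injective h.choose_spec
  exact (awayMap_congr _ w hs _ dvd_rfl).trans (awayMap_refl dvd_rfl _)

lemma cechExt_consEmb (w : CechTerm (Fin.tail x) M (k + 1)) (s : Fin k ↪o Fin r) :
    cechExt x w (consEmb s) = 0 := by
  rw [cechExt, dif_neg]
  rintro ⟨s', hs'⟩
  exact succEmb_ne_consEmb _ _ hs'

/-- Restriction to the Čech complex on all elements but the first. -/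
def cechRes (z : CechTerm x M k) : CechTerm (Fin.tail x) M k := fun s => z (succEmb s)

lemma cechRes_cechExt (w : CechTerm (Fin.tail x) M k) : cechRes x (cechExt x w) = w :=
  funext (cechExt_succEmb x w)

lemma cechD_succEmb (z : CechTerm x M k) (s : Fin (k + 1) ↪o Fin r) :
    cechD x M k z (succEmb s) = cechD (Fin.tail x) M k (cechRes x z) s :=
  (cechD_apply x z (succEmb s)).trans (cechD_apply (Fin.tail x) (cechRes x z) s).symm

lemma cechD_consEmb_zero (z : CechTerm x M 0) (s : Fin 0 ↪o Fin r) :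
    cechD x M 0 z (consEmb s) = awayMap M (dvd_consEmb x s) (z (succEmb s)) := by
  rw [cechD_apply, Fin.sum_univ_one]
  simp only [Fin.val_zero, pow_zero, one_smul]
  exact awayMap_congr x z (face_consEmb_zero s) _ _

lemma cechD_consEmb (z : CechTerm x M (k + 1)) (s : Fin (k + 1) ↪o Fin r)
    (hz : ∀ s', z (consEmb s') = 0) :
    cechD x M (k + 1) z (consEmb s) = awayMap M (dvd_consEmb x s) (z (succEmb s)) := by
  rw [cechD_apply, Fin.sum_univ_succ, Finset.sum_eq_zero, add_zero]
  · simp only [Fin.val_zero, pow_zero, one_smul]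
    exact awayMap_congr x z (face_consEmb_zero s) _ _
  · intro j _
    rw [awayMap_congr x z (face_consEmb_succ s j) _
      (face_consEmb_succ s j ▸ cechProd_face_dvd x (consEmb s) j.succ), hz, map_zero, smul_zero]

lemma cechD_cechExt_consEmb (w : CechTerm (Fin.tail x) M k) (s : Fin k ↪o Fin r) :
    cechD x M k (cechExt x w) (consEmb s) = awayMap M (dvd_consEmb x s) (w s) := by
  cases k with
  | zero =>
    rw [cechD_consEmb_zero]
    exact congrArg _ (cechExt_succEmb x w s)
  | succ k =>
    rw [cechD_consEmb x _ s (cechExt_consEmb x w)]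
    exact congrArg _ (cechExt_succEmb x w s)

/-- By exactness of localization, the kernel of inverting one more element `c` comes from the
`c`-power torsion of `M`. -/
lemma exists_of_awayMap_eq_zero {a b c : R} (h : a ∣ b) (hc : b = c * a) {z : Away M a}
    (hz : awayMap M h z = 0) : ∃ w, awayFun (powTorsion M c).subtype a w = z := by
  obtain ⟨t, m, rfl⟩ := awayMk_surjective z
  rw [awayMap_awayMk h (hc.trans (mul_comm c a))] at hz
  obtain ⟨k, hk⟩ := awayMk_eq_zero.mp hz
  refine ⟨awayMk (k + t) ⟨a ^ k • m, k + t, ?_⟩, ?_⟩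
  · rw [hc, mul_pow, smul_smul] at hk
    rw [← hk, smul_smul, pow_add]
    congr 1
    ring
  · rw [awayFun_awayMk]
    exact awayMk_pow_smul k t m

lemma awayMap_awayFun_eq_zero {a b c : R} (h : a ∣ b) (hc : c ∣ b)
    (w : Away (powTorsion M c) a) :
    awayMap M h (awayFun (powTorsion M c).subtype a w) = 0 := by
  obtain ⟨t, ⟨m, k, hk⟩, rfl⟩ := awayMk_surjective w
  obtain ⟨d, hd⟩ := id h
  rw [awayFun_awayMk, awayMap_awayMk h hd]
  refine awayMk_eq_zero.mpr ⟨k, ?_⟩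
  obtain ⟨e, rfl⟩ := hc
  rw [smul_smul, mul_comm, mul_smul, mul_comm c e, mul_pow, mul_smul]
  change d ^ t • e ^ k • c ^ k • m = 0
  rw [hk, smul_zero, smul_zero]

/-- The Čech complex of an injective module over a Noetherian ring is exact in positive degrees. -/
theorem exists_cechD_eq_of_injective [IsNoetherianRing R] {r : ℕ} (x : Fin r → R) {J : Type u}
    [AddCommGroup J] [Module R J] (hJ : Module.Injective R J) {k : ℕ} (z : CechTerm x J (k + 1))
    (hz : cechD x J (k + 1) z = 0) : ∃ w, cechD x J k w = z := by
  induction r generalizing J k with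
  | zero => exact ⟨0, by rw [map_zero, cechTerm_eq_zero_of_lt x (Nat.succ_pos k) z]⟩
  | succ r ih =>
    -- The components involving index 0 lift to `J` itself, because localization maps of injective
    -- modules are surjective. Subtracting the coboundary of this lift makes these components
    -- vanish.
    choose j hj using fun s : Fin k ↪o Fin r => awayMk_zero_surjective (z (consEmb s))
    let w₁ : CechTerm (Fin.tail x) J k := fun s => awayMk 0 (j s)
    obtain ⟨z₁, hz₁⟩ : ∃ z₁, z₁ = z - cechD x J k (cechExt x w₁) := ⟨_, rfl⟩
    have hcons : ∀ s, z₁ (consEmb s) = 0 := fun s => by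
      rw [hz₁, Pi.sub_apply, cechD_cechExt_consEmb, awayMap_awayMk_zero, hj, sub_self]
    have hd : cechD x J (k + 1) z₁ = 0 := by rw [hz₁, map_sub, hz, cechD_cechD, sub_zero]
    -- The cocycle condition now says that the other components die after inverting `x 0`, so they
    -- come from the `x 0`-power torsion.
    have hker : ∀ s, awayMap J (dvd_consEmb x s) (z₁ (succEmb s)) = 0 := fun s => by
      rw [← cechD_consEmb x z₁ s hcons, hd]
      rfl
    choose u hu using fun s => exists_of_awayMap_eq_zero (dvd_consEmb x s)
      (cechProd_consEmb x s) (hker s)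
    have hu' : cechMap (Fin.tail x) (powTorsion J (x 0)).subtype (k + 1) u = cechRes x z₁ :=
      funext hu
    have hdu : cechD (Fin.tail x) (powTorsion J (x 0)) (k + 1) u = 0 := by
      apply cechMap_injective (Fin.tail x) _ (Submodule.injective_subtype (powTorsion J (x 0)))
      rw [cechMap_cechD, hu', map_zero]
      funext s
      exact (cechD_succEmb x z₁ s).symm.trans (congrFun hd (succEmb s))
    -- The torsion submodule is again injective, and one fewer element is involved.
    obtain ⟨v, hv⟩ := ih (Fin.tail x) (injective_powTorsion (x 0)) u hdu
    have key : cechD x J k (cechExt x (cechMap (Fin.tail x) (powTorsion J (x 0)).subtype k v)) =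
        z₁ := by
      funext s
      obtain ⟨s, rfl⟩ | ⟨s, rfl⟩ := exists_emb s
      · refine (cechD_succEmb x _ s).trans ?_
        rw [cechRes_cechExt, ← cechMap_cechD, hv, hu']
        rfl
      · rw [hcons, cechD_cechExt_consEmb]
        exact awayMap_awayFun_eq_zero _ ⟨_, cechProd_consEmb x s⟩ _
    exact ⟨cechExt x w₁ + cechExt x (cechMap (Fin.tail x) (powTorsion J (x 0)).subtype k v), by
      rw [map_add, key, hz₁, add_sub_cancel]⟩

end Acyclic

/-! ### Local cohomology through injective resolutions with Frobenius -/

section Relations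

variable {R : Type u} [CommRing R]

/-- A linear relation which is single valued and everywhere defined in both directions is the graph
of a linear equivalence. -/
lemma exists_linearEquiv_of_rel {M N : Type u} [AddCommGroup M] [Module R M] [AddCommGroup N]
    [Module R N] (S : M → N → Prop) (hadd : ∀ m n m' n', S m n → S m' n' → S (m + m') (n + n'))
    (hsmul : ∀ (a : R) m n, S m n → S (a • m) (a • n)) (hl : ∀ m, ∃ n, S m n)
    (hr : ∀ n, ∃ m, S m n) (hl0 : ∀ m, S m 0 → m = 0) (hr0 : ∀ n, S 0 n → n = 0) :
    ∃ e : M ≃ₗ[R] N, ∀ m, S m (e m) := by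
  choose f hf using hl
  have hsub : ∀ m n m' n', S m n → S m' n' → S (m - m') (n - n') := fun m n m' n' h h' => by
    have := hadd _ _ _ _ h (hsmul (-1) _ _ h')
    rwa [neg_one_smul, neg_one_smul, ← sub_eq_add_neg, ← sub_eq_add_neg] at this
  have huniq : ∀ m n n', S m n → S m n' → n = n' := fun m n n' h h' => by
    have := hsub _ _ _ _ h h'
    rw [sub_self] at this
    exact sub_eq_zero.mp (hr0 _ this)
  let F : M →ₗ[R] N :=
    { toFun := f
      map_add' := fun m m' => huniq _ _ _ (hf _) (hadd _ _ _ _ (hf m) (hf m'))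
      map_smul' := fun a m => huniq _ _ _ (hf _) (hsmul a _ _ (hf m)) }
  refine ⟨LinearEquiv.ofBijective F ⟨?_, fun n => ?_⟩, hf⟩
  · refine (injective_iff_map_eq_zero F).mpr fun m hm => hl0 m ?_
    rw [← hm]
    exact hf m
  · obtain ⟨m, hm⟩ := hr n
    exact ⟨m, huniq _ _ _ (hf m) hm⟩

/-- A linear relation which is everywhere defined and single valued is the graph of a linear map. -/
lemma exists_linearMap_of_rel {M N : Type u} [AddCommGroup M] [Module R M] [AddCommGroup N]
    [Module R N] (S : M → N → Prop) (hadd : ∀ m n m' n', S m n → S m' n' → S (m + m') (n + n'))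
    (hsmul : ∀ (a : R) m n, S m n → S (a • m) (a • n)) (hl : ∀ m, ∃ n, S m n)
    (hr0 : ∀ n, S 0 n → n = 0) :
    ∃ f : M →ₗ[R] N, (∀ m, S m (f m)) ∧ ∀ m n, S m n → f m = n := by
  choose f hf using hl
  have huniq : ∀ m n n', S m n → S m n' → n = n' := fun m n n' h h' => by
    have := hadd _ _ _ _ h (hsmul (-1) _ _ h')
    rw [neg_one_smul, neg_one_smul, ← sub_eq_add_neg, ← sub_eq_add_neg, sub_self] at this
    exact sub_eq_zero.mp (hr0 _ this)
  exact ⟨{ toFun := f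
           map_add' := fun m m' => huniq _ _ _ (hf _) (hadd _ _ _ _ (hf m) (hf m'))
           map_smul' := fun a m => huniq _ _ _ (hf _) (hsmul a _ _ (hf m)) }, hf,
    fun m n h => huniq _ _ _ (hf m) h⟩

end Relations

/-! ### Čech cocycles and their classes -/

section CechClass

variable {R : Type u} [CommRing R] {r : ℕ} (x : Fin r → R) (M : ModuleCat.{u} R)

/-- The Čech cocycle `z` represents the class `h`. -/
def CechClass (k : ℕ) (z : CechTerm x M k) (h : (cechComplex x M).homology k) : Prop :=
  HasClass (cechComplex x M) k z h

/-- `z` is a coboundary of the Čech complex. -/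
def CechBdry : ∀ k, CechTerm x M k → Prop
  | 0, z => z = 0
  | k + 1, z => ∃ w, cechD x M k w = z

variable {x M} {k : ℕ}

lemma cechComplex_d (z : CechTerm x M k) :
    ((cechComplex x M).d k (k + 1)).hom z = cechD x M k z := by
  have h : (cechComplex x M).d k (k + 1) = ModuleCat.ofHom (cechD x M k) := by
    simp only [cechComplex, CochainComplex.of_d]
  exact congrArg (fun f => f.hom z) h

lemma CechClass.d_eq_zero {z : CechTerm x M k} {h : (cechComplex x M).homology k}
    (hz : CechClass x M k z h) : cechD x M k z = 0 :=
  (cechComplex_d z).symm.trans (HasClass.d_eq_zero hz (k + 1))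

lemma CechClass.exists_of_d_eq_zero {z : CechTerm x M k} (hz : cechD x M k z = 0) :
    ∃ h, CechClass x M k z h := by
  refine HasClass.exists_of_d_eq_zero fun j => ?_
  by_cases hj : k + 1 = j
  · subst hj
    exact (cechComplex_d z).trans hz
  · rw [(cechComplex x M).shape k j hj]
    rfl

lemma CechClass.zero_iff {z : CechTerm x M k} : CechClass x M k z 0 ↔ CechBdry x M k z := by
  constructor
  · intro hz
    obtain ⟨j, w, hw⟩ := HasClass.exists_of_zero hz
    by_cases hj : j + 1 = k
    · subst hj
      exact ⟨w, (cechComplex_d w).symm.trans hw⟩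
    · rw [(cechComplex x M).shape j k hj] at hw
      have hz0 : z = 0 := hw.symm
      cases k with
      | zero => exact hz0
      | succ k => exact ⟨0, by rw [map_zero, hz0]⟩
  · intro hz
    cases k with
    | zero =>
      obtain rfl : z = 0 := hz
      exact HasClass.zero
    | succ k =>
      obtain ⟨w, rfl⟩ := hz
      have := HasClass.of_d (K := cechComplex x M) (i := k + 1) (j := k) w
      rw [show ((cechComplex x M).d k (k + 1)).hom w = cechD x M k w from cechComplex_d w] at this
      exact this

lemma CechClass.action {p : ℕ} [Fact p.Prime] [CharP R p] {M : RFMod R p} {z : CechTerm x M.a k}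
    {h : (M.localCohomology x k).a} (hz : CechClass x M.a k z h) :
    CechClass x M.a k (cechFrob x M k z) ((M.localCohomology x k).action h) :=
  HasClass.homologyLift (cechFrobHom x M) hz

end CechClass

variable {R : Type u} [CommRing R] {p : ℕ} [Fact p.Prime] [CharP R p]

/-- An element killed by a Frobenius power of the ideal `I`. -/
def IsTors (p : ℕ) (I : Ideal R) {M : Type u} [AddCommGroup M] [Module R M] (m : M) : Prop :=
  ∃ k : ℕ, ∀ a ∈ I, a ^ p ^ k • m = 0

lemma pow_smul_eq_zero_of_le {M : Type u} [AddCommGroup M] [Module R M] {a : R} {m : M} {k l : ℕ}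
    (h : a ^ k • m = 0) (hkl : k ≤ l) : a ^ l • m = 0 := by
  rw [← Nat.sub_add_cancel hkl, pow_add, mul_smul, h, smul_zero]

/-- In characteristic p, a ↦ a^(p^k) is additive, so being killed by a Frobenius power of the ideal
can be tested on generators. The torsion hence depends on the ideal only. -/
lemma cechD_cechUnit_eq_zero_iff_isTors {r : ℕ} (x : Fin r → R) {M : Type u} [AddCommGroup M]
    [Module R M] (m : M) :
    cechD x M 0 (cechUnit x m) = 0 ↔ IsTors p (Ideal.span (Set.range x)) m := by
  rw [cechD_cechUnit_eq_zero_iff]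
  have hp : 1 < p := (Fact.out : p.Prime).one_lt
  constructor
  · intro h
    choose k hk using h
    refine ⟨Finset.univ.sup k, fun a ha => ?_⟩
    induction ha using Submodule.span_induction with
    | mem a ha =>
      obtain ⟨i, rfl⟩ := ha
      refine pow_smul_eq_zero_of_le (hk i) ?_
      exact (Finset.le_sup (Finset.mem_univ i)).trans (Nat.lt_pow_self hp).le
    | zero => rw [zero_pow (pow_pos (zero_lt_one.trans hp) _).ne', zero_smul]
    | add a b _ _ h h' => rw [add_pow_char_pow, add_smul, h, h', add_zero]
    | smul c a _ h => rw [smul_eq_mul, mul_pow, mul_smul, h, smul_zero]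
  · rintro ⟨k, hk⟩ i
    exact ⟨p ^ k, hk _ (Ideal.subset_span ⟨i, rfl⟩)⟩

/-- An injective resolution of an `R[F]`-module by `R[F]`-modules. -/
structure FrobRes (M : RFMod R p) where
  /-- The terms of the resolution. -/
  obj : ℕ → RFMod R p
  /-- The differentials. -/
  d : ∀ l, obj l ⟶ obj (l + 1)
  /-- The augmentation. -/
  ε : M ⟶ obj 0
  inj : ∀ l, Module.Injective R (obj l).a
  ε_injective : Function.Injective ε.f.hom
  exact₀ : Function.Exact ε.f.hom (d 0).f.hom
  exact : ∀ l, Function.Exact (d l).f.hom (d (l + 1)).f.hom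

namespace FrobRes

variable {M : RFMod R p} (Q : FrobRes M) {r : ℕ} (x : Fin r → R)

/-- The underlying linear map of the differential. -/
abbrev dl (l : ℕ) : (Q.obj l).a →ₗ[R] (Q.obj (l + 1)).a := (Q.d l).f.hom

/-- The underlying linear map of the augmentation. -/
abbrev εl : M.a →ₗ[R] (Q.obj 0).a := Q.ε.f.hom

lemma dl_dl (l : ℕ) (g : (Q.obj l).a) : Q.dl (l + 1) (Q.dl l g) = 0 :=
  (Q.exact l _).mpr ⟨g, rfl⟩

/-- The double complex of Čech complexes of the terms of the resolution. -/
def cechDouble : DoubleComplex.{u} where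
  X k l := CechTerm x (Q.obj l).a k
  h k l := (cechD x (Q.obj l).a k).toAddMonoidHom
  v k l := (cechMap x (Q.dl l) k).toAddMonoidHom
  hh k _ z := cechD_cechD x k z
  vv k l z := (cechMap_exact x _ _ (Q.exact l) k _).mpr ⟨z, rfl⟩
  comm k l z := (cechMap_cechD x (Q.dl l) k z).symm

lemma cechDouble_rowExact [IsNoetherianRing R] : (Q.cechDouble x).RowExact := fun _ l z hz =>
  exists_cechD_eq_of_injective x (Q.inj l) z hz

lemma cechDouble_colExact : (Q.cechDouble x).ColExact := fun k l z hz =>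
  (cechMap_exact x _ _ (Q.exact l) k z).mp hz

/-- The cocycle `g` of the resolution represents the local cohomology class `h`. -/
def Rep (j : ℕ) (g : (Q.obj j).a) (h : (M.localCohomology x j).a) : Prop :=
  ∃ w : CechTerm x M.a j, (Q.cechDouble x).Zigzag j 0 (cechUnit x g) j (cechMap x Q.εl j w) ∧
    CechClass x M.a j w h

/-- Boundaries of torsion elements of the resolution. -/
def Bdry (I : Ideal R) : ∀ j, (Q.obj j).a → Prop
  | 0, g => g = 0
  | j + 1, g => ∃ g', IsTors p I g' ∧ Q.dl j g' = g

variable {Q x} {j : ℕ}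

lemma Rep.add {g g' : (Q.obj j).a} {h h' : (M.localCohomology x j).a} (H : Q.Rep x j g h)
    (H' : Q.Rep x j g' h') : Q.Rep x j (g + g') (h + h') := by
  obtain ⟨w, hw, hc⟩ := H
  obtain ⟨w', hw', hc'⟩ := H'
  refine ⟨w + w', ?_, HasClass.add hc hc'⟩
  rw [map_add, cechUnit_add]
  exact hw.add hw'

lemma Rep.smul (a : R) {g : (Q.obj j).a} {h : (M.localCohomology x j).a} (H : Q.Rep x j g h) :
    Q.Rep x j (a • g) (a • h) := by
  obtain ⟨w, hw, hc⟩ := H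
  refine ⟨a • w, ?_, HasClass.smul a hc⟩
  rw [map_smul, cechUnit_smul]
  exact DoubleComplex.Zigzag.map (C := Q.cechDouble x) (C' := Q.cechDouble x)
    (fun k l => (LinearMap.lsmul R (CechTerm x (Q.obj l).a k) a).toAddMonoidHom)
    (fun k l (z : CechTerm x (Q.obj l).a k) => (map_smul (cechD x (Q.obj l).a k) a z).symm)
    (fun k l (z : CechTerm x (Q.obj l).a k) => (map_smul (cechMap x (Q.dl l) k) a z).symm) hw

/-- Frobenius commutes with both differentials of the double complex and so preserves zigzags; this
is why the terms of the resolution carry actions. -/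
lemma Rep.action {g : (Q.obj j).a} {h : (M.localCohomology x j).a} (H : Q.Rep x j g h) :
    Q.Rep x j ((Q.obj j).action g) ((M.localCohomology x j).action h) := by
  obtain ⟨w, hw, hc⟩ := H
  refine ⟨_, ?_, hc.action⟩
  rw [cechMap_cechFrob, ← cechFrob_cechUnit]
  exact DoubleComplex.Zigzag.map (C := Q.cechDouble x) (C' := Q.cechDouble x)
    (fun k l => (cechFrob x (Q.obj l) k : CechTerm x (Q.obj l).a k →+ CechTerm x (Q.obj l).a k))
    (fun k l z => (cechFrob_cechD x (Q.obj l) k z).symm)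
    (fun k l z => (cechMap_cechFrob x (Q.d l) k z).symm) hw

/-- The columns are exact because localization is. Together with `Rep.exists_cocycle`, `Rep.bdry`
and `Rep.eq_zero`, this identifies Čech cohomology with the cohomology of the torsion elements of
the resolution. -/
lemma Rep.exists_class {g : (Q.obj j).a} (ht : IsTors p (Ideal.span (Set.range x)) g)
    (hd : Q.dl j g = 0) : ∃ h, Q.Rep x j g h := by
  obtain ⟨w, hw, h1, h2⟩ := DoubleComplex.Zigzag.exists_end (Q.cechDouble_colExact x)
    (Nat.zero_add j) (cechUnit x g) ((cechD_cechUnit_eq_zero_iff_isTors x g).mpr ht)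
    ((cechMap_cechUnit x (Q.dl j) g).trans (by rw [hd]; exact funext fun _ => awayMk_zero _))
  obtain ⟨w, rfl⟩ := (cechMap_exact x _ _ Q.exact₀ j w).mp h2
  obtain ⟨h, hh⟩ := CechClass.exists_of_d_eq_zero (x := x) (M := M.a) (z := w) (by
    apply cechMap_injective x Q.εl Q.ε_injective
    rw [cechMap_cechD, map_zero]
    exact h1)
  exact ⟨h, w, hw, hh⟩

/-- Here the rows are needed: they are exact in positive degrees since the terms of the resolution
are injective. -/
lemma Rep.exists_cocycle [IsNoetherianRing R] (h : (M.localCohomology x j).a) :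
    ∃ g, IsTors p (Ideal.span (Set.range x)) g ∧ Q.dl j g = 0 ∧ Q.Rep x j g h := by
  obtain ⟨w, hw⟩ : ∃ w, CechClass x M.a j w h := HasClass.exists_rep h
  obtain ⟨u, hu, h1, h2⟩ := DoubleComplex.Zigzag.exists_start (Q.cechDouble_rowExact x)
    (cechMap x Q.εl j w) ((cechMap_cechD x Q.εl j w).symm.trans (by rw [hw.d_eq_zero, map_zero]; rfl))
    ((cechMap_exact x _ _ Q.exact₀ j _).mpr ⟨w, rfl⟩)
  obtain ⟨g, rfl⟩ := (cechUnit_bijective x).2 u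
  refine ⟨g, (cechD_cechUnit_eq_zero_iff_isTors x g).mp h1, ?_, w, hu, hw⟩
  apply (cechUnit_bijective x).1
  rw [← cechMap_cechUnit]
  exact h2.trans (funext fun _ => (awayMk_zero _).symm)

lemma Rep.bdry [IsNoetherianRing R] {g : (Q.obj j).a} (H : Q.Rep x j g 0) :
    Q.Bdry (Ideal.span (Set.range x)) j g := by
  obtain ⟨w, hw, hc⟩ := H
  have hb := CechClass.zero_iff.mp hc
  have : (Q.cechDouble x).StartBdry j (cechUnit x g) := by
    refine hw.startBdry (Q.cechDouble_rowExact x) ?_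
    cases j with
    | zero =>
      obtain rfl : w = 0 := hb
      exact map_zero _
    | succ j =>
      obtain ⟨b, rfl⟩ := hb
      exact ⟨cechMap x Q.εl j b, (cechMap_cechD x Q.εl j b).symm,
        (cechMap_exact x _ _ Q.exact₀ j _).mpr ⟨b, rfl⟩⟩
  cases j with
  | zero => exact (cechUnit_bijective x).1 (this.trans (funext fun _ => (awayMk_zero _).symm))
  | succ j =>
    obtain ⟨b, hb, hb'⟩ := this
    obtain ⟨g', rfl⟩ := (cechUnit_bijective x).2 b
    refine ⟨g', (cechD_cechUnit_eq_zero_iff_isTors x g').mp hb', (cechUnit_bijective x).1 ?_⟩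
    rw [← cechMap_cechUnit]
    exact hb

lemma Rep.eq_zero {g : (Q.obj j).a} {h : (M.localCohomology x j).a} (H : Q.Rep x j g h)
    (hg : Q.Bdry (Ideal.span (Set.range x)) j g) : h = 0 := by
  obtain ⟨w, hw, hc⟩ := H
  refine HasClass.unique hc (CechClass.zero_iff.mpr ?_)
  have : (Q.cechDouble x).EndBdry j (cechMap x Q.εl j w) := by
    refine hw.endBdry (Q.cechDouble_colExact x) ?_
    cases j with
    | zero =>
      obtain rfl : g = 0 := hg
      exact funext fun _ => awayMk_zero _
    | succ j =>
      obtain ⟨g', h1, rfl⟩ := hg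
      exact ⟨cechUnit x g', cechMap_cechUnit x (Q.dl j) g',
        (cechD_cechUnit_eq_zero_iff_isTors x g').mpr h1⟩
  cases j with
  | zero =>
    apply cechMap_injective x Q.εl Q.ε_injective
    rw [map_zero]
    exact this
  | succ j =>
    obtain ⟨b, hb, hb'⟩ := this
    obtain ⟨b, rfl⟩ := (cechMap_exact x _ _ Q.exact₀ j b).mp hb'
    refine ⟨b, ?_⟩
    apply cechMap_injective x Q.εl Q.ε_injective
    rw [cechMap_cechD]
    exact hb

/-- Local cohomology does not depend on the choice of generators of the ideal. -/
theorem nonempty_localCohomology_iso [IsNoetherianRing R] (Q : FrobRes M) {r' : ℕ}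
    (x : Fin r → R) (x' : Fin r' → R)
    (hx : Ideal.span (Set.range x) = Ideal.span (Set.range x')) (j : ℕ) :
    Nonempty (M.localCohomology x j ≅ M.localCohomology x' j) := by
  -- Two classes correspond when one torsion cocycle of the resolution represents both; the torsion
  -- condition is the same for both families.
  let S : (M.localCohomology x j).a → (M.localCohomology x' j).a → Prop := fun h h' =>
    ∃ g : (Q.obj j).a, Q.Rep x j g h ∧ Q.Rep x' j g h'
  have hr0 : ∀ n, S 0 n → n = 0 := by
    rintro n ⟨g, h1, h2⟩
    exact h2.eq_zero (hx ▸ h1.bdry)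
  obtain ⟨e, he⟩ := exists_linearEquiv_of_rel S
    (by
      rintro m n m' n' ⟨g, h1, h2⟩ ⟨g', h1', h2'⟩
      exact ⟨g + g', h1.add h1', h2.add h2'⟩)
    (by
      rintro a m n ⟨g, h1, h2⟩
      exact ⟨a • g, h1.smul a, h2.smul a⟩)
    (by
      intro m
      obtain ⟨g, ht, hd, hg⟩ := Rep.exists_cocycle (Q := Q) m
      obtain ⟨n, hn⟩ := Rep.exists_class (x := x') (hx ▸ ht) hd
      exact ⟨n, g, hg, hn⟩)
    (by
      intro m
      obtain ⟨g, ht, hd, hg⟩ := Rep.exists_cocycle (Q := Q) m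
      obtain ⟨n, hn⟩ := Rep.exists_class (x := x) (hx ▸ ht) hd
      exact ⟨n, g, hn, hg⟩)
    (by
      rintro n ⟨g, h1, h2⟩
      exact h1.eq_zero (hx ▸ h2.bdry)) hr0
  refine ⟨RFMod.isoMk e fun m => ?_⟩
  obtain ⟨g, h1, h2⟩ := he m
  obtain ⟨g', h1', h2'⟩ := he ((M.localCohomology x j).action m)
  refine sub_eq_zero.mp (hr0 _ ⟨g' - (Q.obj j).action g, ?_, ?_⟩)
  · have := h1'.add (h1.action.smul (-1))
    rwa [neg_one_smul, neg_one_smul, ← sub_eq_add_neg, ← sub_eq_add_neg, sub_self] at this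
  · have := h2'.add (h2.action.smul (-1))
    rwa [neg_one_smul, neg_one_smul, ← sub_eq_add_neg, ← sub_eq_add_neg] at this

end FrobRes

/-! ### Exactness of the Frobenius functor and existence of resolutions -/

section Exactness

variable {R : Type u} [CommRing R] {p : ℕ} [Fact p.Prime] [CharP R p] {κ : Type} [Fintype κ]

lemma pull_map_sum_tau (B : FrobBasis R p κ) {M N : ModuleCat.{u} R} (f : M ⟶ N) (m : κ → M) :
    ((pull R p).map f).hom (∑ i, B.val i • tau M (m i)) = ∑ i, B.val i • tau N (f.hom (m i)) := by
  rw [map_sum]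
  simp only [map_smul, pull_map_tau]

lemma FrobBasis.pull_map_injective (B : FrobBasis R p κ) {M N : ModuleCat.{u} R} (f : M ⟶ N)
    (hf : Function.Injective f.hom) : Function.Injective ((pull R p).map f).hom := by
  refine (injective_iff_map_eq_zero _).mpr fun t ht => ?_
  obtain ⟨m, rfl⟩ := B.exists_eq_sum_tau M t
  rw [pull_map_sum_tau] at ht
  refine Finset.sum_eq_zero fun i _ => ?_
  rw [hf ((B.eq_zero_of_sum_tau ht i).trans (map_zero f.hom).symm), map_zero, smul_zero]

/-- If `R` is finite free over its Frobenius, then the Frobenius functor is exact. -/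
lemma FrobBasis.preservesFiniteLimits (B : FrobBasis R p κ) : PreservesFiniteLimits (pull R p) := by
  have key : ∀ S : ShortComplex (ModuleCat.{u} R), S.ShortExact →
      (S.map (pull R p)).Exact ∧ Mono ((pull R p).map S.f) := by
    intro S hS
    constructor
    rotate_left
    · rw [ModuleCat.mono_iff_injective]
      exact B.pull_map_injective S.f hS.moduleCat_injective_f
    rw [ShortComplex.moduleCat_exact_iff]
    intro t ht
    obtain ⟨m, rfl⟩ := B.exists_eq_sum_tau S.X₂ t
    have ht' : ∑ i, B.val i • tau (p := p) S.X₃ (S.g.hom (m i)) = 0 :=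
      (pull_map_sum_tau B S.g m).symm.trans ht
    choose m' hm' using fun i => (ShortComplex.moduleCat_exact_iff S).mp hS.exact (m i)
      (B.eq_zero_of_sum_tau ht' i)
    refine ⟨∑ i, B.val i • tau S.X₁ (m' i), ?_⟩
    refine (pull_map_sum_tau B S.f m').trans ?_
    exact Finset.sum_congr rfl fun i _ => congrArg (fun n => B.val i • tau S.X₂ n) (hm' i)
  exact ((Functor.preservesFiniteLimits_tfae (pull R p)).out 0 3).mp key

/-- Take any injective module containing `M`. Freeness over Frobenius keeps R¹ ⊗ M inside R¹ ⊗ H, so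
injectivity extends the structure map, without any canonical choice. The cokernel inherits an
action, which lets the construction be iterated. -/
lemma exists_frobHull (B : FrobBasis R p κ) (M : RFMod R p) :
    ∃ (H C : RFMod R p) (ι : M ⟶ H) (π : H ⟶ C), Module.Injective R H.a ∧
      Function.Injective ι.f.hom ∧ Function.Exact ι.f.hom π.f.hom ∧
      Function.Surjective π.f.hom := by
  let i : M.a ⟶ Injective.under M.a := Injective.ι M.a
  have hi : Function.Injective i.hom := (ModuleCat.mono_iff_injective i).mp inferInstance
  have : Mono ((pull R p).map i) :=
    (ModuleCat.mono_iff_injective _).mpr (B.pull_map_injective i hi)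
  let H : RFMod R p := ⟨Injective.under M.a, Injective.factorThru (M.str ≫ i) ((pull R p).map i)⟩
  let ι : M ⟶ H := ⟨i, Injective.comp_factorThru _ _⟩
  have hle : LinearMap.range ι.f.hom ≤ (LinearMap.range ι.f.hom).comap H.action := by
    rintro _ ⟨m, rfl⟩
    exact ⟨M.action m, RFMod.hom_action ι m⟩
  let C : RFMod R p := .ofAction (.of R (H.a ⧸ LinearMap.range ι.f.hom))
    (Submodule.mapQ _ _ H.action hle)
  let π : H ⟶ C := RFMod.homMk (N := C) (ModuleCat.ofHom (Submodule.mkQ _)) fun m => by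
    rw [show C.action = _ from RFMod.action_ofAction _ _]
    rfl
  refine ⟨H, C, ι, π, ?_, hi, ?_, Submodule.mkQ_surjective _⟩
  · have hI : ∀ J : ModuleCat.{u} R, Injective J → Module.Injective R J := fun J hJ =>
      Module.injective_module_of_injective_object R J (inj := hJ)
    exact hI (Injective.under M.a) inferInstance
  · exact LinearMap.exact_map_mkQ_range ι.f.hom

/-- Every `R[F]`-module has an injective resolution by `R[F]`-modules. -/
lemma FrobBasis.nonempty_frobRes (B : FrobBasis R p κ) (M : RFMod R p) :
    Nonempty (FrobRes M) := by
  choose H C ι π h1 h2 h3 h4 using exists_frobHull (R := R) (p := p) B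
  let K : ℕ → RFMod R p := fun l => Nat.rec M (fun _ N => C N) l
  refine ⟨⟨fun l => H (K l), fun l => π (K l) ≫ ι (C (K l)), ι M, fun l => h1 _, h2 M,
    fun z => ?_, fun l z => ?_⟩⟩
  · exact (map_eq_zero_iff (ι (C M)).f.hom (h2 (C M))).trans (h3 M z)
  · refine (map_eq_zero_iff (ι (C (C (K l)))).f.hom (h2 (C (C (K l))))).trans
      ((h3 (C (K l)) z).trans ?_)
    constructor
    · rintro ⟨y, rfl⟩
      obtain ⟨y, rfl⟩ := h4 _ y
      exact ⟨y, rfl⟩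
    · rintro ⟨y, rfl⟩
      exact ⟨_, rfl⟩

end Exactness

/-! ### Regular local rings -/

section Regular

open RingTheory.Sequence IsLocalRing
open scoped Pointwise

/-- An element of `Q` outside `P` is a nonzerodivisor on the domain R/P, so killing it lowers the
dimension. -/
lemma ringKrullDim_quotient_add_one_le {R : Type u} [CommRing R] {P Q : Ideal R} [P.IsPrime]
    (h : P < Q) : ringKrullDim (R ⧸ Q) + 1 ≤ ringKrullDim (R ⧸ P) := by
  obtain ⟨a, haQ, haP⟩ := Set.exists_of_ssubset h
  have ha : Ideal.Quotient.mk P a ∈ nonZeroDivisors (R ⧸ P) := by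
    rw [mem_nonZeroDivisors_iff_ne_zero, ne_eq, Ideal.Quotient.eq_zero_iff_mem]
    exact haP
  refine le_trans ?_ (ringKrullDim_quotient_succ_le_of_nonZeroDivisor ha)
  gcongr
  refine ringKrullDim_le_of_surjective
    (Ideal.Quotient.lift (Ideal.span {Ideal.Quotient.mk P a}) (Ideal.Quotient.factor h.le)
      fun b hb => ?_) (Ideal.Quotient.lift_surjective_of_surjective _ _
        (Ideal.Quotient.factor_surjective h.le))
  obtain ⟨c, rfl⟩ := Ideal.mem_span_singleton'.mp hb
  rw [map_mul, Ideal.Quotient.factor_mk, Ideal.Quotient.eq_zero_iff_mem.mpr haQ, mul_zero]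

lemma exists_isPrime_le_ringKrullDim_quotient {R : Type u} [CommRing R] {n : ℕ}
    (h : (n : WithBot ℕ∞) ≤ ringKrullDim R) :
    ∃ P : Ideal R, P.IsPrime ∧ (n : WithBot ℕ∞) ≤ ringKrullDim (R ⧸ P) := by
  obtain ⟨l, rfl⟩ := Order.le_krullDim_iff.mp h
  refine ⟨l.head.asIdeal, inferInstance, ?_⟩
  rw [ringKrullDim_quotient]
  exact Order.le_krullDim_iff.mpr ⟨⟨l.length, fun i => ⟨l i, l.head_le i⟩, l.step⟩, rfl⟩

lemma ofList_map_mk_eq_maximalIdeal {R : Type u} [CommRing R] [IsLocalRing R] {a : R} {rs : List R}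
    (h : Ideal.ofList (a :: rs) = maximalIdeal R) [IsLocalRing (R ⧸ Ideal.span {a})] :
    Ideal.ofList (rs.map (Ideal.Quotient.mk (Ideal.span {a}))) =
      maximalIdeal (R ⧸ Ideal.span {a}) := by
  rw [← map_maximalIdeal_of_surjective _ (Ideal.Quotient.mk_surjective (I := Ideal.span {a})), ← h,
    ← Ideal.map_ofList, Ideal.ofList_cons, Ideal.map_sup, Ideal.map_quotient_self, bot_sup_eq]

lemma isLocalRing_quotient_span_singleton {R : Type u} [CommRing R] [IsLocalRing R] {a : R}
    (ha : a ∈ maximalIdeal R) : IsLocalRing (R ⧸ Ideal.span {a}) := by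
  have : Nontrivial (R ⧸ Ideal.span {a}) := Ideal.Quotient.nontrivial_iff.mpr fun h =>
    (maximalIdeal.isMaximal R).ne_top (top_le_iff.mp (h ▸ (Ideal.span_singleton_le_iff_mem _).mpr ha))
  exact IsLocalRing.of_surjective' _ (Ideal.Quotient.mk_surjective (I := Ideal.span {a}))

lemma natCast_le_of_add_one_le {n : ℕ} {d : WithBot ℕ∞} (h : (n : WithBot ℕ∞) + 1 ≤ d + 1) :
    (n : WithBot ℕ∞) ≤ d := by
  induction d with
  | bot =>
    rw [WithBot.bot_add, le_bot_iff] at h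
    exact absurd h (WithBot.natCast_ne_bot (n + 1))
  | coe d =>
    induction d with
    | top => exact le_top
    | coe d =>
      have : n + 1 ≤ d + 1 := by exact_mod_cast h
      exact_mod_cast Nat.le_of_add_le_add_right this

lemma spanFinrank_ofList_le {R : Type u} [CommRing R] (rs : List R) :
    (Ideal.ofList rs).spanFinrank ≤ rs.length := by
  classical
  have h : {r | r ∈ rs} = (rs.toFinset : Set R) := by ext; simp
  rw [Ideal.ofList, h]
  refine (Submodule.spanFinrank_span_le_ncard_of_finite (Finset.finite_toSet _)).trans ?_
  rw [Set.ncard_coe_finset]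
  exact List.toFinset_card_le rs

/-- If the maximal ideal of a Noetherian local ring is generated by as many elements as the
dimension, then these elements form a regular sequence, and the ring is a domain. -/
lemma isDomain_and_isWeaklyRegular (n : ℕ) : ∀ {R : Type u} [CommRing R] [IsLocalRing R]
    [IsNoetherianRing R] (rs : List R), (n : WithBot ℕ∞) ≤ ringKrullDim R → rs.length = n →
      Ideal.ofList rs = maximalIdeal R → IsDomain R ∧ IsWeaklyRegular R rs := by
  induction n with
  | zero =>
    intro R _ _ _ rs _ hl hm
    obtain rfl : rs = [] := List.length_eq_zero_iff.mp hl
    rw [Ideal.ofList_nil] at hm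
    have := (isField_iff_maximalIdeal_eq.mpr hm.symm).isDomain
    exact ⟨this, .nil R R⟩
  | succ n ih =>
    intro R _ _ _ rs hd hl hm
    obtain ⟨a, rs, rfl⟩ := List.exists_cons_of_length_eq_add_one hl
    have ha : a ∈ maximalIdeal R := hm ▸ Ideal.subset_span (by simp)
    have hloc := isLocalRing_quotient_span_singleton ha
    -- Killing one element of the maximal ideal lowers the dimension of any nonzero quotient by at
    -- most one.
    have hdim : ∀ J : Ideal R, J ≠ ⊤ → ((n + 1 : ℕ) : WithBot ℕ∞) ≤ ringKrullDim (R ⧸ J) →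
        (n : WithBot ℕ∞) ≤ ringKrullDim (R ⧸ (J ⊔ Ideal.span {a})) := by
      intro J hJ h
      have : Nontrivial (R ⧸ J) := Ideal.Quotient.nontrivial_iff.mpr hJ
      have : IsLocalRing (R ⧸ J) :=
        IsLocalRing.of_surjective' _ (Ideal.Quotient.mk_surjective (I := J))
      have ha' : Ideal.Quotient.mk J a ∈ maximalIdeal (R ⧸ J) := by
        rw [← map_maximalIdeal_of_surjective _ (Ideal.Quotient.mk_surjective (I := J))]
        exact Ideal.mem_map_of_mem _ ha
      have h1 := h.trans (ringKrullDim_le_ringKrullDim_quotSMulTop_succ ha')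
      have e : Ideal.map (Ideal.Quotient.mk J) (Ideal.span {a}) =
          Ideal.Quotient.mk J a • (⊤ : Ideal (R ⧸ J)) := by
        rw [Ideal.map_span, Set.image_singleton, ← Submodule.ideal_span_singleton_smul]
        simp
      rw [← e, ringKrullDim_eq_of_ringEquiv (DoubleQuot.quotQuotEquivQuotSup J (Ideal.span {a}))]
        at h1
      rw [Nat.cast_add, Nat.cast_one] at h1
      exact natCast_le_of_add_one_le h1
    have hd1 : (n : WithBot ℕ∞) ≤ ringKrullDim (R ⧸ Ideal.span {a}) := by
      have := hdim ⊥ bot_ne_top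
        (by rwa [ringKrullDim_eq_of_ringEquiv (RingEquiv.quotientBot R)])
      rwa [bot_sup_eq] at this
    obtain ⟨hdom, hreg⟩ := ih (rs.map (Ideal.Quotient.mk (Ideal.span {a}))) hd1
      (by simpa using hl) (ofList_map_mk_eq_maximalIdeal hm)
    have hprime : (Ideal.span {a}).IsPrime := (Ideal.Quotient.isDomain_iff_prime _).mp hdom
    have hle : ringKrullDim (R ⧸ Ideal.span {a}) ≤ n := by
      refine (ringKrullDim_le_spanFinrank_maximalIdeal _).trans ?_
      rw [← ofList_map_mk_eq_maximalIdeal hm]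
      refine (Nat.cast_le.mpr (spanFinrank_ofList_le _)).trans ?_
      rw [List.length_map]
      exact Nat.cast_le.mpr (by simpa using hl.le)
    -- Choose a prime `P` with dim R/P ≥ n + 1. As (a) is prime with quotient of dimension at most
    -- n, comparison of dimensions gives P ⊆ (a) and a ∉ P. Then P = aP, and Nakayama yields P = 0.
    obtain ⟨P, hP, hPd⟩ := exists_isPrime_le_ringKrullDim_quotient hd
    have hPa : P ≤ Ideal.span {a} := by
      by_contra hcon
      have hlt : Ideal.span {a} < P ⊔ Ideal.span {a} :=
        lt_of_le_of_ne le_sup_right fun h => hcon (h ▸ le_sup_left)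
      have h1 := (add_le_add_left (hdim P hP.ne_top hPd) 1).trans
        ((ringKrullDim_quotient_add_one_le hlt).trans hle)
      have h2 : n + 1 ≤ n := by exact_mod_cast h1
      omega
    have haP : a ∉ P := fun h => by
      obtain rfl : P = Ideal.span {a} := le_antisymm hPa ((Ideal.span_singleton_le_iff_mem _).mpr h)
      have h1 : n + 1 ≤ n := Nat.cast_le.mp (hPd.trans hle)
      omega
    have hP0 : P = ⊥ := by
      refine Submodule.eq_bot_of_le_smul_of_le_jacobson_bot (Ideal.span {a}) P
        (IsNoetherian.noetherian P) ?_ (((Ideal.span_singleton_le_iff_mem _).mpr ha).trans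
          (maximalIdeal_le_jacobson _))
      intro y hy
      obtain ⟨z, rfl⟩ := Ideal.mem_span_singleton'.mp (hPa hy)
      rw [mul_comm]
      exact Submodule.smul_mem_smul (Ideal.mem_span_singleton_self a)
        ((hP.mem_or_mem hy).resolve_right haP)
    subst hP0
    have hR : IsDomain R := IsDomain.of_bot_isPrime R
    refine ⟨hR, (isWeaklyRegular_cons_iff' R a rs).mpr ⟨?_, ?_⟩⟩
    · exact fun y z h => mul_left_cancel₀ (fun h0 => haP h0) h
    · have e : Ideal.span {a} = a • (⊤ : Ideal R) := by
        rw [← Submodule.ideal_span_singleton_smul]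
        simp
      let f : (R ⧸ Ideal.span {a}) ≃+ QuotSMulTop a R :=
        (Submodule.quotEquivOfEq _ _ e).toAddEquiv
      refine (AddEquiv.isWeaklyRegular_congr (e := f) ?_).mp hreg
      refine List.forall₂_same.mpr fun r _ y => ?_
      obtain ⟨r, rfl⟩ := Ideal.Quotient.mk_surjective r
      obtain ⟨y, rfl⟩ := Ideal.Quotient.mk_surjective y
      rfl

/-- A regular local ring of dimension `n` is a domain, and its maximal ideal is generated by a
regular sequence of length `n`. -/
lemma exists_regular_list {R : Type u} [CommRing R] [IsRegularLocalRing R] {n : ℕ}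
    (hn : ringKrullDim R = n) : IsDomain R ∧ ∃ rs : List R, rs.length = n ∧
      Ideal.ofList rs = maximalIdeal R ∧ IsWeaklyRegular R rs := by
  obtain ⟨s, hs, hsp⟩ := Submodule.FG.exists_span_finset_card_eq_spanFinrank
    (IsNoetherian.noetherian (maximalIdeal R))
  have hc : s.card = n := by
    have := IsRegularLocalRing.spanFinrank_maximalIdeal (R := R)
    rw [hn, ← hs] at this
    exact_mod_cast this
  have hm : Ideal.ofList s.toList = maximalIdeal R := by
    rw [← hsp, Ideal.ofList]
    congr 1
    ext
    simp
  have := isDomain_and_isWeaklyRegular n s.toList hn.ge (by simpa using hc) hm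
  exact ⟨this.1, _, by simpa using hc, hm, this.2⟩

/-- Regularity of the first element on `C` keeps the sequence short exact modulo that element, so
induction on the list applies. -/
lemma IsWeaklyRegular.of_shortExact {R : Type u} [CommRing R] (rs : List R) :
    ∀ {A B C : Type u} [AddCommGroup A] [Module R A] [AddCommGroup B] [Module R B] [AddCommGroup C]
      [Module R C] (f : A →ₗ[R] B) (g : B →ₗ[R] C), Function.Injective f → Function.Exact f g →
      Function.Surjective g → IsWeaklyRegular A rs → IsWeaklyRegular C rs →
      IsWeaklyRegular B rs := by
  induction rs with
  | nil => exact fun _ _ _ _ _ _ _ => .nil R _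
  | cons r rs ih =>
    intro A B C _ _ _ _ _ _ f g hf hfg hg hA hC
    rw [isWeaklyRegular_cons_iff] at hA hC ⊢
    refine ⟨isSMulRegular_of_range_eq_ker hf hfg.linearMap_ker_eq.symm hA.1 hC.1, ?_⟩
    refine ih (QuotSMulTop.map r f) (QuotSMulTop.map r g) ?_
      (QuotSMulTop.map_exact r hfg hg) (QuotSMulTop.map_surjective r hg) hA.2 hC.2
    have h0 : Function.Exact (0 : PUnit.{u + 1} →ₗ[R] A) f := by
      rw [LinearMap.exact_zero_iff_injective]
      exact hf
    have := QuotSMulTop.map_first_exact_on_four_term_exact_of_isSMulRegular_last h0 hfg hC.1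
    rw [map_zero] at this
    exact (LinearMap.exact_zero_iff_injective _ _).mp this

/-- M/a^(t+1)M is an extension of M/aM by M/a^tM, the inclusion being multiplication by `a`. For t =
0 the quotient is zero, which weak regularity allows. -/
lemma IsWeaklyRegular.cons_pow {R : Type u} [CommRing R] {M : Type u} [AddCommGroup M] [Module R M]
    {a : R} {rs : List R} (h : IsWeaklyRegular M (a :: rs)) (t : ℕ) :
    IsWeaklyRegular M (a ^ t :: rs) := by
  rw [isWeaklyRegular_cons_iff] at h ⊢
  refine ⟨h.1.pow t, ?_⟩
  induction t with
  | zero =>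
    have : Subsingleton (QuotSMulTop (a ^ 0) M) := by
      rw [pow_zero, QuotSMulTop, one_smul]
      exact Submodule.Quotient.subsingleton_iff.mpr rfl
    exact ⟨fun i _ => Function.injective_of_subsingleton _⟩
  | succ t ih =>
    have hle : a ^ t • (⊤ : Submodule R M) ≤
        (a ^ (t + 1) • (⊤ : Submodule R M)).comap (LinearMap.lsmul R M a) := by
      rintro _ ⟨m, -, rfl⟩
      exact ⟨m, trivial, by simp [pow_succ', mul_smul, smul_comm a]⟩
    have hle' : a ^ (t + 1) • (⊤ : Submodule R M) ≤ (a • ⊤ : Submodule R M).comap LinearMap.id := by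
      rintro _ ⟨m, -, rfl⟩
      exact ⟨a ^ t • m, trivial, by simp [pow_succ', mul_smul, smul_comm a]⟩
    refine IsWeaklyRegular.of_shortExact rs (Submodule.mapQ _ _ _ hle) (Submodule.mapQ _ _ _ hle')
      ?_ ?_ ?_ ih h.2
    · refine (injective_iff_map_eq_zero _).mpr fun z hz => ?_
      obtain ⟨m, rfl⟩ := Submodule.mkQ_surjective _ z
      obtain ⟨m', -, hm'⟩ := (Submodule.Quotient.mk_eq_zero _).mp hz
      refine (Submodule.Quotient.mk_eq_zero _).mpr ⟨m', trivial, h.1 ?_⟩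
      simpa [pow_succ', mul_smul] using hm'
    · intro z
      obtain ⟨m, rfl⟩ := Submodule.mkQ_surjective _ z
      constructor
      · intro hz
        obtain ⟨m', -, rfl⟩ := (Submodule.Quotient.mk_eq_zero _).mp hz
        exact ⟨Submodule.Quotient.mk m', rfl⟩
      · rintro ⟨w, hw⟩
        obtain ⟨m', rfl⟩ := Submodule.mkQ_surjective _ w
        rw [← hw]
        exact (Submodule.Quotient.mk_eq_zero _).mpr ⟨m', trivial, rfl⟩
    · intro z
      obtain ⟨m, rfl⟩ := Submodule.mkQ_surjective _ z
      exact ⟨Submodule.Quotient.mk m, rfl⟩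

lemma IsWeaklyRegular.map_pow {R : Type u} [CommRing R] (t : ℕ) (rs : List R) :
    ∀ {M : Type u} [AddCommGroup M] [Module R M], IsWeaklyRegular M rs →
      IsWeaklyRegular M (rs.map (· ^ t)) := by
  induction rs with
  | nil => exact fun _ => .nil R _
  | cons r rs ih =>
    intro M _ _ h
    have h' := (isWeaklyRegular_cons_iff _ _ _).mp (IsWeaklyRegular.cons_pow h t)
    exact (isWeaklyRegular_cons_iff _ _ _).mpr ⟨h'.1, ih h'.2⟩

/-- A finite module of maximal depth over a regular local ring is free. -/
lemma free_of_isWeaklyRegular (n : ℕ) : ∀ {R : Type u} [CommRing R] [IsLocalRing R]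
    [IsNoetherianRing R] (rs : List R), rs.length = n → Ideal.ofList rs = maximalIdeal R →
    ∀ (M : Type u) [AddCommGroup M] [Module R M] [Module.Finite R M], IsWeaklyRegular M rs →
      Module.Free R M := by
  induction n with
  | zero =>
    intro R _ _ _ rs hl hm M _ _ _ _
    obtain rfl : rs = [] := List.length_eq_zero_iff.mp hl
    rw [Ideal.ofList_nil] at hm
    let := (isField_iff_maximalIdeal_eq.mpr hm.symm).toField
    exact Module.Free.of_divisionRing R M
  | succ n ih =>
    intro R _ _ _ rs hl hm M _ _ _ h
    obtain ⟨a, rs, rfl⟩ := List.exists_cons_of_length_eq_add_one hl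
    have ha : a ∈ maximalIdeal R := hm ▸ Ideal.subset_span (by simp)
    have hloc := isLocalRing_quotient_span_singleton ha
    rw [isWeaklyRegular_cons_iff'] at h
    have := Module.finitePresentation_of_finite R M
    have := Module.Finite.of_restrictScalars_finite R (R ⧸ Ideal.span {a}) (QuotSMulTop a M)
    exact (Module.free_quotSMulTop_iff_free R M (maximalIdeal_le_jacobson _ ha) h.1).mp
      (ih _ (by simpa using hl) (ofList_map_mk_eq_maximalIdeal hm) _ h.2)

/-- A regular local ring with finite Frobenius is free over its Frobenius. -/
lemma exists_frobBasis {R : Type u} [CommRing R] [IsRegularLocalRing R] {p : ℕ} [Fact p.Prime]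
    [CharP R p] (hF : (frobenius R p).Finite) {n : ℕ} (hn : ringKrullDim R = n) :
    ∃ N : ℕ, Nonempty (FrobBasis R p (Fin N)) := by
  obtain ⟨-, rs, hl, hm, hreg⟩ := exists_regular_list hn
  let M : ModuleCat.{u} R := (push R p).obj (ModuleCat.of R R)
  have hfin : Module.Finite R M := hF
  let e : M ≃+ R := AddEquiv.refl R
  -- An element acts on the pushforward as its p-th power acts on `R`.
  have hM : IsWeaklyRegular M rs := by
    refine (AddEquiv.isWeaklyRegular_congr (e := e) (bs := rs.map (· ^ p)) ?_).mpr
      (IsWeaklyRegular.map_pow p rs hreg)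
    refine List.forall₂_map_right_iff.mpr (List.forall₂_same.mpr fun r _ y => ?_)
    rfl
  have := free_of_isWeaklyRegular n rs hl hm M hM
  exact ⟨_, ⟨Module.finBasis R M⟩⟩

end Regular

/-! ### Local cohomology and regular sequences -/

section CechRegular

open RingTheory.Sequence
open scoped Pointwise

variable {R : Type u} [CommRing R] {r : ℕ} (x : Fin r → R)

/-- The Čech complex of `M` has no cohomology in degree `k`. -/
def CechVanish (M : ModuleCat.{u} R) (k : ℕ) : Prop :=
  ∀ z : CechTerm x M k, cechD x M k z = 0 → CechBdry x M k z

variable {x}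

lemma CechBdry.map {M N : ModuleCat.{u} R} (g : M →ₗ[R] N) {k : ℕ} {z : CechTerm x M k}
    (hz : CechBdry x M k z) : CechBdry x N k (cechMap x g k z) := by
  cases k with
  | zero => rw [show z = 0 from hz, map_zero]; rfl
  | succ k =>
    obtain ⟨u, rfl⟩ := hz
    exact ⟨cechMap x g k u, (cechMap_cechD x g k u).symm⟩

lemma CechBdry.d_eq_zero {M : ModuleCat.{u} R} {k : ℕ} {z : CechTerm x M k}
    (hz : CechBdry x M k z) : cechD x M k z = 0 := by
  cases k with
  | zero => rw [show z = 0 from hz, map_zero]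
  | succ k =>
    obtain ⟨u, rfl⟩ := hz
    exact cechD_cechD x k u

/-- A class is represented by a torsion cocycle of an injective resolution, and some power of `a`
kills that cocycle. -/
lemma exists_pow_smul_cechBdry [IsNoetherianRing R] {p : ℕ} [Fact p.Prime] [CharP R p] {κ : Type}
    [Fintype κ] (B : FrobBasis R p κ) (M : ModuleCat.{u} R) {a : R}
    (ha : a ∈ Ideal.span (Set.range x)) {k : ℕ} {z : CechTerm x M k} (hz : cechD x M k z = 0) :
    ∃ t : ℕ, CechBdry x M k (a ^ t • z) := by
  -- Only the underlying module matters here, so the zero action suffices to obtain a resolution.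
  let M' : RFMod R p := .ofAction M 0
  obtain ⟨Q⟩ := B.nonempty_frobRes M'
  obtain ⟨h, hh⟩ := CechClass.exists_of_d_eq_zero (x := x) (M := M) hz
  obtain ⟨g, ⟨t, ht⟩, -, hg⟩ := FrobRes.Rep.exists_cocycle (Q := Q) (x := x) (M := M') h
  have h0 := hg.smul (a ^ p ^ t)
  rw [ht a ha] at h0
  have h1 := h0.eq_zero (by cases k; exacts [rfl, ⟨0, ⟨0, fun _ _ => smul_zero _⟩, map_zero _⟩])
  refine ⟨p ^ t, CechClass.zero_iff.mp ?_⟩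
  have h2 : CechClass x M k (a ^ p ^ t • z) (a ^ p ^ t • h) := HasClass.smul _ hh
  exact h1 ▸ h2

/-! #### The long exact sequence of multiplication by a regular element -/

variable {M N : ModuleCat.{u} R} {a : R} {g : M →ₗ[R] N}

lemma smul_cech_injective (ha : IsSMulRegular M a) (k : ℕ) {z w : CechTerm x M k}
    (h : a • z = a • w) : z = w := by
  refine cechMap_injective x (LinearMap.lsmul R M a) ha k ?_
  rw [cechMap_lsmul, cechMap_lsmul, h]

lemma exists_smul_of_cechMap_eq_zero (hex : Function.Exact (LinearMap.lsmul R M a) g) {k : ℕ}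
    {z : CechTerm x M k} (hz : cechMap x g k z = 0) : ∃ w, z = a • w := by
  obtain ⟨w, rfl⟩ := (cechMap_exact x _ _ hex k z).mp hz
  exact ⟨w, cechMap_lsmul x a k w⟩

lemma cechMap_smul_eq_zero (hex : Function.Exact (LinearMap.lsmul R M a) g) {k : ℕ}
    (z : CechTerm x M k) : cechMap x g k (a • z) = 0 := by
  rw [← cechMap_lsmul]
  exact (cechMap_exact x _ _ hex k _).mpr ⟨z, rfl⟩

lemma exists_sub_smul_bdry (hg : Function.Surjective g)
    (hex : Function.Exact (LinearMap.lsmul R M a) g) {k : ℕ} {w : CechTerm x M k}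
    (hw : CechBdry x N k (cechMap x g k w)) : ∃ w', CechBdry x M k (w - a • w') := by
  cases k with
  | zero =>
    obtain ⟨w', rfl⟩ := exists_smul_of_cechMap_eq_zero hex hw
    exact ⟨w', sub_self _⟩
  | succ k =>
    obtain ⟨v, hv⟩ := hw
    obtain ⟨v, rfl⟩ := cechMap_surjective x g hg k v
    obtain ⟨w', hw'⟩ := exists_smul_of_cechMap_eq_zero (z := w - cechD x M k v) hex (by
      rw [map_sub, cechMap_cechD, hv, sub_self])
    exact ⟨w', v, by rw [← hw', sub_sub_cancel]⟩

/-- Multiplication by `a` is injective on H^k(M) because the preceding group H^{k-1}(N) in the long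
exact sequence vanishes. -/
lemma cechBdry_of_smul (ha : IsSMulRegular M a) (hg : Function.Surjective g)
    (hex : Function.Exact (LinearMap.lsmul R M a) g) {e : ℕ} (hN : ∀ k < e, CechVanish x N k)
    {k : ℕ} (hk : k < e + 1) {z : CechTerm x M k} (h : CechBdry x M k (a • z)) :
    CechBdry x M k z := by
  cases k with
  | zero => exact smul_cech_injective ha 0 (h.trans (smul_zero a).symm)
  | succ k =>
    obtain ⟨w, hw⟩ := h
    obtain ⟨w', hw'⟩ := exists_sub_smul_bdry hg hex (hN k (by omega) (cechMap x g k w) (by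
      rw [← cechMap_cechD, hw, cechMap_smul_eq_zero hex]))
    refine ⟨w', smul_cech_injective ha _ ?_⟩
    have := hw'.d_eq_zero
    rw [map_sub, map_smul, hw] at this
    exact (sub_eq_zero.mp this).symm

/-- On these cohomology groups `a` acts injectively and also locally nilpotently, so they are zero.
-/
lemma cechVanish_of_quot [IsNoetherianRing R] {p : ℕ} [Fact p.Prime] [CharP R p] {κ : Type}
    [Fintype κ] (B : FrobBasis R p κ) (hax : a ∈ Ideal.span (Set.range x))
    (ha : IsSMulRegular M a) (hg : Function.Surjective g)
    (hex : Function.Exact (LinearMap.lsmul R M a) g) {e : ℕ} (hN : ∀ k < e, CechVanish x N k)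
    (k : ℕ) (hk : k < e + 1) : CechVanish x M k := by
  intro z hz
  obtain ⟨t, ht⟩ := exists_pow_smul_cechBdry B M hax hz
  induction t with
  | zero => rwa [pow_zero, one_smul] at ht
  | succ t ih =>
    rw [pow_succ', mul_smul] at ht
    exact ih (cechBdry_of_smul ha hg hex hN hk ht)

/-- Exactness at H^k(N) in the long exact sequence, between H^k(M) and H^{k+1}(M). -/
lemma CechVanish.quot (ha : IsSMulRegular M a) (hg : Function.Surjective g)
    (hex : Function.Exact (LinearMap.lsmul R M a) g) {k : ℕ} (h0 : CechVanish x M k)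
    (h1 : CechVanish x M (k + 1)) : CechVanish x N k := by
  intro z hz
  obtain ⟨w, rfl⟩ := cechMap_surjective x g hg k z
  rw [← cechMap_cechD] at hz
  obtain ⟨w', hw'⟩ := exists_smul_of_cechMap_eq_zero hex hz
  obtain ⟨u, rfl⟩ := h1 w' (smul_cech_injective ha _ (by
    rw [← map_smul, ← hw', cechD_cechD, smul_zero]))
  have := (h0 (w - a • u) (by rw [map_sub, map_smul, hw', sub_self])).map g
  rwa [map_sub, cechMap_smul_eq_zero hex, sub_zero] at this

/-- The `a`-torsion of `H^{k+1}(M)` is `H^k(M/aM)`, if `a` is regular on `M` and `H^k(M) = 0`. -/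
lemma exists_connecting (ha : IsSMulRegular M a) (hg : Function.Surjective g)
    (hex : Function.Exact (LinearMap.lsmul R M a) g) {k : ℕ} (h0 : CechVanish x M k) :
    ∃ δ : (cechComplex x N).homology k →ₗ[R] (cechComplex x M).homology (k + 1),
      Function.Injective δ ∧ ∀ h, (∃ h', δ h' = h) ↔ a • h = 0 := by
  let H := (cechComplex x M).homology (k + 1)
  -- The connecting homomorphism as a relation: lift a cocycle of `N` to w, and divide the
  -- coboundary of w by `a`.
  let S : Submodule.torsionBy R H a → (cechComplex x N).homology k → Prop := fun h h' =>
    ∃ (w : CechTerm x M k) (w' : CechTerm x M (k + 1)), cechD x M k w = a • w' ∧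
      CechClass x M (k + 1) w' h ∧ CechClass x N k (cechMap x g k w) h'
  obtain ⟨e, -⟩ := exists_linearEquiv_of_rel S
    (by
      rintro h h' k k' ⟨w, w', h1, h2, h3⟩ ⟨v, v', h1', h2', h3'⟩
      refine ⟨w + v, w' + v', by rw [map_add, h1, h1', smul_add], HasClass.add h2 h2', ?_⟩
      rw [map_add]
      exact HasClass.add h3 h3')
    (by
      rintro b h h' ⟨w, w', h1, h2, h3⟩
      refine ⟨b • w, b • w', by rw [map_smul, h1]; exact smul_comm b a w', HasClass.smul b h2, ?_⟩
      rw [map_smul]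
      exact HasClass.smul b h3)
    (by
      rintro ⟨h, hh⟩
      obtain ⟨w', hw'⟩ : ∃ w', CechClass x M (k + 1) w' h := HasClass.exists_rep h
      have h1 : CechClass x M (k + 1) (a • w') (a • h) := HasClass.smul a hw'
      rw [(Submodule.mem_torsionBy_iff a h).mp hh] at h1
      obtain ⟨w, hw⟩ := CechClass.zero_iff.mp h1
      obtain ⟨h', hh'⟩ := CechClass.exists_of_d_eq_zero (x := x) (z := cechMap x g k w) (by
        rw [← cechMap_cechD, hw, cechMap_smul_eq_zero hex])
      exact ⟨h', w, w', hw, hw', hh'⟩)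
    (by
      intro h'
      obtain ⟨z, hz⟩ : ∃ z, CechClass x N k z h' := HasClass.exists_rep h'
      obtain ⟨w, rfl⟩ := cechMap_surjective x g hg k z
      have hd := hz.d_eq_zero
      rw [← cechMap_cechD] at hd
      obtain ⟨w', hw'⟩ := exists_smul_of_cechMap_eq_zero hex hd
      obtain ⟨h, hh⟩ := CechClass.exists_of_d_eq_zero (x := x) (z := w')
        (smul_cech_injective ha _ (by rw [← map_smul, ← hw', cechD_cechD, smul_zero]))
      refine ⟨⟨h, (Submodule.mem_torsionBy_iff a h).mpr ?_⟩, w, w', hw', hh, hz⟩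
      have h1 : CechClass x M (k + 1) (a • w') (a • h) := HasClass.smul a hh
      exact HasClass.unique h1 (CechClass.zero_iff.mpr ⟨w, hw'⟩))
    (by
      rintro ⟨h, hh⟩ ⟨w, w', h1, h2, h3⟩
      obtain ⟨u, hu⟩ := exists_sub_smul_bdry hg hex (CechClass.zero_iff.mp h3)
      have h4 := hu.d_eq_zero
      rw [map_sub, map_smul, h1] at h4
      refine Subtype.ext (HasClass.unique h2 (CechClass.zero_iff.mpr ⟨u, ?_⟩))
      exact (smul_cech_injective ha _ (sub_eq_zero.mp h4)).symm)
    (by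
      rintro h' ⟨w, w', h1, h2, h3⟩
      obtain ⟨u, rfl⟩ := CechClass.zero_iff.mp h2
      have := (h0 (w - a • u) (by rw [map_sub, map_smul, h1, sub_self])).map g
      rw [map_sub, cechMap_smul_eq_zero hex, sub_zero] at this
      exact HasClass.unique h3 (CechClass.zero_iff.mpr this))
  refine ⟨(Submodule.torsionBy R H a).subtype ∘ₗ e.symm.toLinearMap,
    Subtype.val_injective.comp e.symm.injective, fun h => ⟨?_, fun hh => ?_⟩⟩
  · rintro ⟨h', rfl⟩
    exact (Submodule.mem_torsionBy_iff a _).mp (e.symm h').2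
  · exact ⟨e ⟨h, (Submodule.mem_torsionBy_iff a h).mpr hh⟩, congrArg Subtype.val
      (e.symm_apply_apply _)⟩

lemma exact_lsmul_mkQ (M : Type u) [AddCommGroup M] [Module R M] (a : R) :
    Function.Exact (LinearMap.lsmul R M a) (Submodule.mkQ (a • (⊤ : Submodule R M))) :=
  LinearMap.exact_lsmul_mkQ_smul_top M a

section

variable [IsNoetherianRing R] {p : ℕ} [Fact p.Prime] [CharP R p] {κ : Type} [Fintype κ]
  (x)

lemma cechVanish_of_isWeaklyRegular (B : FrobBasis R p κ) (rs : List R) (hrs : ∀ a ∈ rs, a ∈ Ideal.span (Set.range x)) :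
    ∀ (M : ModuleCat.{u} R), IsWeaklyRegular M rs → ∀ k < rs.length, CechVanish x M k := by
  induction rs with
  | nil => exact fun M _ k hk => absurd hk (Nat.not_lt_zero k)
  | cons a rs ih =>
    intro M h k hk
    rw [isWeaklyRegular_cons_iff] at h
    exact cechVanish_of_quot (N := .of R (QuotSMulTop a M)) B (hrs a (by simp)) h.1
      (Submodule.mkQ_surjective _) (exact_lsmul_mkQ M a)
      (ih (fun b hb => hrs b (by simp [hb])) (.of R (QuotSMulTop a M)) h.2) k hk

/-- For a regular sequence `rs` on `M`, the `rs`-torsion of the first nonvanishing local cohomology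
of `M` is `M/(rs)M`. -/
lemma exists_quot_to_homology (B : FrobBasis R p κ) (rs : List R)
    (hrs : ∀ a ∈ rs, a ∈ Ideal.span (Set.range x)) :
    ∀ (M : ModuleCat.{u} R), IsWeaklyRegular M rs →
      (∀ (m : M ⧸ (Ideal.ofList rs • ⊤ : Submodule R M)) (i : Fin r), ∃ k : ℕ, x i ^ k • m = 0) →
      ∃ f : (M ⧸ (Ideal.ofList rs • ⊤ : Submodule R M)) →ₗ[R]
          (cechComplex x M).homology rs.length,
        Function.Injective f ∧ ∀ h, (∃ m, f m = h) ↔ ∀ a ∈ rs, a • h = 0 := by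
  induction rs with
  | nil =>
    intro M _ ht
    have hbot : (Ideal.ofList ([] : List R) • ⊤ : Submodule R M) = ⊥ := by
      rw [Ideal.ofList_nil, Submodule.bot_smul]
    let q : (M ⧸ (Ideal.ofList ([] : List R) • ⊤ : Submodule R M)) ≃ₗ[R] M :=
      Submodule.quotEquivOfEqBot _ hbot
    have hz : ∀ m : M, cechD x M 0 (cechUnit x m) = 0 := fun m => by
      rw [cechD_cechUnit_eq_zero_iff]
      intro i
      obtain ⟨k, hk⟩ := ht (q.symm m) i
      refine ⟨k, q.symm.injective ?_⟩
      rw [map_smul, hk, map_zero]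
    -- With no elements left, the torsion hypothesis makes all of `M` equal to its degree zero
    -- cohomology.
    obtain ⟨e, -⟩ := exists_linearEquiv_of_rel (R := R) (M := M)
      (N := (cechComplex x M).homology 0) (fun m h => CechClass x M 0 (cechUnit x m) h)
      (fun m h m' h' H H' => by
        rw [cechUnit_add]
        exact HasClass.add H H')
      (fun a m h H => by
        rw [cechUnit_smul]
        exact HasClass.smul a H)
      (fun m => CechClass.exists_of_d_eq_zero (hz m))
      (fun h => by
        obtain ⟨z, H⟩ : ∃ z, CechClass x M 0 z h := HasClass.exists_rep h
        obtain ⟨m, rfl⟩ := (cechUnit_bijective x).2 z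
        exact ⟨m, H⟩)
      (fun m H => (cechUnit_bijective x).1 ((CechClass.zero_iff.mp H).trans
        (funext fun _ => (awayMk_zero _).symm)))
      (fun h H => HasClass.unique H (CechClass.zero_iff.mpr (funext fun _ => awayMk_zero _)))
    refine ⟨e.toLinearMap ∘ₗ q.toLinearMap, e.injective.comp q.injective, fun h => ⟨?_, ?_⟩⟩
    · exact fun _ a ha => absurd ha List.not_mem_nil
    · exact fun _ => (e.surjective.comp q.surjective) h
  | cons a rs ih =>
    intro M h ht
    have h' := (isWeaklyRegular_cons_iff _ _ _).mp h
    have hrs' : ∀ b ∈ rs, b ∈ Ideal.span (Set.range x) := fun b hb => hrs b (by simp [hb])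
    let N : ModuleCat.{u} R := .of R (QuotSMulTop a M)
    let q := Submodule.quotOfListConsSMulTopEquivQuotSMulTopInner M a rs
    obtain ⟨f, hf, hf'⟩ := ih hrs' N h'.2 (fun m i => by
      obtain ⟨k, hk⟩ := ht (q.symm m) i
      refine ⟨k, q.symm.injective ?_⟩
      rw [map_smul, hk, map_zero])
    -- The `a`-torsion is the previous cohomology of M/aM, and inside it the torsion for the
    -- remaining elements is known by induction.
    obtain ⟨δ, hδ, hδ'⟩ := exists_connecting (x := x) (N := N) h'.1 (Submodule.mkQ_surjective _)
      (exact_lsmul_mkQ M a) (cechVanish_of_isWeaklyRegular x B (a :: rs) hrs M h rs.length (by simp))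
    refine ⟨δ ∘ₗ f ∘ₗ q.toLinearMap, hδ.comp (hf.comp q.injective), fun z => ⟨?_, fun hz => ?_⟩⟩
    · rintro ⟨m, rfl⟩ b hb
      rcases List.mem_cons.mp hb with rfl | hb
      · exact (hδ' _).mp ⟨_, rfl⟩
      · exact (map_smul δ b _).symm.trans ((congrArg δ ((hf' (f (q m))).mp ⟨q m, rfl⟩ b hb)).trans
          (map_zero δ))
    · obtain ⟨y, rfl⟩ := (hδ' z).mpr (hz a (by simp))
      obtain ⟨m, rfl⟩ := (hf' y).mpr fun b hb => hδ (by
        rw [map_smul, map_zero]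
        exact hz b (by simp [hb]))
      exact ⟨q.symm m, congrArg (fun t => δ (f t)) (q.apply_symm_apply m)⟩

end

end CechRegular

/-! ### Depth and the dimension formula -/

section Depth

open RingTheory.Sequence IsLocalRing
open scoped Pointwise

/-- A longest chain of primes containing `I` starts at a prime of height at least c; prolong it
downwards. -/
lemma height_add_le_ringKrullDim {R : Type u} [CommRing R] {I : Ideal R} {c d n : ℕ}
    (hc : I.height = c) (hd : ringKrullDim (R ⧸ I) = d) (hn : ringKrullDim R = n) : c + d ≤ n := by
  rw [ringKrullDim_quotient] at hd
  obtain ⟨l, hl⟩ := Order.le_krullDim_iff.mp hd.ge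
  let l' : LTSeries (PrimeSpectrum R) := ⟨l.length, fun i => (l i).1, l.step⟩
  have : Nonempty (PrimeSpectrum R) := ⟨l'.head⟩
  have h1 : (d : ℕ∞) ≤ Order.coheight l'.head := hl ▸ Order.length_le_coheight_head (p := l')
  have h2 : (c : ℕ∞) ≤ Order.height l'.head := by
    rw [← hc]
    refine (Ideal.height_mono (J := l'.head.asIdeal) l.head.2).trans ?_
    rw [PrimeSpectrum.height_eq_orderHeight]
  have h3 := le_iSup (fun a : PrimeSpectrum R => Order.height a + Order.coheight a) l'.head
  rw [ringKrullDim, Order.krullDim_eq_iSup_height_add_coheight_of_nonempty] at hn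
  have h4 : ((c + d : ℕ) : ℕ∞) ≤ n := by
    rw [Nat.cast_add]
    refine (add_le_add h2 h1).trans (h3.trans ?_)
    exact (WithBot.coe_le_coe.mp hn.le)
  exact_mod_cast h4

/-- At a minimal prime over `I` the sequence becomes regular in the local ring, whose dimension
drops by exactly its length. -/
lemma length_le_height {R : Type u} [CommRing R] [IsNoetherianRing R] {I : Ideal R} {rs : List R}
    (h : IsWeaklyRegular R rs) (hI : ∀ a ∈ rs, a ∈ I) : (rs.length : ℕ∞) ≤ I.height := by
  rw [Ideal.height_eq_inf_minimalPrimes]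
  refine le_iInf₂ fun Q hQ => ?_
  have := hQ.1.1
  have hreg := IsWeaklyRegular.isRegular_of_isLocalization_of_mem (Localization.AtPrime Q) Q h
    fun a ha => hQ.1.2 (hI a ha)
  have h1 := ringKrullDim_add_length_eq_ringKrullDim_of_isRegular _ hreg
  rw [IsLocalization.AtPrime.ringKrullDim_eq_height Q (Localization.AtPrime Q), List.length_map]
    at h1
  have : Nontrivial (Localization.AtPrime Q ⧸
      Ideal.ofList (rs.map (algebraMap R (Localization.AtPrime Q)))) := by
    refine Ideal.Quotient.nontrivial_iff.mpr fun h0 => hreg.top_ne_smul ?_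
    rw [h0, Submodule.top_smul]
  have h2 : (rs.length : WithBot ℕ∞) ≤ Q.height := by
    rw [← h1]
    exact le_add_of_nonneg_left ringKrullDim_nonneg_of_nontrivial
  exact_mod_cast h2

/-- Prime avoidance: the zero divisors on `M` are the union of its finitely many associated primes.
-/
lemma exists_mem_isSMulRegular {R : Type u} [CommRing R] [IsNoetherianRing R]
    {M : ModuleCat.{u} R} {I : Ideal R} [Module.Finite R M]
    (h : ∀ P ∈ associatedPrimes R M, ¬ I ≤ P) : ∃ a ∈ I, IsSMulRegular M a := by
  by_contra hcon
  push Not at hcon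
  have hsub : (I : Set R) ⊆ ⋃ P ∈ associatedPrimes R M, P := by
    rw [biUnion_associatedPrimes_eq_compl_regular]
    exact hcon
  obtain ⟨P, hP, hle⟩ := (Ideal.subset_union_prime_finite (associatedPrimes.finite R M) (f := id)
    ⊥ ⊥ fun P hP _ _ => hP.isPrime).mp hsub
  exact h P hP hle

variable {R : Type u} [CommRing R] [IsLocalRing R] [IsNoetherianRing R] {r : ℕ} {x : Fin r → R}
  {M : ModuleCat.{u} R}

/-- A nonzero element killed by the maximal ideal would be a nonzero Čech cocycle of degree zero. -/
lemma maximalIdeal_notMem_associatedPrimes (hx : Ideal.span (Set.range x) = maximalIdeal R)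
    (h : CechVanish x M 0) : maximalIdeal R ∉ associatedPrimes R M := by
  intro hm
  obtain ⟨-, y, hy⟩ := isAssociatedPrime_iff.mp hm
  have hPy : ∀ b ∈ maximalIdeal R, b • y = 0 := fun b hb => by
    rw [hy, Submodule.mem_colon_singleton, Submodule.mem_bot] at hb
    exact hb
  have h0 : cechUnit x y = 0 := h _ ((cechD_cechUnit_eq_zero_iff x y).mpr fun i =>
    ⟨1, by rw [pow_one]; exact hPy _ (hx ▸ Ideal.subset_span ⟨i, rfl⟩)⟩)
  have hy0 : y = 0 := (cechUnit_bijective x).1 (h0.trans (funext fun _ => (awayMk_zero _).symm))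
  refine hm.isPrime.ne_top ((Ideal.eq_top_iff_one _).mpr ?_)
  rw [hy, Submodule.mem_colon_singleton, hy0, smul_zero]
  exact Submodule.zero_mem _

/-- The depth is at most the dimension of any associated prime. -/
lemma le_ringKrullDim_of_mem_associatedPrimes (hx : Ideal.span (Set.range x) = maximalIdeal R)
    (e : ℕ) : ∀ (M : ModuleCat.{u} R) [Module.Finite R M], (∀ k < e, CechVanish x M k) →
      ∀ P ∈ associatedPrimes R M, (e : WithBot ℕ∞) ≤ ringKrullDim (R ⧸ P) := by
  induction e with
  | zero =>
    intro M _ _ P hP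
    have := hP.isPrime
    have : Nontrivial (R ⧸ P) := Ideal.Quotient.nontrivial_iff.mpr hP.isPrime.ne_top
    exact ringKrullDim_nonneg_of_nontrivial
  | succ e ih =>
    intro M _ hM P hP
    have hPp := hP.isPrime
    obtain ⟨a, ham, ha⟩ := exists_mem_isSMulRegular (M := M) (I := maximalIdeal R)
      fun Q hQ hle => maximalIdeal_notMem_associatedPrimes hx (hM 0 (by omega))
        
        ((maximalIdeal.isMaximal R).eq_of_le hQ.isPrime.ne_top hle ▸ hQ)
    obtain ⟨-, y, hy⟩ := isAssociatedPrime_iff.mp hP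
    have hPy : ∀ b, b ∈ P ↔ b • y = 0 := fun b => by
      rw [hy, Submodule.mem_colon_singleton, Submodule.mem_bot]
    have hy0 : y ≠ 0 := fun h => hPp.ne_top ((Ideal.eq_top_iff_one P).mpr ((hPy 1).mpr (by
      rw [h, smul_zero])))
    -- The submodule killed by `P` is nonzero, so U/aU ≠ 0 by Nakayama. It embeds in M/aM since `a`
    -- is regular, and this produces an associated prime of M/aM containing both `P` and `a`.
    let U : Submodule R M := Submodule.torsionBySet R M P
    have hyU : y ∈ U := (Submodule.mem_torsionBySet_iff _ _).mpr fun b => (hPy b).mp b.2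
    have : Nontrivial U := ⟨⟨y, hyU⟩, 0, fun h => hy0 (congrArg Subtype.val h)⟩
    have := nontrivial_quotSMulTop_of_mem_maximalIdeal U ham
    obtain ⟨q, hq⟩ := exists_ne (0 : QuotSMulTop a U)
    obtain ⟨u, rfl⟩ := Submodule.mkQ_surjective _ q
    have hu : (Submodule.mkQ (a • (⊤ : Submodule R M))) u.1 ≠ 0 := fun h => by
      obtain ⟨m, -, hm⟩ := (Submodule.Quotient.mk_eq_zero _).mp h
      refine hq ((Submodule.Quotient.mk_eq_zero _).mpr ⟨⟨m, ?_⟩, trivial, Subtype.ext hm⟩)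
      refine (Submodule.mem_torsionBySet_iff _ _).mpr fun b => ha ?_
      change a • b.1 • m = a • 0
      rw [smul_comm, smul_zero, ← (Submodule.mem_torsionBySet_iff _ _).mp u.2 b]
      exact congrArg (b.1 • ·) hm
    obtain ⟨Q, hQ, hle⟩ := exists_le_isAssociatedPrime_of_isNoetherianRing R _ hu
    have hPQ : P ≤ Q := fun b hb => hle (Submodule.mem_colon_singleton.mpr (by
      rw [← map_smul, (Submodule.mem_torsionBySet_iff _ _).mp u.2 ⟨b, hb⟩, map_zero]
      exact Submodule.zero_mem _))
    have haQ : a ∈ Q := hle (Submodule.mem_colon_singleton.mpr (by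
      rw [← map_smul]
      exact (Submodule.Quotient.mk_eq_zero _).mpr ⟨u.1, trivial, rfl⟩))
    have haP : a ∉ P := fun h => hy0 (ha (((hPy a).mp h).trans (smul_zero a).symm))
    have : Module.Finite R (ModuleCat.of R (QuotSMulTop a M)) :=
      inferInstanceAs (Module.Finite R (QuotSMulTop a M))
    have h1 := ih (.of R (QuotSMulTop a M)) (fun k hk =>
      CechVanish.quot ha (Submodule.mkQ_surjective _) (exact_lsmul_mkQ M a) (hM k (by omega))
        (hM (k + 1) (by omega))) Q hQ
    rw [Nat.cast_add, Nat.cast_one]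
    exact (add_le_add h1 le_rfl).trans (ringKrullDim_quotient_add_one_le
      (lt_of_le_of_ne hPQ fun h => haP (h ▸ haQ)))

/-- If `M` has depth at least `e`, then there is an `M`-regular sequence in `I` of length at least
`e - dim R/I`. -/
lemma exists_isWeaklyRegular_mem (hx : Ideal.span (Set.range x) = maximalIdeal R) {I : Ideal R}
    (hI : I ≠ ⊤) (e : ℕ) : ∀ (M : ModuleCat.{u} R) [Module.Finite R M] [Nontrivial M],
      (∀ k < e, CechVanish x M k) → ∃ rs : List R, (∀ a ∈ rs, a ∈ I) ∧ IsWeaklyRegular M rs ∧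
        (e : WithBot ℕ∞) ≤ ringKrullDim (R ⧸ I) + rs.length := by
  induction e with
  | zero =>
    intro M _ _ _
    have : Nontrivial (R ⧸ I) := Ideal.Quotient.nontrivial_iff.mpr hI
    exact ⟨[], by simp, .nil R M, add_nonneg ringKrullDim_nonneg_of_nontrivial (by simp)⟩
  | succ e ih =>
    intro M _ _ hM
    -- If an associated prime contains `I`, its quotient dimension bounds the depth and the empty
    -- sequence works. Otherwise `I` contains a regular element to divide by.
    by_cases hass : ∃ P ∈ associatedPrimes R M, I ≤ P
    · obtain ⟨P, hP, hle⟩ := hass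
      refine ⟨[], by simp, .nil R M, ?_⟩
      rw [List.length_nil, Nat.cast_zero, add_zero]
      exact (le_ringKrullDim_of_mem_associatedPrimes hx (e + 1) M hM P hP).trans
        (ringKrullDim_le_of_surjective _ (Ideal.Quotient.factor_surjective hle))
    · push Not at hass
      obtain ⟨a, haI, ha⟩ := exists_mem_isSMulRegular hass
      have ham : a ∈ maximalIdeal R := le_maximalIdeal hI haI
      have : Nontrivial (ModuleCat.of R (QuotSMulTop a M)) :=
        nontrivial_quotSMulTop_of_mem_maximalIdeal M ham
      have : Module.Finite R (ModuleCat.of R (QuotSMulTop a M)) :=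
        inferInstanceAs (Module.Finite R (QuotSMulTop a M))
      obtain ⟨rs, h1, h2, h3⟩ := ih (.of R (QuotSMulTop a M)) fun k hk =>
        CechVanish.quot ha (Submodule.mkQ_surjective _) (exact_lsmul_mkQ M a) (hM k (by omega))
          (hM (k + 1) (by omega))
      refine ⟨a :: rs, ?_, (isWeaklyRegular_cons_iff _ _ _).mpr ⟨ha, h2⟩, ?_⟩
      · intro b hb
        rcases List.mem_cons.mp hb with rfl | hb
        exacts [haI, h1 b hb]
      · rw [List.length_cons, Nat.cast_add, Nat.cast_add, ← add_assoc]
        exact add_le_add h3 le_rfl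

/-- The dimension formula for a regular local ring, as a consequence of the vanishing of its local
cohomology below the dimension. -/
lemma height_add_ringKrullDim_quotient (hx : Ideal.span (Set.range x) = maximalIdeal R) {n : ℕ}
    (hn : ringKrullDim R = n) (hv : ∀ k < n, CechVanish x (ModuleCat.of R R) k)
    {I : Ideal R} {c d : ℕ} (hc : I.height = c) (hd : ringKrullDim (R ⧸ I) = d) : c + d = n := by
  refine le_antisymm (height_add_le_ringKrullDim hc hd hn) ?_
  have hI : I ≠ ⊤ := by
    rintro rfl
    rw [ringKrullDim_eq_bot_of_subsingleton] at hd
    exact WithBot.natCast_ne_bot d hd.symm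
  have : Nontrivial (ModuleCat.of R R) := inferInstanceAs (Nontrivial R)
  have : Module.Finite R (ModuleCat.of R R) := inferInstanceAs (Module.Finite R R)
  obtain ⟨rs, h1, h2, h3⟩ := exists_isWeaklyRegular_mem hx hI n (.of R R) hv
  have h4 := length_le_height h2 h1
  rw [hc, Nat.cast_le] at h4
  rw [hd] at h3
  have h5 : n ≤ d + rs.length := by exact_mod_cast h3
  omega

end Depth

/-! ### The injective hull of the residue field -/

section Hull

open RingTheory.Sequence IsLocalRing

variable {R : Type u} [CommRing R]

/-- The ideal generated by the `t`-th powers of the members of a list. -/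
def powIdeal (rs : List R) (t : ℕ) : Ideal R := Ideal.ofList (rs.map (· ^ t))

lemma pow_mem_powIdeal {rs : List R} (t : ℕ) {a : R} (ha : a ∈ rs) : a ^ t ∈ powIdeal rs t :=
  Ideal.subset_span (List.mem_map.mpr ⟨a, ha, rfl⟩)

lemma powIdeal_le_iff {rs : List R} {t : ℕ} {J : Ideal R} :
    powIdeal rs t ≤ J ↔ ∀ a ∈ rs, a ^ t ∈ J := by
  rw [powIdeal, Ideal.ofList, Ideal.span_le]
  constructor
  · exact fun h a ha => h (List.mem_map.mpr ⟨a, ha, rfl⟩)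
  · rintro h _ hb
    obtain ⟨a, ha, rfl⟩ := List.mem_map.mp hb
    exact h a ha

lemma ofList_le_radical_powIdeal (rs : List R) (t : ℕ) :
    Ideal.ofList rs ≤ (powIdeal rs t).radical :=
  Ideal.span_le.mpr fun _ ha => ⟨t, pow_mem_powIdeal t ha⟩

lemma powIdeal_le_pow (rs : List R) (t : ℕ) : powIdeal rs t ≤ Ideal.ofList rs ^ t :=
  powIdeal_le_iff.mpr fun _ ha => Ideal.pow_mem_pow (I := Ideal.ofList rs) (Ideal.subset_span ha) t

lemma exists_pow_le_powIdeal [IsNoetherianRing R] (rs : List R) (t : ℕ) :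
    ∃ s, Ideal.ofList rs ^ s ≤ powIdeal rs t :=
  Ideal.exists_pow_le_of_le_radical_of_fg (ofList_le_radical_powIdeal rs t)
    (IsNoetherian.noetherian _)

lemma powIdeal_smul_eq_zero {rs : List R} {t : ℕ} {M : Type u} [AddCommGroup M] [Module R M]
    {m : M} (h : ∀ a ∈ rs, a ^ t • m = 0) {c : R} (hc : c ∈ powIdeal rs t) : c • m = 0 := by
  have : powIdeal rs t ≤ LinearMap.ker (LinearMap.toSpanSingleton R M m) :=
    powIdeal_le_iff.mpr h
  exact this hc

lemma exists_pow_smul_eq_zero_list {rs : List R} {M : Type u} [AddCommGroup M] [Module R M]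
    {m : M} (h : ∀ a ∈ rs, ∃ k : ℕ, a ^ k • m = 0) : ∃ t : ℕ, ∀ a ∈ rs, a ^ t • m = 0 := by
  classical
  choose! k hk using h
  exact ⟨rs.toFinset.sup k, fun a ha => pow_smul_eq_zero_of_le (hk a ha)
    (Finset.le_sup (List.mem_toFinset.mpr ha))⟩

/-- The parameters `rs` make `E` look like the injective hull of the residue field. -/
structure IsDualizing (rs : List R) (E : Type u) [AddCommGroup E] [Module R E] : Prop where
  tors : ∀ e : E, ∃ t : ℕ, ∀ a ∈ rs, a ^ t • e = 0
  cyclic : ∀ t : ℕ, ∃ e : E, (∀ c : R, c • e = 0 ↔ c ∈ powIdeal rs t) ∧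
    ∀ e' : E, (∀ a ∈ rs, a ^ t • e' = 0) → ∃ c : R, e' = c • e

lemma IsDualizing.of_equiv {rs : List R} {E E' : Type u} [AddCommGroup E] [Module R E]
    [AddCommGroup E'] [Module R E'] (f : E ≃ₗ[R] E') (h : IsDualizing rs E) :
    IsDualizing rs E' where
  tors e' := by
    obtain ⟨t, ht⟩ := h.tors (f.symm e')
    exact ⟨t, fun a ha => f.symm.injective (by rw [map_smul, ht a ha, map_zero])⟩
  cyclic t := by
    obtain ⟨e, h1, h2⟩ := h.cyclic t
    refine ⟨f e, fun c => ?_, fun e' he' => ?_⟩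
    · rw [← map_smul, map_eq_zero_iff f f.injective, h1]
    · obtain ⟨c, hc⟩ := h2 (f.symm e') fun a ha => by rw [← map_smul, he' a ha, map_zero]
      exact ⟨c, by rw [← map_smul, ← hc, f.apply_symm_apply]⟩

/-- The endomorphisms of a dualizing module over a complete ring are the multiplications. -/
lemma IsDualizing.exists_eq_smul [IsNoetherianRing R] {rs : List R}
    [IsAdicComplete (Ideal.ofList rs) R] {E : Type u} [AddCommGroup E] [Module R E]
    (h : IsDualizing rs E) (φ : E →ₗ[R] E) : ∃ c : R, ∀ e, φ e = c • e := by
  choose e h1 h2 using h.cyclic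
  have hkill : ∀ t, ∀ a ∈ rs, a ^ t • e t = 0 := fun t a ha =>
    (h1 t _).mpr (pow_mem_powIdeal t ha)
  -- The elements killed by the t-th powers form the cyclic module generated by e t, so the
  -- endomorphism acts there as a scalar c t. These scalars are compatible modulo the annihilators,
  -- and completeness supplies their limit.
  choose c hc using fun t => h2 t (φ (e t)) fun a ha => by rw [← map_smul, hkill t a ha, map_zero]
  have hφ : ∀ t e', (∀ a ∈ rs, a ^ t • e' = 0) → φ e' = c t • e' := fun t e' he' => by
    obtain ⟨b, rfl⟩ := h2 t e' he'
    rw [map_smul, hc, smul_comm]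
  have hmono : ∀ s t, s ≤ t → c s - c t ∈ powIdeal rs s := fun s t hst => by
    rw [← h1, sub_smul, ← hc, hφ t (e s) fun a ha => pow_smul_eq_zero_of_le (hkill s a ha) hst,
      sub_self]
  obtain ⟨L, hL⟩ := IsPrecomplete.prec (I := Ideal.ofList rs) inferInstance (f := c)
    fun {s t} hst => by
      rw [SModEq.sub_mem, smul_eq_mul, Ideal.mul_top]
      exact powIdeal_le_pow rs s (hmono s t hst)
  refine ⟨L, fun e' => ?_⟩
  obtain ⟨t, ht⟩ := h.tors e'
  obtain ⟨s, hs⟩ := exists_pow_le_powIdeal rs t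
  have h3 : c (max s t) - L ∈ powIdeal rs t := by
    have := hL (max s t)
    rw [SModEq.sub_mem, smul_eq_mul, Ideal.mul_top] at this
    exact hs (Ideal.pow_le_pow_right (le_max_left s t) this)
  have h4 := powIdeal_smul_eq_zero ht (add_mem (hmono t _ (le_max_right s t)) h3)
  rw [sub_add_sub_cancel, sub_smul, sub_eq_zero] at h4
  rw [hφ t e' ht, h4]

/-- The cyclic submodules have annihilators inside arbitrarily high powers of a separated ideal. -/
lemma IsDualizing.eq_zero_of_smul [IsNoetherianRing R] {rs : List R}
    [IsAdicComplete (Ideal.ofList rs) R] {E : Type u} [AddCommGroup E] [Module R E]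
    (h : IsDualizing rs E) {c : R} (hc : ∀ e : E, c • e = 0) : c = 0 := by
  refine IsHausdorff.haus (I := Ideal.ofList rs) inferInstance c fun t => ?_
  obtain ⟨e, h1, -⟩ := h.cyclic t
  rw [SModEq.zero, smul_eq_mul, Ideal.mul_top]
  exact powIdeal_le_pow rs t ((h1 c).mp (hc e))

/-- The top local cohomology of a regular local ring is dualizing. -/
lemma isDualizing_homology [IsNoetherianRing R] {p : ℕ} [Fact p.Prime] [CharP R p] {κ : Type}
    [Fintype κ] (B : FrobBasis R p κ) {r : ℕ} (x : Fin r → R) {rs : List R}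
    (hx : Ideal.span (Set.range x) = Ideal.ofList rs) (hrs : IsWeaklyRegular R rs) {n : ℕ}
    (hn : rs.length = n) :
    IsDualizing rs ((cechComplex x (ModuleCat.of R R)).homology n) where
  tors h := by
    subst hn
    obtain ⟨z, hz⟩ : ∃ z, CechClass x (ModuleCat.of R R) rs.length z h := HasClass.exists_rep h
    refine exists_pow_smul_eq_zero_list fun a ha => ?_
    obtain ⟨t, ht⟩ := exists_pow_smul_cechBdry B (ModuleCat.of R R) (x := x) (a := a)
      (hx ▸ Ideal.subset_span ha) hz.d_eq_zero
    have h1 : CechClass x (ModuleCat.of R R) rs.length (a ^ t • z) (a ^ t • h) :=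
      HasClass.smul _ hz
    exact ⟨t, HasClass.unique h1 (CechClass.zero_iff.mpr ht)⟩
  cyclic t := by
    subst hn
    -- For t = 0 the powers are 1 and need not lie in the ideal, so the embedding below is
    -- unavailable; the submodule to generate is then zero.
    by_cases h0 : t = 0 ∧ rs ≠ []
    · obtain ⟨rfl, h0⟩ := h0
      obtain ⟨a, ha⟩ := List.exists_mem_of_ne_nil rs h0
      have htop : powIdeal rs 0 = ⊤ :=
        (Ideal.eq_top_iff_one _).mpr (pow_zero a ▸ pow_mem_powIdeal 0 ha)
      refine ⟨0, fun c => ?_, fun e' he' => ⟨0, ?_⟩⟩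
      · rw [htop, smul_zero]
        exact iff_of_true rfl trivial
      · have := he' a ha
        rwa [pow_zero, one_smul, ← smul_zero (0 : R)] at this
    have key := exists_quot_to_homology x B (rs.map (· ^ t))
      (by
        intro b hb
        obtain ⟨a, ha, rfl⟩ := List.mem_map.mp hb
        have ht : t ≠ 0 := fun ht => h0 ⟨ht, List.ne_nil_of_mem ha⟩
        exact Ideal.pow_mem_of_mem _ (hx ▸ Ideal.subset_span ha) t (Nat.pos_of_ne_zero ht))
      (ModuleCat.of R R) (IsWeaklyRegular.map_pow t rs hrs)
      (by
        intro m i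
        obtain ⟨m, rfl⟩ := Submodule.mkQ_surjective _ m
        obtain ⟨k, hk⟩ : x i ∈ (powIdeal rs t).radical :=
          ofList_le_radical_powIdeal rs t (hx ▸ Ideal.subset_span ⟨i, rfl⟩)
        refine ⟨k, ?_⟩
        rw [← map_smul]
        refine (Submodule.Quotient.mk_eq_zero _).mpr ?_
        exact Submodule.smul_mem_smul hk trivial)
    rw [List.length_map] at key
    obtain ⟨f, hf, hf'⟩ := key
    have hmk : ∀ c : R, f (Submodule.Quotient.mk c) = c • f (Submodule.Quotient.mk (1 : R)) :=
      fun c => (congrArg (fun b : R => f (Submodule.Quotient.mk b)) (mul_one c).symm).trans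
        (map_smul f c (Submodule.Quotient.mk (1 : R)))
    refine ⟨f (Submodule.Quotient.mk (1 : R)), fun c => ?_, fun e' he' => ?_⟩
    · rw [← hmk, map_eq_zero_iff f hf, Submodule.Quotient.mk_eq_zero]
      have hmul : (powIdeal rs t • ⊤ : Submodule R R) = powIdeal rs t := by
        rw [smul_eq_mul, Ideal.mul_top]
      exact hmul ▸ Iff.rfl
    · obtain ⟨m, rfl⟩ := (hf' e').mpr fun b hb => by
        obtain ⟨a, ha, rfl⟩ := List.mem_map.mp hb
        exact he' a ha
      obtain ⟨c, rfl⟩ := Submodule.mkQ_surjective _ m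
      exact ⟨c, hmk c⟩

/-! #### Matlis duality for modules of finite length -/

/-- A nonzero torsion element has a nonzero multiple in the socle. -/
lemma exists_socle [IsNoetherianRing R] {I : Ideal R} {M : Type u} [AddCommGroup M] [Module R M]
    {m : M} (hm : m ≠ 0) (ht : ∀ a ∈ I, ∃ k : ℕ, a ^ k • m = 0) :
    ∃ c : R, c • m ≠ 0 ∧ ∀ a ∈ I, a • c • m = 0 := by
  obtain ⟨P, hP, -⟩ := exists_le_isAssociatedPrime_of_isNoetherianRing R
    (⟨m, Submodule.mem_span_singleton_self m⟩ : Submodule.span R {m})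
    (fun h => hm (congrArg Subtype.val h))
  obtain ⟨hp, ⟨y, hy⟩, hPy⟩ := isAssociatedPrime_iff.mp hP
  obtain ⟨c, rfl⟩ := Submodule.mem_span_singleton.mp hy
  have hPc : ∀ b, b ∈ P ↔ b • c • m = 0 := fun b => by
    rw [hPy, Submodule.mem_colon_singleton, Submodule.mem_bot, Subtype.ext_iff]
    rfl
  refine ⟨c, fun h => hp.ne_top ((Ideal.eq_top_iff_one P).mpr ((hPc 1).mpr ?_)), fun a ha => ?_⟩
  · rw [h, smul_zero]
  · obtain ⟨k, hk⟩ := ht a ha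
    refine (hPc a).mp (hp.mem_of_pow_mem k ((hPc _).mpr ?_))
    rw [smul_comm, hk, smul_zero]

lemma surjective_of_length_le {M N : Type u} [AddCommGroup M] [Module R M] [AddCommGroup N]
    [Module R N] (hM : IsFiniteLength R M) (f : M →ₗ[R] N) (hf : Function.Injective f)
    (h : Module.length R N ≤ Module.length R M) : Function.Surjective f := by
  have h1 := Module.length_eq_add_of_exact f (LinearMap.range f).mkQ hf
    (Submodule.mkQ_surjective _) (LinearMap.exact_map_mkQ_range f)
  rw [h1] at h
  have h2 : Module.length R (N ⧸ LinearMap.range f) = 0 := by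
    have h3 := Module.length_ne_top_iff.mpr hM
    exact ENat.add_right_injective_of_ne_top h3 (le_antisymm (by simpa using h) (by simp))
  have h4 := Module.length_eq_zero_iff.mp h2
  exact LinearMap.range_eq_top.mp (Submodule.Quotient.subsingleton_iff.mp h4)

variable [IsLocalRing R] {E : Type u} [AddCommGroup E] [Module R E]

/-- The `a`-power torsion is injective, hence a direct summand. It contains the image of the residue
field, so by essentiality its complement is zero. -/
lemma IsInjectiveHull.exists_pow_smul_eq_zero [IsNoetherianRing R]
    (hE : IsInjectiveHull (R := R) (ResidueField R) E) {a : R} (ha : a ∈ maximalIdeal R) (e : E) :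
    ∃ k : ℕ, a ^ k • e = 0 := by
  obtain ⟨hinj, f, hf, hess⟩ := hE
  have hT := injective_powTorsion (M := E) a
  obtain ⟨π, hπ⟩ := hT.out (powTorsion E a).subtype Subtype.val_injective LinearMap.id
  have hker : LinearMap.ker π = ⊥ := by
    refine hess _ (le_bot_iff.mp ?_)
    rintro _ ⟨h1, ⟨y, rfl⟩⟩
    have hmem : f y ∈ powTorsion E a := ⟨1, by
      obtain ⟨c, rfl⟩ := IsLocalRing.residue_surjective y
      rw [pow_one, ← map_smul, Algebra.smul_def, ResidueField.algebraMap_eq,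
        (residue_eq_zero_iff a).mpr ha, zero_mul, map_zero]⟩
    have h2 : π (f y) = ⟨f y, hmem⟩ := hπ ⟨f y, hmem⟩
    rw [LinearMap.mem_ker.mp h1] at h2
    exact (congrArg Subtype.val h2).symm
  have h3 : e - (π e : E) ∈ LinearMap.ker π := by
    have h4 : π (π e : E) = π e := hπ (π e)
    rw [LinearMap.mem_ker, map_sub, h4, sub_self]
  rw [hker, Submodule.mem_bot, sub_eq_zero] at h3
  obtain ⟨k, hk⟩ := (π e).2
  exact ⟨k, by rw [h3]; exact hk⟩

/-- Otherwise the span of `e` would be a simple module meeting the image of the residue field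
trivially, against essentiality. -/
lemma IsInjectiveHull.exists_socle_equiv (hE : IsInjectiveHull (R := R) (ResidueField R) E) :
    ∃ f : ResidueField R →ₗ[R] E, Function.Injective f ∧
      ∀ e, (∀ a ∈ maximalIdeal R, a • e = 0) → ∃ y, f y = e := by
  obtain ⟨-, f, hf, hess⟩ := hE
  refine ⟨f, hf, fun e he => ?_⟩
  by_contra hcon
  have h0 : Submodule.span R {e} = ⊥ := hess _ (le_bot_iff.mp (by
    rintro _ ⟨h1, ⟨y, rfl⟩⟩
    obtain ⟨c, hc⟩ := Submodule.mem_span_singleton.mp h1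
    by_cases hcm : c ∈ maximalIdeal R
    · rw [Submodule.mem_bot, ← hc, he c hcm]
    · obtain ⟨u, rfl⟩ := (notMem_maximalIdeal.mp hcm)
      exact absurd ⟨(↑u⁻¹ : R) • y, by rw [map_smul, ← hc, smul_smul, Units.inv_mul, one_smul]⟩
        hcon))
  refine hcon ⟨0, ?_⟩
  rw [map_zero, Submodule.span_singleton_eq_bot.mp h0]

/-- Dualizing into the injective hull of the residue field does not increase the length. -/
lemma IsInjectiveHull.length_hom_le [IsNoetherianRing R]
    (hE : IsInjectiveHull (R := R) (ResidueField R) E) {N : Type u} [AddCommGroup N] [Module R N]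
    (hN : IsFiniteLength R N) : Module.length R (N →ₗ[R] E) ≤ Module.length R N := by
  induction hN with
  | of_subsingleton =>
    rw [Module.length_eq_zero_iff.mpr inferInstance]
    exact zero_le
  | @of_simple_quotient M _ _ N _ hN ih =>
    have hinj := hE.1
    have h1 := Module.length_eq_add_of_exact N.subtype N.mkQ N.injective_subtype
      N.mkQ_surjective (LinearMap.exact_subtype_mkQ N)
    have h2 := Module.length_eq_add_of_exact (LinearMap.lcomp R E N.mkQ) (LinearMap.lcomp R E N.subtype)
      (fun φ ψ h => LinearMap.ext fun q => by
        obtain ⟨m, rfl⟩ := N.mkQ_surjective q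
        exact LinearMap.congr_fun h m)
      (fun φ => by
        obtain ⟨ψ, hψ⟩ := hinj.out N.subtype N.injective_subtype φ
        exact ⟨ψ, LinearMap.ext hψ⟩)
      (fun φ => by
        constructor
        · intro h
          have hle : N ≤ LinearMap.ker φ := fun m hm => LinearMap.congr_fun h ⟨m, hm⟩
          exact ⟨N.liftQ φ hle, N.liftQ_mkQ φ hle⟩
        · rintro ⟨ψ, rfl⟩
          ext m
          exact (congrArg ψ ((Submodule.Quotient.mk_eq_zero N).mpr m.2)).trans (map_zero ψ))
    rw [h1, h2, add_comm]
    refine add_le_add ih ?_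
    obtain ⟨P, hP, ⟨q⟩⟩ := (isSimpleModule_iff_quot_maximal (R := R) (M := M ⧸ N)).mp
      inferInstance
    obtain rfl := eq_maximalIdeal hP
    obtain ⟨f, hf, hf'⟩ := hE.exists_socle_equiv
    -- Homomorphisms from a simple module are determined by the image of a generator. This image
    -- lies in the socle of E, a copy of the residue field, so they have length at most one.
    choose g hg using fun φ : (M ⧸ N) →ₗ[R] E => hf' (φ (q.symm (Submodule.Quotient.mk 1)))
      fun a ha => by
        rw [← map_smul, ← map_smul, ← Submodule.Quotient.mk_smul, smul_eq_mul, mul_one,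
          (Submodule.Quotient.mk_eq_zero _).mpr ha, map_zero, map_zero]
    let G : ((M ⧸ N) →ₗ[R] E) →ₗ[R] ResidueField R :=
      { toFun := g
        map_add' := fun φ ψ => hf (by rw [map_add, hg, hg, hg]; rfl)
        map_smul' := fun c φ => hf (by rw [map_smul, hg, hg]; rfl) }
    rw [q.length_eq]
    refine Module.length_le_of_injective G fun φ ψ h => ?_
    have h3 := congrArg f h
    change f (g φ) = f (g ψ) at h3
    rw [hg, hg] at h3
    refine LinearMap.ext fun m => ?_
    obtain ⟨m, rfl⟩ := q.symm.surjective m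
    obtain ⟨c, rfl⟩ := Submodule.mkQ_surjective _ m
    have h4 : Submodule.mkQ (maximalIdeal R) c = c • Submodule.Quotient.mk 1 := by
      rw [← Submodule.Quotient.mk_smul, smul_eq_mul, mul_one]
      rfl
    rw [h4, map_smul, map_smul, map_smul, h3]

lemma isFiniteLength_quotient [IsNoetherianRing R] {J : Ideal R} {s : ℕ}
    (h : maximalIdeal R ^ s ≤ J) : IsFiniteLength R (R ⧸ J) := by
  have : Ring.KrullDimLE 0 (R ⧸ J) := by
    rw [Ring.krullDimLE_zero_iff]
    intro P hP
    have hc := Ideal.comap_isPrime (Ideal.Quotient.mk J) P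
    have hle : maximalIdeal R ≤ P.comap (Ideal.Quotient.mk J) := by
      refine (hc.pow_le_iff (n := s + 1) (Nat.succ_ne_zero s)).mp ?_
      refine (Ideal.pow_le_pow_right (Nat.le_succ s)).trans fun a ha => ?_
      rw [Ideal.mem_comap, Ideal.Quotient.eq_zero_iff_mem.mpr (h ha)]
      exact P.zero_mem
    have hmax : (P.comap (Ideal.Quotient.mk J)).IsMaximal :=
      (maximalIdeal.isMaximal R).eq_of_le hc.ne_top hle ▸ maximalIdeal.isMaximal R
    have h1 := Ideal.map_eq_top_or_isMaximal_of_surjective (Ideal.Quotient.mk J)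
      Ideal.Quotient.mk_surjective hmax
    rw [Ideal.map_comap_of_surjective _ Ideal.Quotient.mk_surjective] at h1
    exact h1.resolve_left hP.ne_top
  have : IsArtinianRing (R ⧸ J) :=
    isArtinianRing_iff_isNoetherianRing_krullDimLE_zero.mpr ⟨inferInstance, this⟩
  rw [← Module.length_ne_top_iff, Module.length_eq_of_surjective (R := R ⧸ J) (S := R)
    Ideal.Quotient.mk_surjective]
  exact Module.length_ne_top

/-- The injective hull of the residue field is determined by being dualizing. -/
lemma IsInjectiveHull.nonempty_equiv [IsNoetherianRing R]
    (hE : IsInjectiveHull (R := R) (ResidueField R) E) {rs : List R}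
    (hrs : Ideal.ofList rs = maximalIdeal R) {H : Type u} [AddCommGroup H] [Module R H]
    (hH : IsDualizing rs H) : Nonempty (H ≃ₗ[R] E) := by
  choose e h1 h2 using hH.cyclic
  have hpow : powIdeal rs 1 = maximalIdeal R := by
    rw [← hrs, powIdeal]
    simp
  have lift : ∀ {M : Type u} [AddCommGroup M] [Module R M] (J : Ideal R) (m : M),
      (∀ c ∈ J, c • m = 0) → ∃ f : (R ⧸ J) →ₗ[R] M, ∀ c : R, f (Submodule.Quotient.mk c) = c • m :=
    fun J m hm => ⟨J.liftQ (LinearMap.toSpanSingleton R _ m) hm, fun c => rfl⟩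
  obtain ⟨f, hf, hf'⟩ := hE.exists_socle_equiv
  obtain ⟨j, hj⟩ := lift (maximalIdeal R) (e 1) fun c hc => (h1 1 c).mpr (hpow ▸ hc)
  have hjinj : Function.Injective j := (injective_iff_map_eq_zero j).mpr fun y hy => by
    obtain ⟨c, rfl⟩ := Submodule.mkQ_surjective _ y
    refine (Submodule.Quotient.mk_eq_zero _).mpr (hpow ▸ (h1 1 c).mp ?_)
    rw [← hj]
    exact hy
  -- Extend the embedding of the residue field from the socle of H to all of H. A nonzero kernel
  -- would contain a socle element, where the map is injective.
  obtain ⟨i, hi⟩ := hE.1.out j hjinj (f : (R ⧸ maximalIdeal R) →ₗ[R] E)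
  have hiinj : Function.Injective i := (injective_iff_map_eq_zero i).mpr fun h hh => by
    by_contra hne
    obtain ⟨c, hc, hc'⟩ := exists_socle (I := maximalIdeal R) hne fun a ha => by
      obtain ⟨t, ht⟩ := hH.tors h
      obtain ⟨k, hk⟩ := ofList_le_radical_powIdeal rs t (hrs ▸ ha)
      exact ⟨k, powIdeal_smul_eq_zero ht hk⟩
    obtain ⟨b, hb⟩ := h2 1 (c • h) fun a ha => by
      rw [pow_one]
      exact hc' a (hrs ▸ Ideal.subset_span ha)
    rw [← hj] at hb
    have h3 : f (Submodule.Quotient.mk b : R ⧸ maximalIdeal R) = 0 := by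
      refine (hi _).symm.trans ?_
      rw [← hb, map_smul, hh, smul_zero]
    refine hc (hb.trans ?_)
    rw [hf (h3.trans (map_zero f).symm)]
    exact map_zero j
  refine ⟨LinearEquiv.ofBijective i ⟨hiinj, fun y => ?_⟩⟩
  obtain ⟨t, ht⟩ := exists_pow_smul_eq_zero_list (rs := rs) fun a ha =>
    hE.exists_pow_smul_eq_zero (a := a) (hrs ▸ Ideal.subset_span ha) y
  obtain ⟨s, hs⟩ := exists_pow_le_powIdeal rs t
  have hfl := isFiniteLength_quotient (hrs ▸ hs)
  -- For surjectivity, R modulo the t-th powers embeds in the part T of E killed by these powers,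
  -- through the image of e t. The length bound on Hom into E forces this embedding to be onto.
  let T : Submodule R E := Submodule.torsionBySet R E (powIdeal rs t)
  have hTm : ∀ z, z ∈ T ↔ ∀ c ∈ powIdeal rs t, c • z = 0 := fun z =>
    (Submodule.mem_torsionBySet_iff _ _).trans
      ⟨fun h c hc => h ⟨c, hc⟩, fun h c => h c.1 c.2⟩
  have hlen : Module.length R T ≤ Module.length R (R ⧸ powIdeal rs t) := by
    choose g hg using fun z : T => lift (powIdeal rs t) z.1 ((hTm z.1).mp z.2)
    let G : T →ₗ[R] ((R ⧸ powIdeal rs t) →ₗ[R] E) :=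
      { toFun := g
        map_add' := fun z z' => LinearMap.ext fun q => by
          obtain ⟨c, rfl⟩ := Submodule.mkQ_surjective _ q
          refine (hg _ c).trans ((smul_add c z.1 z'.1).trans ?_)
          rw [← hg, ← hg]
          rfl
        map_smul' := fun b z => LinearMap.ext fun q => by
          obtain ⟨c, rfl⟩ := Submodule.mkQ_surjective _ q
          refine (hg _ c).trans ((smul_comm c b z.1).trans ?_)
          rw [← hg]
          rfl }
    refine (Module.length_le_of_injective G fun z z' h => Subtype.ext ?_).trans
      (hE.length_hom_le hfl)
    have h3 : g z (Submodule.Quotient.mk 1) = g z' (Submodule.Quotient.mk 1) :=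
      LinearMap.congr_fun h _
    rwa [hg, hg, one_smul, one_smul] at h3
  obtain ⟨g, hg⟩ := lift (powIdeal rs t) (i (e t)) fun c hc => by
    rw [← map_smul, (h1 t c).mpr hc, map_zero]
  have hgT : ∀ q, g q ∈ T := fun q => by
    obtain ⟨b, rfl⟩ := Submodule.mkQ_surjective _ q
    refine (hTm _).mpr fun c hc => ?_
    rw [← map_smul]
    refine (hg (c * b)).trans ?_
    rw [mul_comm, mul_smul, ← map_smul, (h1 t c).mpr hc, map_zero, smul_zero]
  have hsurj := surjective_of_length_le hfl (g.codRestrict T hgT)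
    ((injective_iff_map_eq_zero _).mpr fun q hq => by
      obtain ⟨b, rfl⟩ := Submodule.mkQ_surjective _ q
      refine (Submodule.Quotient.mk_eq_zero _).mpr ((h1 t b).mp (hiinj ?_))
      rw [map_smul, map_zero, ← hg]
      exact congrArg Subtype.val hq) hlen
  obtain ⟨q, hq⟩ := hsurj ⟨y, (hTm y).mpr fun c hc => powIdeal_smul_eq_zero ht hc⟩
  obtain ⟨b, rfl⟩ := Submodule.mkQ_surjective _ q
  refine ⟨b • e t, ?_⟩
  rw [map_smul, ← hg]
  exact congrArg Subtype.val hq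

end Hull

/-! ### Unit modules of Čech cochains and of homomorphisms -/

section UnitModules

variable {R : Type u} [CommRing R] {p : ℕ} [Fact p.Prime] [CharP R p] {κ : Type} [Fintype κ]

lemma RFMod.ring_action (a : R) :
    (RFMod.ring R p).action (show (ModuleCat.of R R) from a) = (show R from a) ^ p :=
  (DFunLike.congr_fun (RFMod.action_ofAction (ModuleCat.of R R) (LinearMap.frobenius R R p)) a).trans
    (LinearMap.frobenius_def (R := R) (S := R) (p := p) (x := a))

lemma FrobBasis.isUnitRF_ring (B : FrobBasis R p κ) : IsUnitRF (RFMod.ring R p) := by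
  have key : ∀ m : κ → R, ∑ i, B.val i • (RFMod.ring R p).action (m i) =
      (∑ i, B.val i * m i ^ p : R) := fun m =>
    Finset.sum_congr rfl fun i _ => congrArg (fun b : R => B.val i * b) (RFMod.ring_action (m i))
  refine (B.isUnitRF_iff _).mpr ⟨fun a => ?_, fun m hm i => ?_⟩
  · obtain ⟨s, hs⟩ := B.exists_eq_sum a
    exact ⟨s, hs.trans (key s).symm⟩
  · exact B.eq_zero_of_sum ((key m).symm.trans hm) i

lemma isUnitRF_of_iso {M N : RFMod R p} (e : M ≅ N) (h : IsUnitRF M) : IsUnitRF N := by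
  have : IsIso M.str := h
  have : IsIso e.hom.f := ((Endofunctor.Algebra.forget _).mapIso e).isIso_hom
  have h1 : N.str = inv ((pull R p).map e.hom.f) ≫ M.str ≫ e.hom.f := by
    rw [IsIso.eq_inv_comp]
    exact e.hom.h
  rw [IsUnitRF, h1]
  infer_instance

variable {r : ℕ} (x : Fin r → R)

/-- The terms of the Čech complex of an `R[F]`-module, as `R[F]`-modules. -/
def cechRF (M : RFMod R p) (k : ℕ) : RFMod R p :=
  .ofAction (.of R (CechTerm x M.a k)) (cechFrob x M k)

lemma cechRF_action (M : RFMod R p) (k : ℕ) : (cechRF x M k).action = cechFrob x M k :=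
  RFMod.action_ofAction _ _

lemma FrobBasis.exists_away (B : FrobBasis R p κ) {M : RFMod R p} (hM : IsUnitRF M) {a : R}
    (z : Away M.a a) : ∃ w : κ → Away M.a a, z = ∑ i, B.val i • awayFrob M.action a (w i) := by
  obtain ⟨t, m, rfl⟩ := awayMk_surjective z
  -- Rewriting m / a^t as a^(tq) m / a^(tp), with q = p - 1, makes the denominator a p-th power that
  -- can be absorbed by Frobenius.
  obtain ⟨q, hq⟩ : ∃ q, p = q + 1 := Nat.exists_eq_add_one.mpr (Fact.out : p.Prime).pos
  obtain ⟨w, hw⟩ := ((B.isUnitRF_iff M).mp hM).1 (a ^ (t * q) • m)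
  refine ⟨fun i => awayMk t (w i), ?_⟩
  have h1 : awayMk (a := a) t m = awayMk (t * p) (a ^ (t * q) • m) := by
    rw [← awayMk_pow_smul (t * q) t m]
    congr 1
    rw [hq, mul_add, mul_one]
  rw [h1, hw, awayMk_sum]
  refine Finset.sum_congr rfl fun i _ => ?_
  rw [awayMk_smul, awayFrob_awayMk]

lemma FrobBasis.away_eq_zero (B : FrobBasis R p κ) {M : RFMod R p} (hM : IsUnitRF M) {a : R}
    {w : κ → Away M.a a} (h : ∑ i, B.val i • awayFrob M.action a (w i) = 0) (i : κ) : w i = 0 := by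
  obtain ⟨t, m, hm⟩ := exists_common_awayMk w
  have h1 : ∑ i, B.val i • awayFrob M.action a (w i) =
      awayMk (t * p) (∑ i, B.val i • M.action (m i)) := by
    rw [awayMk_sum]
    refine Finset.sum_congr rfl fun i _ => ?_
    rw [awayMk_smul, hm, awayFrob_awayMk]
  rw [h1] at h
  obtain ⟨k, hk⟩ := awayMk_eq_zero.mp h
  -- Raising the exponent to a multiple of p allows the annihilating power to move inside Frobenius.
  have hk' := pow_smul_eq_zero_of_le hk (Nat.le_mul_of_pos_right k (Fact.out : p.Prime).pos)
  rw [Finset.smul_sum] at hk'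
  have h2 := ((B.isUnitRF_iff M).mp hM).2 (fun i => a ^ k • m i) (Eq.trans
    (Finset.sum_congr rfl fun i _ => by
      rw [LinearMap.map_smulₛₗ, frobenius_def, ← pow_mul, smul_comm]) hk') i
  rw [hm]
  exact awayMk_eq_zero.mpr ⟨k, h2⟩

lemma FrobBasis.isUnitRF_cechRF (B : FrobBasis R p κ) {M : RFMod R p} (hM : IsUnitRF M) (k : ℕ) :
    IsUnitRF (cechRF x M k) := by
  refine (B.isUnitRF_iff _).mpr ?_
  rw [cechRF_action]
  have key : ∀ (w : κ → CechTerm x M.a k) s, (∑ i, B.val i • cechFrob x M k (w i)) s =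
      ∑ i, B.val i • awayFrob M.action (cechProd x s) (w i s) := fun w s =>
    Finset.sum_apply s _ _
  refine ⟨fun z => ?_, fun w h i => ?_⟩
  · choose w hw using fun s => B.exists_away hM ((show CechTerm x M.a k from z) s)
    refine ⟨fun i s => w s i, ?_⟩
    funext s
    exact (hw s).trans (key (fun i s => w s i) s).symm
  · funext s
    exact B.away_eq_zero hM ((key w s).symm.trans (congrFun h s)) i

lemma FrobBasis.exists_cech (B : FrobBasis R p κ) {M : RFMod R p} (hM : IsUnitRF M) {k : ℕ}
    (z : CechTerm x M.a k) : ∃ w : κ → CechTerm x M.a k, z = ∑ i, B.val i • cechFrob x M k (w i) := by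
  have := ((B.isUnitRF_iff _).mp (B.isUnitRF_cechRF x hM k)).1
  rw [cechRF_action] at this
  exact this z

lemma FrobBasis.cech_eq_zero (B : FrobBasis R p κ) {M : RFMod R p} (hM : IsUnitRF M) {k : ℕ}
    {w : κ → CechTerm x M.a k} (h : ∑ i, B.val i • cechFrob x M k (w i) = 0) (i : κ) : w i = 0 := by
  have := ((B.isUnitRF_iff _).mp (B.isUnitRF_cechRF x hM k)).2
  rw [cechRF_action] at this
  exact this w h i

lemma cechD_sum_cechFrob (B : FrobBasis R p κ) (M : RFMod R p) {k : ℕ}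
    (w : κ → CechTerm x M.a k) : cechD x M.a k (∑ i, B.val i • cechFrob x M k (w i)) =
      ∑ i, B.val i • cechFrob x M (k + 1) (cechD x M.a k (w i)) := by
  rw [map_sum]
  refine Finset.sum_congr rfl fun i _ => ?_
  rw [map_smul, cechFrob_cechD]

lemma exists_cechClass {x : Fin r → R} {M : RFMod R p} {k : ℕ} (h : (M.localCohomology x k).a) :
    ∃ z : CechTerm x M.a k, CechClass x M.a k z h :=
  HasClass.exists_rep h

/-- The local cohomology of a unit module is unit. -/
lemma FrobBasis.isUnitRF_localCohomology (B : FrobBasis R p κ) {M : RFMod R p} (hM : IsUnitRF M)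
    (k : ℕ) : IsUnitRF (M.localCohomology x k) := by
  refine (B.isUnitRF_iff _).mpr ⟨fun h => ?_, fun h h0 i => ?_⟩
  · obtain ⟨z, hz⟩ : ∃ z, CechClass x M.a k z h := HasClass.exists_rep h
    obtain ⟨w, rfl⟩ := B.exists_cech x hM z
    have hd := hz.d_eq_zero
    rw [cechD_sum_cechFrob] at hd
    choose h' hh' using fun i => CechClass.exists_of_d_eq_zero (x := x) (M := M.a)
      (B.cech_eq_zero x hM hd i)
    refine ⟨h', HasClass.unique hz (HasClass.sum _ fun i _ => HasClass.smul _ ?_)⟩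
    exact (hh' i).action
  · choose w hw using fun i => exists_cechClass (h i)
    have h1 : CechClass x M.a k (∑ i, B.val i • cechFrob x M k (w i)) 0 :=
      h0 ▸ HasClass.sum _ fun i _ => HasClass.smul _ (hw i).action
    refine HasClass.unique (hw i) (CechClass.zero_iff.mpr ?_)
    have h2 := CechClass.zero_iff.mp h1
    cases k with
    | zero => exact B.cech_eq_zero x hM h2 i
    | succ k =>
      obtain ⟨v, hv⟩ := h2
      obtain ⟨v, rfl⟩ := B.exists_cech x hM v
      rw [cechD_sum_cechFrob] at hv
      refine ⟨v i, sub_eq_zero.mp (B.cech_eq_zero x hM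
        (w := fun i => cechD x M.a k (v i) - w i) ?_ i)⟩
      simp only [map_sub, smul_sub, Finset.sum_sub_distrib]
      rw [hv, sub_self]

/-! #### Homomorphisms out of a unit module -/

/-- The Frobenius action `φ ↦ θ_E ∘ (R¹ ⊗ φ) ∘ θ_C⁻¹` on the homomorphisms out of a unit module. -/
def homAction {C : RFMod R p} (hC : IsUnitRF C) (E : RFMod R p) :
    (C.a →ₗ[R] E.a) →ₛₗ[frobenius R p] (C.a →ₗ[R] E.a) :=
  have : IsIso C.str := hC
  { toFun := fun φ => (inv C.str ≫ (pull R p).map (ModuleCat.ofHom φ) ≫ E.str).hom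
    map_add' := fun φ ψ => by
      rw [ModuleCat.ofHom_add, Functor.map_add, Preadditive.add_comp, Preadditive.comp_add]
      rfl
    map_smul' := fun a φ => by
      have h := pull_map_smul a (ModuleCat.ofHom φ) E.str
      have h2 : ModuleCat.ofHom (a • φ) = a • ModuleCat.ofHom φ := rfl
      rw [h2, h, Linear.comp_smul]
      rfl }

/-- This identity characterizes the action, because the elements F(c) generate the unit module `C`.
-/
lemma homAction_action {C : RFMod R p} (hC : IsUnitRF C) (E : RFMod R p) (φ : C.a →ₗ[R] E.a)
    (c : C.a) : homAction hC E φ (C.action c) = E.action (φ c) := by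
  have : IsIso C.str := hC
  have h1 : C.action c = C.str.hom (tau C.a c) := delinearize_eq C.str c
  have h2 : (C.str ≫ inv C.str ≫ (pull R p).map (ModuleCat.ofHom φ) ≫ E.str).hom (tau C.a c) =
      E.action (φ c) := by
    rw [IsIso.hom_inv_id_assoc, ← delinearize_eq, delinearize_map_comp]
    rfl
  rw [h1]
  exact h2

lemma FrobBasis.hom_ext_action (B : FrobBasis R p κ) {C : RFMod R p} (hC : IsUnitRF C)
    {N : Type u} [AddCommGroup N] [Module R N] {φ ψ : C.a →ₗ[R] N}
    (h : ∀ c, φ (C.action c) = ψ (C.action c)) : φ = ψ := by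
  refine LinearMap.ext fun c => ?_
  obtain ⟨w, rfl⟩ := ((B.isUnitRF_iff C).mp hC).1 c
  simp only [map_sum, map_smul, h]

/-- The components are c ↦ coord_i(ψ(F(c))), linear because the p⁻¹-linear coordinates cancel the
p-linear Frobenius. -/
lemma FrobBasis.exists_hom (B : FrobBasis R p κ) {C E : RFMod R p} (hC : IsUnitRF C)
    (hE : IsUnitRF E) (ψ : C.a →ₗ[R] E.a) :
    ∃ φ : κ → C.a →ₗ[R] E.a, ψ = ∑ i, B.val i • homAction hC E (φ i) := by
  obtain ⟨coord, h1, h2, h3⟩ := B.exists_coord hE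
  let φ : κ → C.a →ₗ[R] E.a := fun i =>
    { toFun := fun c => coord i (ψ (C.action c))
      map_add' := fun c c' => by rw [map_add, map_add, h2]
      map_smul' := fun a c => by
        rw [LinearMap.map_smulₛₗ, map_smul, frobenius_def, h3]
        rfl }
  refine ⟨φ, B.hom_ext_action hC fun c => ?_⟩
  rw [LinearMap.sum_apply]
  simp only [LinearMap.smul_apply, homAction_action]
  exact h1 _

lemma FrobBasis.hom_eq_zero (B : FrobBasis R p κ) {C E : RFMod R p} (hC : IsUnitRF C)
    (hE : IsUnitRF E) {φ : κ → C.a →ₗ[R] E.a}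
    (h : ∑ i, B.val i • homAction hC E (φ i) = 0) (i : κ) : φ i = 0 := by
  refine LinearMap.ext fun c => ((B.isUnitRF_iff E).mp hE).2 (fun i => φ i c) ?_ i
  have h1 := LinearMap.congr_fun h (C.action c)
  rw [LinearMap.sum_apply] at h1
  simpa only [LinearMap.smul_apply, homAction_action, LinearMap.zero_apply] using h1

end UnitModules

/-! #### Injectivity -/

section Injectivity

variable {R : Type u} [CommRing R]

/-- By adjunction, Hom(-, Hom(C, E)) is Hom(- ⊗ C, E), a composite of exact functors. -/
lemma injective_linearMap_of_flat (C E : Type u) [AddCommGroup C] [Module R C] [AddCommGroup E]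
    [Module R E] [Module.Flat R C] [hE : Module.Injective R E] : Module.Injective R (C →ₗ[R] E) where
  out X Y _ _ _ _ f hf g := by
    obtain ⟨h, hh⟩ := hE.out (f.rTensor C)
      (Module.Flat.rTensor_preserves_injective_linearMap f hf) (TensorProduct.lift g)
    refine ⟨TensorProduct.curry h, fun z => LinearMap.ext fun c => ?_⟩
    have := hh (TensorProduct.tmul R z c)
    rwa [LinearMap.rTensor_tmul, TensorProduct.lift.tmul] at this

lemma flat_cechTerm {r : ℕ} (x : Fin r → R) (k : ℕ) : Module.Flat R (CechTerm x R k) := by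
  have : ∀ a : R, Module.Flat R (Away R a) := fun a =>
    Module.Flat.of_linearEquiv (IsLocalizedModule.iso (Submonoid.powers a)
      (Algebra.linearMap R (Localization (Submonoid.powers a))))
  classical
  exact Module.Flat.of_linearEquiv (DFinsupp.linearEquivFunOnFintype (R := R)
    (M := fun s : Fin k ↪o Fin r => Away R (cechProd x s))).symm

lemma exists_factor_of_ker_le {A B E : Type u} [AddCommGroup A] [Module R A] [AddCommGroup B]
    [Module R B] [AddCommGroup E] [Module R E] [hE : Module.Injective R E] (f : A →ₗ[R] B)
    (g : A →ₗ[R] E) (h : ∀ a, f a = 0 → g a = 0) : ∃ φ : B →ₗ[R] E, ∀ a, φ (f a) = g a := by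
  have hk : LinearMap.ker f ≤ LinearMap.ker g := h
  obtain ⟨φ, hφ⟩ := hE.out ((LinearMap.ker f).liftQ f le_rfl)
    (LinearMap.ker_eq_bot.mp (Submodule.ker_liftQ_eq_bot _ _ _ le_rfl))
    ((LinearMap.ker f).liftQ g hk)
  exact ⟨φ, fun a => hφ (Submodule.Quotient.mk a)⟩

end Injectivity

/-! ### The resolution of a regular ring by duals of Čech cochains -/

section DualResolution

variable {R : Type u} [CommRing R] {p : ℕ} [Fact p.Prime] [CharP R p] {κ : Type} [Fintype κ]

/-! ### Homomorphisms from Čech cochains -/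

section CechHom

variable {r : ℕ} {x : Fin r → R} {M E : RFMod R p}

/-- The Frobenius action on the homomorphisms from Čech cochains of a unit module. -/
def cechHomAction (hM : ∀ k, IsUnitRF (cechRF x M k)) (E : RFMod R p) (k : ℕ) :
    (CechTerm x M.a k →ₗ[R] E.a) →ₛₗ[frobenius R p] (CechTerm x M.a k →ₗ[R] E.a) :=
  homAction (hM k) E

lemma cechHomAction_cechFrob (hM : ∀ k, IsUnitRF (cechRF x M k)) {k : ℕ}
    (φ : CechTerm x M.a k →ₗ[R] E.a) (c : CechTerm x M.a k) :
    cechHomAction hM E k φ (cechFrob x M k c) = E.action (φ c) := by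
  have h := homAction_action (hM k) E φ c
  rw [cechRF_action] at h
  exact h

lemma FrobBasis.cechHom_ext (B : FrobBasis R p κ) (hM : ∀ k, IsUnitRF (cechRF x M k)) {k : ℕ}
    {N : Type u} [AddCommGroup N] [Module R N] {φ ψ : CechTerm x M.a k →ₗ[R] N}
    (h : ∀ c, φ (cechFrob x M k c) = ψ (cechFrob x M k c)) : φ = ψ := by
  refine B.hom_ext_action (hM k) ?_
  rw [cechRF_action]
  exact h

lemma FrobBasis.exists_cechHom (B : FrobBasis R p κ) (hM : ∀ k, IsUnitRF (cechRF x M k))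
    (hE : IsUnitRF E) {k : ℕ} (ψ : CechTerm x M.a k →ₗ[R] E.a) :
    ∃ φ : κ → CechTerm x M.a k →ₗ[R] E.a, ψ = ∑ i, B.val i • cechHomAction hM E k (φ i) :=
  B.exists_hom (hM k) hE ψ

lemma FrobBasis.cechHom_eq_zero (B : FrobBasis R p κ) (hM : ∀ k, IsUnitRF (cechRF x M k))
    (hE : IsUnitRF E) {k : ℕ} {φ : κ → CechTerm x M.a k →ₗ[R] E.a}
    (h : ∑ i, B.val i • cechHomAction hM E k (φ i) = 0) (i : κ) : φ i = 0 :=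
  B.hom_eq_zero (hM k) hE h i

/-- Families of homomorphisms from the Čech cochains of degree `n - l`. -/
abbrev DualTerm (x : Fin r → R) (M E : RFMod R p) (n l : ℕ) : Type u :=
  ∀ m : {m : ℕ // m + l = n}, CechTerm x M.a m →ₗ[R] E.a

/-- The Frobenius action on homomorphisms from Čech cochains. -/
def dualTermAction (hM : ∀ k, IsUnitRF (cechRF x M k)) (E : RFMod R p) (n l : ℕ) :
    DualTerm x M E n l →ₛₗ[frobenius R p] DualTerm x M E n l where
  toFun φ m := cechHomAction hM E m (φ m)
  map_add' φ ψ := funext fun m => map_add (cechHomAction hM E m) (φ m) (ψ m)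
  map_smul' a φ := funext fun m => LinearMap.map_smulₛₗ (cechHomAction hM E m) a (φ m)

/-- The `R[F]`-module of homomorphisms from the Čech cochains of degree `n - l`. -/
def dualObj (hM : ∀ k, IsUnitRF (cechRF x M k)) (E : RFMod R p) (n l : ℕ) : RFMod R p :=
  .ofAction (.of R (DualTerm x M E n l)) (dualTermAction hM E n l)

lemma dualObj_action (hM : ∀ k, IsUnitRF (cechRF x M k)) (n l : ℕ) :
    (dualObj hM E n l).action = dualTermAction hM E n l :=
  RFMod.action_ofAction _ _

lemma FrobBasis.isUnitRF_dualObj (B : FrobBasis R p κ) (hM : ∀ k, IsUnitRF (cechRF x M k))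
    (hE : IsUnitRF E) (n l : ℕ) : IsUnitRF (dualObj hM E n l) := by
  refine (B.isUnitRF_iff _).mpr ?_
  rw [dualObj_action]
  have key : ∀ (φ : κ → DualTerm x M E n l) m, (∑ i, B.val i • dualTermAction hM E n l (φ i)) m =
      ∑ i, B.val i • cechHomAction hM E m (φ i m) := fun φ m => Finset.sum_apply m _ _
  refine ⟨fun ψ => ?_, fun φ h i => ?_⟩
  · choose φ hφ using fun m => B.exists_cechHom hM hE ((show DualTerm x M E n l from ψ) m)
    refine ⟨fun i m => φ m i, ?_⟩
    funext m
    exact (hφ m).trans (key (fun i m => φ m i) m).symm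
  · funext m
    exact B.cechHom_eq_zero hM hE ((key φ m).symm.trans (congrFun h m)) i

/-- The differential dual to the Čech differential. -/
def dualD (x : Fin r → R) (M E : RFMod R p) (n l : ℕ) :
    DualTerm x M E n l →ₗ[R] DualTerm x M E n (l + 1) where
  toFun φ m := φ ⟨m.1 + 1, by have := m.2; omega⟩ ∘ₗ cechD x M.a m.1
  map_add' _ _ := rfl
  map_smul' _ _ := rfl

lemma dualD_apply (n l : ℕ) (φ : DualTerm x M E n l) (m : {m : ℕ // m + (l + 1) = n})
    (c : CechTerm x M.a m.1) :
    dualD x M E n l φ m c = φ ⟨m.1 + 1, by have := m.2; omega⟩ (cechD x M.a m.1 c) := rfl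

/-- The differential dual to the Čech differential, as a morphism of `R[F]`-modules. -/
def FrobBasis.dualHom (B : FrobBasis R p κ) (hM : ∀ k, IsUnitRF (cechRF x M k)) (E : RFMod R p)
    (n l : ℕ) : dualObj hM E n l ⟶ dualObj hM E n (l + 1) :=
  RFMod.homMk (M := dualObj hM E n l) (N := dualObj hM E n (l + 1))
    (ModuleCat.ofHom (dualD x M E n l)) fun φ => by
      rw [dualObj_action, dualObj_action]
      funext m
      refine B.cechHom_ext hM fun c => ?_
      refine (dualD_apply n l _ m _).trans ?_
      rw [cechFrob_cechD]
      refine (cechHomAction_cechFrob hM _ _).trans ?_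
      exact (cechHomAction_cechFrob hM (dualD x M E n l φ m) c).symm

lemma eq_zero_of_cechBdry {n m : ℕ} {φ : DualTerm x M E n 0} (h : dualD x M E n 0 φ = 0)
    {hm : m + 0 = n} {z : CechTerm x M.a m} (hz : CechBdry x M.a m z) : φ ⟨m, hm⟩ z = 0 := by
  cases m with
  | zero => rw [show z = 0 from hz, map_zero]
  | succ m =>
    obtain ⟨w, rfl⟩ := hz
    exact LinearMap.congr_fun (congrFun h ⟨m, hm⟩) w

/-- The element with given homomorphisms in positive degrees. -/
def dualLift {n l : ℕ}
    (ψ : ∀ m : {m : ℕ // m + (l + 1) = n}, CechTerm x M.a (m.1 + 1) →ₗ[R] E.a) :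
    DualTerm x M E n l
  | ⟨0, _⟩ => 0
  | ⟨m + 1, h⟩ => ψ ⟨m, by omega⟩

end CechHom

/-- What makes the duals into `E` of the Čech cochains of `R` an injective resolution of `R`. -/
structure DualData {n : ℕ} (x : Fin n → R) (E : RFMod R p) where
  unit : ∀ k, IsUnitRF (cechRF x (RFMod.ring R p) k)
  inj : Module.Injective R E.a
  unit_E : IsUnitRF E
  vanish : ∀ k < n, CechVanish x (RFMod.ring R p).a k
  /-- The map from the top cochains to `E`. -/
  top : CechTerm x (RFMod.ring R p).a n →ₗ[R] E.a
  top_surjective : Function.Surjective top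
  top_eq_zero : ∀ z, top z = 0 ↔ CechBdry x (RFMod.ring R p).a n z
  top_frob : ∀ z, top (cechFrob x (RFMod.ring R p) n z) = E.action (top z)
  exists_smul : ∀ φ : E.a →ₗ[R] E.a, ∃ c : R, ∀ e, φ e = c • e
  eq_zero : ∀ c : R, (∀ e : E.a, c • e = 0) → c = 0

namespace DualData

variable {n : ℕ} {x : Fin n → R} {E : RFMod R p} (T : DualData x E)

/-- The map from the top cochains to `E`, with the degree as a parameter. -/
def topAt {m : ℕ} (h : m = n) : CechTerm x (RFMod.ring R p).a m →ₗ[R] E.a := by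
  subst h
  exact T.top

/-- The augmentation of the resolution. -/
def aug : R →ₗ[R] DualTerm x (RFMod.ring R p) E n 0 where
  toFun a m := a • T.topAt m.2
  map_add' a b := funext fun m => add_smul a b (T.topAt m.2)
  map_smul' a b := funext fun m => mul_smul a b (T.topAt m.2)

lemma aug_apply (a : R) (c : CechTerm x (RFMod.ring R p).a n) :
    T.aug a ⟨n, rfl⟩ c = a • T.top c := rfl

lemma dualTerm_zero_ext {φ ψ : DualTerm x (RFMod.ring R p) E n 0}
    (h : ∀ c, φ ⟨n, rfl⟩ c = ψ ⟨n, rfl⟩ c) : φ = ψ := by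
  funext ⟨m, hm⟩
  obtain rfl : m = n := hm
  exact LinearMap.ext h

lemma aug_pow (B : FrobBasis R p κ) (a : R) :
    T.aug (a ^ p) = dualTermAction T.unit E n 0 (T.aug a) := by
  refine dualTerm_zero_ext fun c => LinearMap.congr_fun (B.cechHom_ext T.unit
    (φ := T.aug (a ^ p) ⟨n, rfl⟩) (ψ := cechHomAction T.unit E n (T.aug a ⟨n, rfl⟩))
    fun c => ?_) c
  rw [cechHomAction_cechFrob, aug_apply, aug_apply, T.top_frob, LinearMap.map_smulₛₗ,
    frobenius_def]

/-- The augmentation of the resolution, as a morphism of `R[F]`-modules. -/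
def augHom (B : FrobBasis R p κ) : RFMod.ring R p ⟶ dualObj T.unit E n 0 :=
  RFMod.homMk (M := RFMod.ring R p) (N := dualObj T.unit E n 0)
    (ModuleCat.ofHom T.aug) fun a => by
      rw [dualObj_action]
      exact (congrArg T.aug (RFMod.ring_action (R := R) a)).trans (T.aug_pow B a)

/-- The injective resolution of `R` by the duals of the Čech cochains. -/
def res (B : FrobBasis R p κ) : FrobRes (RFMod.ring R p) where
  obj l := dualObj T.unit E n l
  d l := B.dualHom T.unit E n l
  ε := T.augHom B
  inj l := by
    have := T.inj
    have : ∀ k, Module.Injective R (CechTerm x R k →ₗ[R] E.a) := fun k => by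
      have := flat_cechTerm x k
      exact injective_linearMap_of_flat (CechTerm x R k) E.a
    exact inferInstanceAs (Module.Injective R
      (∀ m : {m : ℕ // m + l = n}, CechTerm x R m →ₗ[R] E.a))
  ε_injective := (injective_iff_map_eq_zero T.aug).mpr fun a ha => T.eq_zero a fun e => by
    obtain ⟨c, rfl⟩ := T.top_surjective e
    rw [← aug_apply, ha]
    rfl
  exact₀ φ := by
    change dualD x (RFMod.ring R p) E n 0 φ = 0 ↔ ∃ a, T.aug a = φ
    constructor
    · intro h
      let ψ : CechTerm x (RFMod.ring R p).a n →ₗ[R] E.a :=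
        (show DualTerm x (RFMod.ring R p) E n 0 from φ) ⟨n, rfl⟩
      have := T.inj
      -- A dual cocycle kills the coboundaries and so factors through the surjection of the top
      -- cochains onto E; the resulting endomorphism of E is multiplication by an element of the
      -- ring.
      obtain ⟨φ', hφ'⟩ := exists_factor_of_ker_le T.top ψ fun z hz => by
        exact eq_zero_of_cechBdry h ((T.top_eq_zero z).mp hz)
      obtain ⟨a, ha⟩ := T.exists_smul φ'
      refine ⟨a, dualTerm_zero_ext fun c => ?_⟩
      rw [aug_apply, ← ha, hφ']
    · rintro ⟨a, rfl⟩
      funext ⟨m, hm⟩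
      subst hm
      refine LinearMap.ext fun c => ?_
      rw [dualD_apply]
      exact (congrArg (a • ·) ((T.top_eq_zero _).mpr ⟨c, rfl⟩)).trans (smul_zero a)
  exact l φ := by
    change dualD x (RFMod.ring R p) E n (l + 1) φ = 0 ↔
      ∃ ψ, dualD x (RFMod.ring R p) E n l ψ = φ
    constructor
    · intro h
      have := T.inj
      -- Below degree n every Čech cocycle is a coboundary and is killed by the dual cocycle, which
      -- therefore factors through the Čech differential. Injectivity of E extends the factor to all
      -- cochains.
      have key : ∀ m : {m : ℕ // m + (l + 1) = n}, ∃ ψ : CechTerm x (RFMod.ring R p).a (m.1 + 1) →ₗ[R] E.a,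
          ∀ c, ψ (cechD x (RFMod.ring R p).a m.1 c) =
            (show DualTerm x (RFMod.ring R p) E n (l + 1) from φ) m c := by
        rintro ⟨m, hm⟩
        refine exists_factor_of_ker_le _ _ fun z hz => ?_
        have hb := T.vanish m (by omega) z hz
        cases m with
        | zero =>
          rw [show z = 0 from hb, map_zero]
        | succ m =>
          obtain ⟨w, rfl⟩ := hb
          exact LinearMap.congr_fun (congrFun h ⟨m, by omega⟩) w
      choose ψ hψ using key
      exact ⟨dualLift ψ, funext fun m => LinearMap.ext (hψ m)⟩
    · rintro ⟨ψ, rfl⟩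
      funext m
      refine LinearMap.ext fun c => ?_
      rw [dualD_apply, dualD_apply, cechD_cechD, map_zero]
      rfl

end DualData

end DualResolution

/-! ### Local cohomology as a direct limit -/

section Core

variable {R : Type u} [CommRing R] {p : ℕ}

/-- An element killed by the `k`-th Frobenius power of the ideal `I`. -/
def FrobKill (p : ℕ) (I : Ideal R) (k : ℕ) {M : Type u} [AddCommGroup M] [Module R M] (m : M) :
    Prop :=
  ∀ a ∈ I, a ^ p ^ k • m = 0

lemma FrobKill.isTors {I : Ideal R} {k : ℕ} {M : Type u} [AddCommGroup M] [Module R M] {m : M}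
    (h : FrobKill p I k m) : IsTors p I m := ⟨k, h⟩

lemma FrobKill.mono [Fact p.Prime] {I : Ideal R} {k l : ℕ} (hkl : k ≤ l) {M : Type u}
    [AddCommGroup M] [Module R M] {m : M} (h : FrobKill p I k m) : FrobKill p I l m := fun a ha =>
  pow_smul_eq_zero_of_le (h a ha) (Nat.pow_le_pow_right (Fact.out : p.Prime).pos hkl)

variable [Fact p.Prime] [CharP R p] {κ : Type} [Fintype κ]

/-- Since a^(p^(k+1)) F(m) = F(a^(p^k) m), uniqueness of coordinates removes one Frobenius. -/
lemma FrobBasis.frobKill_of_sum (B : FrobBasis R p κ) {N : RFMod R p} (hN : IsUnitRF N)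
    {I : Ideal R} {k : ℕ} {m : κ → N.a}
    (h : FrobKill p I (k + 1) (∑ i, B.val i • N.action (m i))) (i : κ) : FrobKill p I k (m i) := by
  intro a ha
  refine ((B.isUnitRF_iff N).mp hN).2 (fun i => a ^ p ^ k • m i) ?_ i
  refine Eq.trans (Finset.sum_congr rfl fun i _ => ?_) (Finset.smul_sum.symm.trans (h a ha))
  rw [LinearMap.map_smulₛₗ, frobenius_def, ← pow_mul, smul_comm, pow_succ]

namespace FrobRes

variable {N : RFMod R p} (Q : FrobRes N)

/-- Boundaries of elements killed by the `k`-th Frobenius power of `I`. -/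
def KillBdry (I : Ideal R) (k : ℕ) : ∀ j, (Q.obj j).a → Prop
  | 0, g => g = 0
  | j + 1, g => ∃ g', FrobKill p I k g' ∧ Q.dl j g' = g

variable {Q} {I : Ideal R} {j : ℕ}

lemma KillBdry.mono {k l : ℕ} (hkl : k ≤ l) {g : (Q.obj j).a} (h : Q.KillBdry I k j g) :
    Q.KillBdry I l j g := by
  cases j with
  | zero => exact h
  | succ j =>
    obtain ⟨g', h1, h2⟩ := h
    exact ⟨g', h1.mono hkl, h2⟩

lemma KillBdry.sub {k : ℕ} {g g' : (Q.obj j).a} (h : Q.KillBdry I k j g)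
    (h' : Q.KillBdry I k j g') : Q.KillBdry I k j (g - g') := by
  cases j with
  | zero => exact (congrArg₂ (· - ·) h h').trans (sub_zero _)
  | succ j =>
    obtain ⟨b, h1, rfl⟩ := h
    obtain ⟨b', h1', rfl⟩ := h'
    exact ⟨b - b', fun a ha => by rw [smul_sub, h1 a ha, h1' a ha, sub_zero], map_sub _ _ _⟩

lemma KillBdry.bdry {k : ℕ} {g : (Q.obj j).a} (h : Q.KillBdry I k j g) : Q.Bdry I j g := by
  cases j with
  | zero => exact h
  | succ j =>
    obtain ⟨b, h1, rfl⟩ := h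
    exact ⟨b, h1.isTors, rfl⟩

lemma Bdry.exists_killBdry {g : (Q.obj j).a} (h : Q.Bdry I j g) : ∃ k, Q.KillBdry I k j g := by
  cases j with
  | zero => exact ⟨0, h⟩
  | succ j =>
    obtain ⟨b, ⟨k, h1⟩, rfl⟩ := h
    exact ⟨k, b, h1, rfl⟩

lemma dl_action (l : ℕ) (g : (Q.obj l).a) :
    Q.dl l ((Q.obj l).action g) = (Q.obj (l + 1)).action (Q.dl l g) :=
  RFMod.hom_action (Q.d l) g

lemma dl_sum_action (B : FrobBasis R p κ) (l : ℕ) (g : κ → (Q.obj l).a) :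
    Q.dl l (∑ i, B.val i • (Q.obj l).action (g i)) =
      ∑ i, B.val i • (Q.obj (l + 1)).action (Q.dl l (g i)) := by
  rw [map_sum]
  refine Finset.sum_congr rfl fun i _ => ?_
  rw [map_smul, dl_action]

/-- Expand a primitive in the unit module one degree lower; its coordinates are primitives of the
coordinates of the boundary, killed by one Frobenius power less. -/
lemma KillBdry.of_sum (B : FrobBasis R p κ) (hQ : ∀ l, IsUnitRF (Q.obj l)) {k : ℕ}
    {g : κ → (Q.obj j).a} (h : Q.KillBdry I (k + 1) j (∑ i, B.val i • (Q.obj j).action (g i)))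
    (i : κ) : Q.KillBdry I k j (g i) := by
  cases j with
  | zero => exact ((B.isUnitRF_iff _).mp (hQ 0)).2 g h i
  | succ j =>
    obtain ⟨b, h1, h2⟩ := h
    obtain ⟨c, rfl⟩ := ((B.isUnitRF_iff _).mp (hQ j)).1 b
    refine ⟨c i, B.frobKill_of_sum (hQ j) h1 i, ?_⟩
    rw [dl_sum_action] at h2
    refine sub_eq_zero.mp (((B.isUnitRF_iff _).mp (hQ (j + 1))).2
      (fun i => Q.dl j (c i) - g i) ?_ i)
    rw [← sub_eq_zero, ← Finset.sum_sub_distrib] at h2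
    refine Eq.trans (Finset.sum_congr rfl fun i _ => ?_) h2
    rw [map_sub, smul_sub]

variable {r : ℕ} {x : Fin r → R}

lemma Rep.sum {α : Type*} (s : Finset α) {g : α → (Q.obj j).a}
    {h : α → (N.localCohomology x j).a} (H : ∀ a ∈ s, Q.Rep x j (g a) (h a)) :
    Q.Rep x j (∑ a ∈ s, g a) (∑ a ∈ s, h a) := by
  classical
  induction s using Finset.induction_on with
  | empty =>
    refine ⟨0, ?_, HasClass.zero⟩
    rw [Finset.sum_empty, map_zero, show cechUnit x (0 : (Q.obj j).a) = 0 from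
      funext fun _ => awayMk_zero _]
    exact DoubleComplex.Zigzag.zero (C := Q.cechDouble x) (Nat.zero_add j)
  | insert a s ha ih =>
    rw [Finset.sum_insert ha, Finset.sum_insert ha]
    exact (H a (Finset.mem_insert_self a s)).add
      (ih fun b hb => H b (Finset.mem_insert_of_mem hb))

lemma Rep.sub {g g' : (Q.obj j).a} {h h' : (N.localCohomology x j).a} (H : Q.Rep x j g h)
    (H' : Q.Rep x j g' h') : Q.Rep x j (g - g') (h - h') := by
  have := H.add (H'.smul (-1))
  rwa [neg_one_smul, neg_one_smul, ← sub_eq_add_neg, ← sub_eq_add_neg] at this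

lemma Rep.eq_of_bdry_sub {g g' : (Q.obj j).a} {h h' : (N.localCohomology x j).a}
    (H : Q.Rep x j g h) (H' : Q.Rep x j g' h')
    (hb : Q.Bdry (Ideal.span (Set.range x)) j (g - g')) : h = h' :=
  sub_eq_zero.mp ((H.sub H').eq_zero hb)

lemma KillBdry.zero (k : ℕ) : Q.KillBdry I k j 0 := by
  cases j with
  | zero => exact rfl
  | succ j => exact ⟨0, fun a _ => smul_zero _, map_zero _⟩

/-- If the classes of `X₀` correspond to the cohomology of the submodules of elements killed by
`I` of a resolution by unit modules, in a way compatible with Frobenius, then the limit is the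
local cohomology. -/
theorem nonempty_colim_iso [IsNoetherianRing R] (B : FrobBasis R p κ)
    {X : ℕ ⥤ ModuleCat.{u} R} {t : ∀ n, (pull R p).obj (X.obj n) ⟶ X.obj (n + 1)}
    {ht : ∀ n, (pull R p).map (X.map (homOfLE (Nat.le_add_right n 1))) ≫ t (n + 1) =
      t n ≫ X.map (homOfLE (Nat.le_add_right (n + 1) 1))} (hiso : ∀ n, IsIso (t n))
    (Q : FrobRes N) (hN : IsUnitRF N) (hQ : ∀ l, IsUnitRF (Q.obj l)) (hx : Ideal.span (Set.range x) = I)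
    (S : X.obj 0 → (Q.obj j).a → Prop)
    (hadd : ∀ w g w' g', S w g → S w' g' → S (w + w') (g + g'))
    (hsmul : ∀ (a : R) w g, S w g → S (a • w) (a • g))
    (hl : ∀ w, ∃ g, S w g)
    (hS : ∀ w g, S w g → FrobKill p I 0 g ∧ Q.dl j g = 0)
    (hr : ∀ g, FrobKill p I 0 g → Q.dl j g = 0 → ∃ w, S w g)
    (h0 : ∀ g, S 0 g → Q.KillBdry I 0 j g)
    (h0' : ∀ w g, S w g → Q.KillBdry I 0 j g → w = 0)
    (hc : ∀ w (w' : κ → X.obj 0) g (g' : κ → (Q.obj j).a),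
      (X.map (homOfLE (Nat.le_add_right 0 1))).hom w =
        ∑ i, B.val i • delinearize (t 0) (w' i) → S w g → (∀ i, S (w' i) (g' i)) →
      Q.KillBdry I 1 j (g - ∑ i, B.val i • (Q.obj j).action (g' i))) :
    Nonempty (RFMod.colim X t ht ≅ N.localCohomology x j) := by
  subst hx
  have hcl : ∀ w g, S w g → ∃ h, Q.Rep x j g h := fun w g h =>
    Rep.exists_class (hS w g h).1.isTors (hS w g h).2
  obtain ⟨f, -, hf⟩ := exists_linearMap_of_rel
    (fun (w : X.obj 0) (h : (N.localCohomology x j).a) => ∃ g, S w g ∧ Q.Rep x j g h)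
    (by
      rintro m n m' n' ⟨g, h1, h2⟩ ⟨g', h1', h2'⟩
      exact ⟨g + g', hadd _ _ _ _ h1 h1', h2.add h2'⟩)
    (by
      rintro a m n ⟨g, h1, h2⟩
      exact ⟨a • g, hsmul a _ _ h1, h2.smul a⟩)
    (fun w => by
      obtain ⟨g, hg⟩ := hl w
      obtain ⟨h, hh⟩ := hcl w g hg
      exact ⟨h, g, hg, hh⟩)
    (by
      rintro n ⟨g, h1, h2⟩
      exact h2.eq_zero (h0 g h1).bdry)
  have hRep : ∀ w g, S w g → Q.Rep x j g (f w) := fun w g h => by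
    obtain ⟨h', hh⟩ := hcl w g h
    rw [hf w h' ⟨g, h, hh⟩]
    exact hh
  -- Both filtrations count the Frobenius power of I needed: for a class at the initial stage, to
  -- kill a primitive of its cocycle; for a local cohomology class, to kill a representing cocycle.
  refine B.nonempty_colim_iso hiso (B.isUnitRF_localCohomology x hN j) (ModuleCat.ofHom f)
    ?_ (fun k w => ∃ g, S w g ∧ Q.KillBdry (Ideal.span (Set.range x)) k j g) ?_ ?_ ?_
    (fun k h => ∃ g, FrobKill p (Ideal.span (Set.range x)) k g ∧ Q.dl j g = 0 ∧ Q.Rep x j g h)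
    ?_ ?_ ?_
  · intro w w' hw
    obtain ⟨g, hg⟩ := hl w
    choose g' hg' using fun i => hl (w' i)
    exact (hRep w g hg).eq_of_bdry_sub
      (Rep.sum _ fun i _ => (hRep (w' i) (g' i) (hg' i)).action.smul _)
      (hc w w' g g' hw hg hg').bdry
  · rintro w ⟨g, h1, h2⟩
    exact h0' w g h1 h2
  · rintro k w ⟨g, h1, h2⟩ w' hw
    choose g' hg' using fun i => hl (w' i)
    have h3 := h2.sub ((hc w w' g g' hw h1 hg').mono (Nat.le_add_left 1 k))
    rw [sub_sub_cancel] at h3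
    exact fun i => ⟨g' i, hg' i, KillBdry.of_sum B hQ h3 i⟩
  · intro w hw
    obtain ⟨g, hg⟩ := hl w
    have h1 := hRep w g hg
    rw [show f w = 0 from hw] at h1
    obtain ⟨k, hk⟩ := h1.bdry.exists_killBdry
    exact ⟨k, g, hg, hk⟩
  · rintro h ⟨g, h1, h2, h3⟩
    obtain ⟨w, hw⟩ := hr g h1 h2
    exact ⟨w, hf w h ⟨g, hw, h3⟩⟩
  · rintro k h ⟨g, h1, h2, h3⟩
    obtain ⟨g', rfl⟩ := ((B.isUnitRF_iff _).mp (hQ j)).1 g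
    rw [dl_sum_action] at h2
    have h4 := ((B.isUnitRF_iff _).mp (hQ (j + 1))).2 _ h2
    have h5 := B.frobKill_of_sum (hQ j) h1
    choose h' hh' using fun i => Rep.exists_class (x := x) (h5 i).isTors (h4 i)
    refine ⟨h', h3.eq_of_bdry_sub (Rep.sum _ fun i _ => (hh' i).action.smul _) ?_,
      fun i => ⟨g' i, h5 i, h4 i, hh' i⟩⟩
    rw [sub_self]
    exact (KillBdry.zero (Q := Q) 0).bdry
  · intro h
    obtain ⟨g, ⟨k, h1⟩, h2, h3⟩ := Rep.exists_cocycle (Q := Q) h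
    exact ⟨k, g, h1, h2, h3⟩

end FrobRes

end Core

/-! ### Čech cochains of a quotient ring -/

section CechQuot

variable {R : Type u} [CommRing R] {p : ℕ} [Fact p.Prime] [CharP R p] {κ : Type} [Fintype κ]

variable (p) in
/-- The projection `R → R/I`. -/
def quotMap (I : Ideal R) : (RFMod.ring R p).a →ₗ[R] (RFMod.quot p I).a :=
  (Submodule.mkQ I : R →ₗ[R] R ⧸ I)

lemma quotMap_surjective (I : Ideal R) : Function.Surjective (quotMap p I) :=
  Submodule.mkQ_surjective I

lemma quotMap_eq_zero {I : Ideal R} {a : R} : quotMap p I a = 0 ↔ a ∈ I :=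
  Submodule.Quotient.mk_eq_zero I

lemma quot_smul_eq_zero {I : Ideal R} {a : R} (ha : a ∈ I) (m : (RFMod.quot p I).a) :
    a • m = 0 := by
  obtain ⟨b, rfl⟩ := Submodule.mkQ_surjective I m
  exact (map_smul I.mkQ a b).symm.trans (quotMap_eq_zero (p := p).mpr (I.mul_mem_right b ha))

variable (R p) in
/-- The element `1` of `R`. -/
def ringOne : (RFMod.ring R p).a := (1 : R)

lemma exists_eq_smul_ringOne {I : Ideal R} {m : (RFMod.ring R p).a} (h : quotMap p I m = 0) :
    ∃ b ∈ I, m = b • ringOne R p :=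
  ⟨m, quotMap_eq_zero.mp h, (mul_one (show R from m)).symm⟩

lemma quotMap_action (I : Ideal R) (a : (RFMod.ring R p).a) :
    quotMap p I ((RFMod.ring R p).action a) = (RFMod.quot p I).action (quotMap p I a) :=
  (congrArg (quotMap p I) (RFMod.ring_action (R := R) a)).trans
    (DFunLike.congr_fun (RFMod.action_ofAction (ModuleCat.of R (R ⧸ I)) _) (quotMap p I a)).symm

variable (p) in
/-- The projection `R → R/I` as a morphism of `R[F]`-modules. -/
def quotHom (I : Ideal R) : RFMod.ring R p ⟶ RFMod.quot p I :=
  RFMod.homMk (ModuleCat.ofHom (quotMap p I)) (quotMap_action I)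

variable {r : ℕ} (x : Fin r → R)

variable (p) in
/-- The projection from the Čech cochains of `R` to those of `R/I`. -/
def cechQuot (I : Ideal R) (k : ℕ) :
    CechTerm x (RFMod.ring R p).a k →ₗ[R] CechTerm x (RFMod.quot p I).a k :=
  cechMap x (quotMap p I) k

lemma cechQuot_surjective (I : Ideal R) (k : ℕ) : Function.Surjective (cechQuot p x I k) :=
  cechMap_surjective x _ (quotMap_surjective I) k

lemma cechQuot_cechD (I : Ideal R) {k : ℕ} (c : CechTerm x (RFMod.ring R p).a k) :
    cechQuot p x I (k + 1) (cechD x (RFMod.ring R p).a k c) =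
      cechD x (RFMod.quot p I).a k (cechQuot p x I k c) :=
  cechMap_cechD x _ k c

lemma cechQuot_cechFrob (I : Ideal R) {k : ℕ} (c : CechTerm x (RFMod.ring R p).a k) :
    cechQuot p x I k (cechFrob x (RFMod.ring R p) k c) =
      cechFrob x (RFMod.quot p I) k (cechQuot p x I k c) :=
  cechMap_cechFrob x (quotHom p I) k c

lemma cechTerm_quot_smul_eq_zero {I : Ideal R} {a : R} (ha : a ∈ I) {k : ℕ}
    (z : CechTerm x (RFMod.quot p I).a k) : a • z = 0 := by
  rw [← cechMap_lsmul, show LinearMap.lsmul R (RFMod.quot p I).a a = 0 from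
    LinearMap.ext fun m => quot_smul_eq_zero ha m, cechMap_zero]

variable {x}

/-- The kernel of the reduction of cochains modulo `I` is spanned by multiples with coefficients in
`I`. -/
lemma eq_zero_of_cechQuot {I : Ideal R} {k : ℕ} {c : CechTerm x (RFMod.ring R p).a k}
    (hc : cechQuot p x I k c = 0) {E : Type u} [AddCommGroup E] [Module R E]
    {g : CechTerm x (RFMod.ring R p).a k →ₗ[R] E} (hg : ∀ a ∈ I, a • g = 0) : g c = 0 := by
  classical
  have h1 : ∀ s, ∃ (b : R) (z : Away (RFMod.ring R p).a (cechProd x s)), b ∈ I ∧ c s = b • z := by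
    intro s
    obtain ⟨t, m, hm⟩ := awayMk_surjective (c s)
    have h2 : awayFun (quotMap p I) (cechProd x s) (c s) = 0 := congrFun hc s
    rw [hm, awayFun_awayMk, awayMk_eq_zero] at h2
    obtain ⟨l, hl⟩ := h2
    rw [← map_smul] at hl
    obtain ⟨b, hb, hb'⟩ := exists_eq_smul_ringOne hl
    refine ⟨b, awayMk (l + t) (ringOne R p), hb, ?_⟩
    rw [hm, ← awayMk_pow_smul l, hb', awayMk_smul]
  choose b z hb hz using h1
  have h3 : c = ∑ s, b s • (Pi.single s (z s) : CechTerm x (RFMod.ring R p).a k) := by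
    refine (Finset.univ_sum_single c).symm.trans (Finset.sum_congr rfl fun s _ => ?_)
    rw [hz s, Pi.single_smul]
  rw [h3, map_sum]
  refine Finset.sum_eq_zero fun s _ => ?_
  rw [map_smul, ← LinearMap.smul_apply, hg _ (hb s), LinearMap.zero_apply]

/-- The coordinates of an element of the Frobenius power of `I` lie in `I`. -/
lemma FrobBasis.exists_of_mem_map (B : FrobBasis R p κ) {I : Ideal R} {a : R}
    (ha : a ∈ I.map (frobenius R p)) : ∃ s : κ → R, (∀ i, s i ∈ I) ∧ a = ∑ i, B.val i * s i ^ p := by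
  have hp : p ≠ 0 := (Fact.out : p.Prime).ne_zero
  induction ha using Submodule.span_induction with
  | mem a ha =>
    obtain ⟨b, hb, rfl⟩ := ha
    obtain ⟨s, hs⟩ := B.exists_eq_sum 1
    refine ⟨fun i => s i * b, fun i => I.mul_mem_left _ hb, ?_⟩
    rw [← one_mul (frobenius R p b), hs, Finset.sum_mul]
    exact Finset.sum_congr rfl fun i _ => by rw [mul_pow, mul_assoc, frobenius_def]
  | zero =>
    refine ⟨0, fun _ => I.zero_mem, (Finset.sum_eq_zero fun i _ => ?_).symm⟩
    rw [Pi.zero_apply, zero_pow hp, mul_zero]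
  | add a b _ _ iha ihb =>
    obtain ⟨s, h1, rfl⟩ := iha
    obtain ⟨s', h1', rfl⟩ := ihb
    refine ⟨s + s', fun i => I.add_mem (h1 i) (h1' i), ?_⟩
    rw [← Finset.sum_add_distrib]
    exact Finset.sum_congr rfl fun i _ => by rw [Pi.add_apply, add_pow_char, mul_add]
  | smul c a _ iha =>
    obtain ⟨s, h1, rfl⟩ := iha
    -- Multiplication by c permutes nothing in the basis, so each product c b_i is expanded anew.
    choose s' hs' using fun i => B.exists_eq_sum (c * B.val i)
    refine ⟨fun l => ∑ i, s' i l * s i,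
      fun l => I.sum_mem fun i _ => I.mul_mem_left _ (h1 i), ?_⟩
    rw [smul_eq_mul, Finset.mul_sum]
    simp only [sum_pow_char, Finset.mul_sum]
    rw [Finset.sum_comm]
    refine Finset.sum_congr rfl fun i _ => ?_
    rw [← mul_assoc, hs' i, Finset.sum_mul]
    exact Finset.sum_congr rfl fun l _ => by rw [mul_pow, mul_assoc]

lemma FrobBasis.mem_of_sum_mem_map (B : FrobBasis R p κ) {I : Ideal R} {m : κ → R}
    (h : ∑ i, B.val i * m i ^ p ∈ I.map (frobenius R p)) (i : κ) : m i ∈ I := by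
  obtain ⟨s, h1, h2⟩ := B.exists_of_mem_map h
  have h3 : m i - s i = 0 := B.eq_zero_of_sum (s := fun i => m i - s i) (by
    rw [← sub_eq_zero, ← Finset.sum_sub_distrib] at h2
    refine Eq.trans (Finset.sum_congr rfl fun i _ => ?_) h2
    rw [sub_pow_char, mul_sub]) i
  rw [sub_eq_zero.mp h3]
  exact h1 i

/-- The preceding coordinate criterion after localization: clear denominators, with an exponent
divisible by p. -/
lemma FrobBasis.cechQuot_eq_zero (B : FrobBasis R p κ) {I : Ideal R} {k : ℕ}
    {w : κ → CechTerm x (RFMod.ring R p).a k}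
    (h : cechQuot p x (I.map (frobenius R p)) k
      (∑ i, B.val i • cechFrob x (RFMod.ring R p) k (w i)) = 0) (i : κ) :
    cechQuot p x I k (w i) = 0 := by
  funext s
  obtain ⟨t, m, hm⟩ := exists_common_awayMk (fun i => w i s)
  have h0 : (∑ i, B.val i • cechFrob x (RFMod.ring R p) k (w i)) s =
      awayMk (t * p) (∑ i, B.val i • (RFMod.ring R p).action (m i)) := by
    rw [awayMk_sum]
    refine (Finset.sum_apply s _ _).trans (Finset.sum_congr rfl fun i _ => ?_)
    rw [awayMk_smul]
    refine congrArg (B.val i • ·) ((congrArg (awayFrob (RFMod.ring R p).action _) (hm i)).trans ?_)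
    exact awayFrob_awayMk _ t (m i)
  have h1 := (congrArg (awayFun (quotMap p (I.map (frobenius R p))) (cechProd x s)) h0).symm.trans
    (congrFun h s)
  rw [awayFun_awayMk] at h1
  obtain ⟨l, hl⟩ := awayMk_eq_zero.mp h1
  have hl' := pow_smul_eq_zero_of_le hl (Nat.le_mul_of_pos_right l (Fact.out : p.Prime).pos)
  rw [← map_smul] at hl'
  have h2 : cechProd x s ^ (l * p) • ∑ i, B.val i • (RFMod.ring R p).action (m i) =
      ∑ i, B.val i * (cechProd x s ^ l * (show R from m i)) ^ p := by
    rw [Finset.smul_sum]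
    refine Finset.sum_congr rfl fun i _ => ?_
    refine (congrArg (fun b : R => cechProd x s ^ (l * p) * (B.val i * b))
      (RFMod.ring_action (R := R) (m i))).trans ?_
    rw [mul_pow, ← pow_mul]
    ring
  have h3 := B.mem_of_sum_mem_map (quotMap_eq_zero.mp ((congrArg _ h2.symm).trans hl')) i
  refine (congrArg (awayFun (quotMap p I) (cechProd x s)) (hm i)).trans ?_
  rw [awayFun_awayMk]
  refine awayMk_eq_zero.mpr ⟨l, ?_⟩
  rw [← map_smul]
  exact quotMap_eq_zero.mpr h3

end CechQuot

/-! ### The extended Matlis dual of local cohomology -/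

section DualLocalCohomology

variable {R : Type u} [CommRing R] {p : ℕ} [Fact p.Prime] [CharP R p] {κ : Type} [Fintype κ]

lemma dualTerm_ext {r : ℕ} {x : Fin r → R} {M E : RFMod R p} {n i j : ℕ} (hij : i + j = n)
    {φ ψ : DualTerm x M E n j} (h : ∀ c, φ ⟨i, hij⟩ c = ψ ⟨i, hij⟩ c) : φ = ψ := by
  funext ⟨m, hm⟩
  obtain rfl : m = i := by omega
  exact LinearMap.ext h

lemma exists_cechClass_linearMap {r : ℕ} (x : Fin r → R) (M : RFMod R p) (k : ℕ) :
    ∃ q : LinearMap.ker (cechD x M.a k) →ₗ[R] (M.localCohomology x k).a,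
      ∀ z h, CechClass x M.a k z.1 h → q z = h := by
  obtain ⟨q, -, hq⟩ := exists_linearMap_of_rel (fun (z : LinearMap.ker (cechD x M.a k))
    (h : (M.localCohomology x k).a) => CechClass x M.a k z.1 h)
    (fun _ _ _ _ h h' => HasClass.add h h') (fun a _ _ h => HasClass.smul a h)
    (fun z => CechClass.exists_of_d_eq_zero z.2) (fun _ h => HasClass.unique h HasClass.zero)
  exact ⟨q, hq⟩

namespace DualData

variable {n : ℕ} {x : Fin n → R} {E : RFMod R p} (T : DualData x E) (B : FrobBasis R p κ)
  {I : Ideal R} {i j : ℕ}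

/-- The hypothesis lets `G` factor through the Čech differential followed by reduction modulo `K`.
Injectivity of E extends the factor to the cochains of R/K, and a primitive obtained this way is
killed by `K`. For j = 0 the target cochains vanish, so `G` itself is zero. -/
lemma killBdry (hij : i + j = n) {k : ℕ} {K : Ideal R} (hK : ∀ a ∈ I, a ^ p ^ k ∈ K)
    (G : DualTerm x (RFMod.ring R p) E n j)
    (hG : ∀ c, cechQuot p x K (i + 1) (cechD x (RFMod.ring R p).a i c) = 0 → G ⟨i, hij⟩ c = 0) :
    (T.res B).KillBdry I k j G := by
  cases j with
  | zero =>
    refine dualTerm_ext hij fun c => hG c ?_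
    rw [cechTerm_eq_zero_of_lt x (by omega) (cechD x (RFMod.ring R p).a i c), map_zero]
  | succ j =>
    have := T.inj
    have key : ∀ m : {m : ℕ // m + (j + 1) = n},
        ∃ ψ : CechTerm x (RFMod.ring R p).a (m.1 + 1) →ₗ[R] E.a, (∀ a ∈ K, a • ψ = 0) ∧
          ∀ c, ψ (cechD x (RFMod.ring R p).a m.1 c) = G m c := by
      rintro ⟨m, hm⟩
      obtain rfl : m = i := by omega
      obtain ⟨ψ, hψ⟩ := exists_factor_of_ker_le
        (cechQuot p x K (m + 1) ∘ₗ cechD x (RFMod.ring R p).a m) (G ⟨m, hm⟩) hG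
      refine ⟨ψ ∘ₗ cechQuot p x K (m + 1), fun a ha => LinearMap.ext fun c => ?_, hψ⟩
      rw [LinearMap.smul_apply, LinearMap.comp_apply, ← map_smul,
        cechTerm_quot_smul_eq_zero x ha, map_zero, LinearMap.zero_apply]
    choose ψ hψ hψ' using key
    refine ⟨dualLift ψ, fun a ha => ?_, funext fun m => LinearMap.ext (hψ' m)⟩
    funext ⟨m, hm⟩
    obtain rfl : m = i + 1 := by omega
    exact hψ ⟨i, hij⟩ _ (hK a ha)

/-- The homomorphism `φ` from local cohomology is induced by `g`. -/
def Induces (I : Ideal R) (hij : i + j = n)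
    (φ : (homInto E.a).obj (op ((RFMod.quot p I).localCohomology x i).a))
    (g : DualTerm x (RFMod.ring R p) E n j) : Prop :=
  (∀ a ∈ I, a • g = 0) ∧ dualD x (RFMod.ring R p) E n j g = 0 ∧
    ∀ c h, CechClass x (RFMod.quot p I).a i (cechQuot p x I i c) h →
      g ⟨i, hij⟩ c = homEval h φ

variable {hij : i + j = n}
  {φ : (homInto E.a).obj (op ((RFMod.quot p I).localCohomology x i).a)}
  {g : DualTerm x (RFMod.ring R p) E n j}

/-- Being killed by `I` gives independence of the lift to cochains of `R`, and being a dual cocycle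
gives vanishing on coboundaries. -/
lemma Induces.apply_eq_zero (hg : ∀ a ∈ I, a • g = 0)
    (hd : dualD x (RFMod.ring R p) E n j g = 0) (hij : i + j = n)
    {c : CechTerm x (RFMod.ring R p).a i}
    (hc : CechBdry x (RFMod.quot p I).a i (cechQuot p x I i c)) : g ⟨i, hij⟩ c = 0 := by
  have hg' : ∀ a ∈ I, a • g ⟨i, hij⟩ = 0 := fun a ha => congrFun (hg a ha) ⟨i, hij⟩
  cases i with
  | zero => exact eq_zero_of_cechQuot hc hg'
  | succ i =>
    obtain ⟨z, hz⟩ := hc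
    obtain ⟨b, rfl⟩ := cechQuot_surjective x I i z
    rw [← cechQuot_cechD] at hz
    have h1 : g ⟨i + 1, hij⟩ (c - cechD x (RFMod.ring R p).a i b) = 0 :=
      eq_zero_of_cechQuot (by rw [map_sub, hz, sub_self]) hg'
    rw [map_sub, sub_eq_zero] at h1
    exact h1.trans (LinearMap.congr_fun (congrFun hd ⟨i, by omega⟩) b)

/-- A functional on cohomology is one on cocycles, which injectivity of E extends to all cochains.
With the next three lemmas, this identifies the dual of H^i_m(R/I) with H^j(Hom(R/I, Q)). -/
lemma Induces.exists_right (T : DualData x E) (hij : i + j = n)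
    (φ : (homInto E.a).obj (op ((RFMod.quot p I).localCohomology x i).a)) :
    ∃ g, Induces I hij φ g := by
  obtain ⟨q, hq⟩ := exists_cechClass_linearMap x (RFMod.quot p I) i
  obtain ⟨ψ, hψ⟩ := T.inj.out (LinearMap.ker (cechD x (RFMod.quot p I).a i)).subtype
    (Submodule.subtype_injective _)
    ((show ((RFMod.quot p I).localCohomology x i).a ⟶ E.a from φ).hom ∘ₗ q)
  have hψ' : ∀ z h, CechClass x (RFMod.quot p I).a i z h → ψ z = homEval h φ := fun z h hz => by
    refine (hψ ⟨z, hz.d_eq_zero⟩).trans ?_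
    exact congrArg (show ((RFMod.quot p I).localCohomology x i).a ⟶ E.a from φ).hom
      (hq ⟨z, hz.d_eq_zero⟩ h hz)
  -- The only possible degree m is i; the case distinction merely transports along this equality.
  let G : DualTerm x (RFMod.ring R p) E n j := fun m =>
    if hm : m.1 = i then hm ▸ (ψ ∘ₗ cechQuot p x I i) else 0
  have hG : ∀ c, G ⟨i, hij⟩ c = ψ (cechQuot p x I i c) := fun c => by
    simp only [G, dif_pos]
    rfl
  refine ⟨G, fun a ha => dualTerm_ext hij fun c => ?_, ?_, fun c h hc => ?_⟩
  · change a • G ⟨i, hij⟩ c = 0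
    rw [hG, ← map_smul, cechTerm_quot_smul_eq_zero x ha, map_zero]
  · funext ⟨m, hm⟩
    obtain rfl : i = m + 1 := by omega
    refine LinearMap.ext fun c => ?_
    rw [dualD_apply]
    refine (hG _).trans ?_
    rw [cechQuot_cechD]
    exact (hψ' _ 0 (CechClass.zero_iff.mpr ⟨_, rfl⟩)).trans
      (map_zero (ModuleCat.Hom.hom (show _ ⟶ E.a from φ)))
  · rw [hG]
    exact hψ' _ h hc

lemma Induces.exists_left (hij : i + j = n) (hg : ∀ a ∈ I, a • g = 0)
    (hd : dualD x (RFMod.ring R p) E n j g = 0) : ∃ φ, Induces I hij φ g := by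
  obtain ⟨f, -, hf⟩ := exists_linearMap_of_rel
    (fun (h : ((RFMod.quot p I).localCohomology x i).a) (e : E.a) =>
      ∃ c, CechClass x (RFMod.quot p I).a i (cechQuot p x I i c) h ∧ g ⟨i, hij⟩ c = e)
    (by
      rintro _ _ _ _ ⟨c, h1, rfl⟩ ⟨c', h1', rfl⟩
      exact ⟨c + c', by rw [map_add]; exact HasClass.add h1 h1', map_add _ _ _⟩)
    (by
      rintro a _ _ ⟨c, h1, rfl⟩
      exact ⟨a • c, by rw [map_smul]; exact HasClass.smul a h1, map_smul _ _ _⟩)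
    (fun h => by
      obtain ⟨z, hz⟩ := exists_cechClass h
      obtain ⟨c, rfl⟩ := cechQuot_surjective x I i z
      exact ⟨_, c, hz, rfl⟩)
    (by
      rintro _ ⟨c, h1, rfl⟩
      exact Induces.apply_eq_zero hg hd hij (CechClass.zero_iff.mp h1))
  exact ⟨ModuleCat.ofHom f, hg, hd, fun c h hc => (hf h _ ⟨c, hc, rfl⟩).symm⟩

lemma Induces.eq_zero (H : Induces I hij φ g) (hb : (T.res B).KillBdry I 0 j g) : φ = 0 := by
  refine homEval_ext fun h => ?_
  obtain ⟨z, hz⟩ := exists_cechClass h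
  obtain ⟨c, rfl⟩ := cechQuot_surjective x I i z
  refine (H.2.2 c h hz).symm.trans (Eq.trans ?_ (show (0 : E.a) = _ from rfl))
  cases j with
  | zero => exact congrArg (fun g : DualTerm x (RFMod.ring R p) E n 0 => g ⟨i, hij⟩ c) hb
  | succ j =>
    obtain ⟨b, hb, rfl⟩ := hb
    have hz' := hz.d_eq_zero
    rw [← cechQuot_cechD] at hz'
    exact eq_zero_of_cechQuot (g := (show DualTerm x (RFMod.ring R p) E n j from b) ⟨i + 1, by omega⟩)
      hz' fun a ha => by
        have := hb a ha
        rw [pow_zero, pow_one] at this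
        exact congrFun this ⟨i + 1, by omega⟩

lemma Induces.killBdry_zero (H : Induces I hij 0 g) : (T.res B).KillBdry I 0 j g := by
  refine T.killBdry B hij (K := I) (fun a ha => by rwa [pow_zero, pow_one]) g fun c hc => ?_
  rw [cechQuot_cechD] at hc
  obtain ⟨h, hh⟩ := CechClass.exists_of_d_eq_zero hc
  exact H.2.2 c h hh

lemma sum_action_apply (g : κ → DualTerm x (RFMod.ring R p) E n j) (m) (c) :
    (∑ l, B.val l • dualTermAction T.unit E n j (g l)) m (cechFrob x (RFMod.ring R p) m c) =
      ∑ l, B.val l • E.action (g l m c) := by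
  rw [show (∑ l, B.val l • dualTermAction T.unit E n j (g l)) m =
    ∑ l, B.val l • cechHomAction T.unit E m (g l m) from Finset.sum_apply m _ _,
    LinearMap.sum_apply]
  exact Finset.sum_congr rfl fun l _ =>
    congrArg (B.val l • ·) (cechHomAction_cechFrob T.unit (g l m) c)

/-- It suffices to test on cochains c whose coboundary vanishes modulo the Frobenius power of `I`.
Writing c = Σ b_l F(w_l), each w_l is a cocycle modulo `I`, and there the hypothesis on classes
applies. -/
lemma Induces.frob (H : Induces I hij φ g)
    {φ' : κ → (homInto E.a).obj (op ((RFMod.quot p I).localCohomology x i).a)}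
    {g' : κ → DualTerm x (RFMod.ring R p) E n j} (H' : ∀ l, Induces I hij (φ' l) (g' l))
    (h : ∀ m, homEval (((RFMod.quot p I).localCohomology x i).action m) φ =
      ∑ l, B.val l • E.action (homEval m (φ' l))) :
    (T.res B).KillBdry I 1 j (g - ∑ l, B.val l • dualTermAction T.unit E n j (g' l)) := by
  refine T.killBdry B hij (K := I.map (frobenius R p))
    (fun a ha => by rw [pow_one]; exact Ideal.mem_map_of_mem (frobenius R p) ha) _ fun c hc => ?_
  obtain ⟨w, rfl⟩ := B.exists_cech x B.isUnitRF_ring c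
  rw [cechD_sum_cechFrob] at hc
  have hw := B.cechQuot_eq_zero hc
  rw [map_sum]
  refine Finset.sum_eq_zero fun l _ => ?_
  rw [map_smul]
  refine (congrArg (B.val l • ·) ?_).trans (smul_zero (B.val l))
  have hw' := hw l
  rw [cechQuot_cechD] at hw'
  obtain ⟨m, hm⟩ := CechClass.exists_of_d_eq_zero hw'
  have hm' := hm.action
  rw [← cechQuot_cechFrob] at hm'
  refine sub_eq_zero.mpr ((H.2.2 _ _ hm').trans ((h m).trans ?_))
  refine Eq.trans ?_ (T.sum_action_apply B g' ⟨i, hij⟩ (w l)).symm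
  exact Finset.sum_congr rfl fun l' _ =>
    congrArg (fun e => B.val l' • E.action e) ((H' l').2.2 _ _ hm).symm

/-- The extended Matlis dual of local cohomology at the maximal ideal is local cohomology. -/
theorem nonempty_dual_iso [IsNoetherianRing R] (T : DualData x E) (B : FrobBasis R p κ)
    (hij : i + j = n) {s : ℕ} (y : Fin s → R) (hy : Ideal.span (Set.range y) = I) {M : RFMod R p}
    (α : M ≅ (RFMod.quot p I).localCohomology x i) :
    Nonempty (RFMod.dual E M ≅ (RFMod.ring R p).localCohomology y j) := by
  have hk : ∀ g : DualTerm x (RFMod.ring R p) E n j, FrobKill p I 0 g ↔ ∀ a ∈ I, a • g = 0 :=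
    fun g => by simp only [FrobKill, pow_zero, pow_one]
  let P : (homInto E.a).obj (op M.a) →ₗ[R]
    (homInto E.a).obj (op ((RFMod.quot p I).localCohomology x i).a) :=
    ((homInto E.a).map α.inv.f.op).hom
  have hP : ∀ φ m, homEval m (P φ) = homEval (α.inv.f.hom m) φ := fun _ _ => rfl
  have hα : α.hom.f ≫ α.inv.f = 𝟙 _ :=
    (Endofunctor.Algebra.comp_f _ _).symm.trans (congrArg Endofunctor.Algebra.Hom.f α.hom_inv_id)
  have hα' : α.inv.f ≫ α.hom.f = 𝟙 _ :=
    (Endofunctor.Algebra.comp_f _ _).symm.trans (congrArg Endofunctor.Algebra.Hom.f α.inv_hom_id)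
  have hP0 : ∀ φ, P φ = 0 → φ = 0 := fun φ h => homEval_ext fun m => by
    have h1 := congrArg (homEval (α.hom.f.hom m)) h
    rw [hP] at h1
    refine Eq.trans (congrArg (fun m => homEval m φ) ?_) (h1.trans rfl)
    exact (LinearMap.congr_fun (congrArg ModuleCat.Hom.hom hα) m).symm
  have hPs : ∀ ψ, ∃ φ, P φ = ψ := fun ψ =>
    ⟨((homInto E.a).map α.hom.f.op).hom ψ, homEval_ext fun m => congrArg (fun m => homEval m ψ)
      (LinearMap.congr_fun (congrArg ModuleCat.Hom.hom hα') m)⟩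
  refine (T.res B).nonempty_colim_iso B (fun n => B.isIso_psi T.unit_E _) B.isUnitRF_ring
    (fun l => B.isUnitRF_dualObj T.unit T.unit_E n l) hy (fun φ g => Induces I hij (P φ) g)
    ?_ ?_ ?_ ?_ ?_ ?_ ?_ ?_
  · rintro w g w' g' ⟨h1, h2, h3⟩ ⟨h1', h2', h3'⟩
    refine ⟨fun a ha => ?_, ?_, fun c h hc => ?_⟩
    · exact (smul_add a g g').trans ((congrArg₂ (· + ·) (h1 a ha) (h1' a ha)).trans (add_zero 0))
    · exact (map_add _ g g').trans ((congrArg₂ (· + ·) h2 h2').trans (add_zero 0))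
    · exact (congrArg₂ (· + ·) (h3 c h hc) (h3' c h hc)).trans
        (map_add (homEval h ∘ₗ P) w w').symm
  · rintro b w g ⟨h1, h2, h3⟩
    refine ⟨fun a ha => ?_, ?_, fun c h hc => ?_⟩
    · exact (smul_comm a b g).trans ((congrArg (b • ·) (h1 a ha)).trans (smul_zero b))
    · exact (map_smul _ b g).trans ((congrArg (b • ·) h2).trans (smul_zero b))
    · exact (congrArg (b • ·) (h3 c h hc)).trans (map_smul (homEval h ∘ₗ P) b w).symm
  · exact fun φ => Induces.exists_right T hij (P φ)
  · exact fun φ g h => ⟨(hk g).mpr h.1, h.2.1⟩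
  · intro g h1 h2
    obtain ⟨ψ, hψ⟩ := Induces.exists_left hij ((hk g).mp h1) h2
    obtain ⟨φ, rfl⟩ := hPs ψ
    exact ⟨φ, hψ⟩
  · exact fun g h => Induces.killBdry_zero T B
      (Eq.mp (congrArg (fun φ => Induces I hij φ g) (map_zero P)) h)
  · exact fun φ g h hb => hP0 φ (Induces.eq_zero T B h hb)
  · intro w w' g g' hw h h'
    have := Induces.frob T B h h' (fun m => ?_)
    · refine Eq.mp (congrArg ((T.res B).KillBdry I 1 j) (congrArg (g - ·) ?_)) this
      refine Finset.sum_congr rfl fun l _ => congrArg (B.val l • ·) ?_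
      exact (DFunLike.congr_fun (dualObj_action T.unit n j) (g' l)).symm
    · rw [Functor.ofSequence_map_homOfLE_succ] at hw
      -- Evaluating the relation of the directed system at 1 ⊗ m turns the transition map into
      -- composition with Frobenius, and Ψ into Frobenius on E.
      have h1 := congrArg (homEval (tau M.a (α.inv.f.hom m))) hw
      refine Eq.trans ?_ (h1.trans (B.sum_psi_tau E w' (α.inv.f.hom m)))
      exact congrArg (fun m => homEval m w)
        ((RFMod.hom_action α.inv m).trans (delinearize_eq M.str (α.inv.f.hom m)))

end DualData

end DualLocalCohomology

/-! ### Regular local rings -/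

section RegularLocal

open IsLocalRing RingTheory.Sequence

variable {R : Type u} [CommRing R] {p : ℕ} [Fact p.Prime] [CharP R p] {κ : Type} [Fintype κ]

/-- A module with transported structure is isomorphic to the given one. -/
def RFMod.transportIso (M : RFMod R p) {E : ModuleCat.{u} R} (e : E ≅ M.a) : M.transport e ≅ M :=
  Endofunctor.Algebra.isoMk e (by simp [RFMod.transport])

lemma FrobBasis.nonempty_localCohomology_iso [IsNoetherianRing R] (B : FrobBasis R p κ)
    (M : RFMod R p) {r r' : ℕ} (x : Fin r → R) (x' : Fin r' → R)
    (hx : Ideal.span (Set.range x) = Ideal.span (Set.range x')) (j : ℕ) :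
    Nonempty (M.localCohomology x j ≅ M.localCohomology x' j) := by
  obtain ⟨Q⟩ := B.nonempty_frobRes M
  exact Q.nonempty_localCohomology_iso x x' hx j

lemma FrobBasis.isUnitRF_dual (B : FrobBasis R p κ) {E : RFMod R p} (hE : IsUnitRF E)
    (M : RFMod R p) : IsUnitRF (RFMod.dual E M) :=
  B.isUnitRF_colim fun _ => B.isIso_psi hE _

lemma FrobBasis.pullIter_eq_zero (B : FrobBasis R p κ) {M : ModuleCat.{u} R}
    (hM : ∀ m : M, m = 0) : ∀ k (m : pullIter p M k), m = 0
  | 0, m => hM m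
  | k + 1, m => by
    obtain ⟨w, hw⟩ := B.exists_eq_sum_tau (pullIter p M k) m
    refine hw.trans (Finset.sum_eq_zero fun i _ => ?_)
    rw [B.pullIter_eq_zero hM k (w i), map_zero, smul_zero]

lemma FrobBasis.isZero_dual (B : FrobBasis R p κ) (E : RFMod R p) {M : RFMod R p}
    (hM : ∀ m : M.a, m = 0) : IsZero (RFMod.dual E M).a := by
  have : Subsingleton (RFMod.dual E M).a := subsingleton_of_forall_eq 0 fun z => by
    obtain ⟨k, w, rfl⟩ := colimι_exists_rep z
    have hw : w = 0 := homEval_ext (M := pullIter p M.a k) fun m => by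
      rw [B.pullIter_eq_zero hM k m]
      exact (map_zero (ModuleCat.Hom.hom (show pullIter p M.a k ⟶ E.a from w))).trans rfl
    exact (congrArg _ hw).trans (map_zero _)
  exact ModuleCat.isZero_of_subsingleton _

lemma localCohomology_eq_zero_of_lt {r : ℕ} (x : Fin r → R) (M : RFMod R p) {i : ℕ} (hi : r < i)
    (h : (M.localCohomology x i).a) : h = 0 := by
  obtain ⟨z, hz⟩ := exists_cechClass h
  rw [cechTerm_eq_zero_of_lt x hi z] at hz
  exact HasClass.unique hz HasClass.zero

lemma exists_cechClass_linearMap_of_forall {r : ℕ} {x : Fin r → R} {M : RFMod R p} {k : ℕ}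
    (hd : ∀ z, cechD x M.a k z = 0) :
    ∃ q : CechTerm x M.a k →ₗ[R] (M.localCohomology x k).a, (∀ z, CechClass x M.a k z (q z)) ∧
      ∀ z h, CechClass x M.a k z h → q z = h :=
  exists_linearMap_of_rel (fun (z : CechTerm x M.a k) (h : (M.localCohomology x k).a) =>
    CechClass x M.a k z h) (fun _ _ _ _ h h' => HasClass.add h h')
    (fun a _ _ h => HasClass.smul a h) (fun z => CechClass.exists_of_d_eq_zero (hd z))
    (fun _ h => HasClass.unique h HasClass.zero)

/-- The duality data of a complete ring with a regular sequence. -/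
lemma nonempty_dualData [IsNoetherianRing R] (B : FrobBasis R p κ) {n : ℕ} (x : Fin n → R)
    {rs : List R} (hlen : rs.length = n) (hx : Ideal.span (Set.range x) = Ideal.ofList rs)
    (hrs : IsWeaklyRegular R rs) [IsAdicComplete (Ideal.ofList rs) R] {E : RFMod R p}
    (hE : Module.Injective R E.a) (α : E ≅ (RFMod.ring R p).localCohomology x n) :
    Nonempty (DualData x E) := by
  have hd : ∀ z : CechTerm x (RFMod.ring R p).a n, cechD x (RFMod.ring R p).a n z = 0 := fun z =>
    cechTerm_eq_zero_of_lt x (Nat.lt_succ_self n) _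
  obtain ⟨q, hq, hq'⟩ := exists_cechClass_linearMap_of_forall hd
  let β : ((RFMod.ring R p).localCohomology x n).a ≃ₗ[R] E.a :=
    ((Endofunctor.Algebra.forget _).mapIso α.symm).toLinearEquiv
  have hβ : ∀ e, β (((RFMod.ring R p).localCohomology x n).action e) = E.action (β e) :=
    fun e => RFMod.hom_action α.inv e
  have hD : IsDualizing rs E.a := (isDualizing_homology B x hx hrs hlen).of_equiv β
  exact ⟨{
    unit := B.isUnitRF_cechRF x B.isUnitRF_ring
    inj := hE
    unit_E := isUnitRF_of_iso α.symm (B.isUnitRF_localCohomology x B.isUnitRF_ring n)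
    vanish := fun k hk => cechVanish_of_isWeaklyRegular x B rs
      (fun a ha => hx ▸ Ideal.subset_span ha) (RFMod.ring R p).a hrs k (hlen ▸ hk)
    top := β.toLinearMap ∘ₗ q
    top_surjective := fun e => by
      obtain ⟨h, rfl⟩ := β.surjective e
      obtain ⟨z, hz⟩ := exists_cechClass h
      exact ⟨z, congrArg β (hq' z h hz)⟩
    top_eq_zero := fun z => by
      refine (map_eq_zero_iff β β.injective).trans ?_
      refine Iff.trans ⟨fun h => ?_, fun h => hq' z 0 h⟩ CechClass.zero_iff
      have := hq z
      rwa [h] at this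
    top_frob := fun z => (congrArg β (hq' _ _ (hq z).action)).trans (hβ (q z))
    exists_smul := hD.exists_eq_smul
    eq_zero := fun c => hD.eq_zero_of_smul }⟩

end RegularLocal

/-! ### Extension groups through resolutions -/

section ExtNaturality

/-- The homology of the opposite complex is natural. -/
lemma homologyUnop_hom_naturality {V : Type*} [Category* V] [Abelian V] {ι : Type*}
    {c : ComplexShape ι} {K L : HomologicalComplex Vᵒᵖ c} (φ : K ⟶ L) (i : ι) :
    (HomologicalComplex.homologyUnop L i).hom ≫ (HomologicalComplex.homologyMap φ i).unop =
      HomologicalComplex.homologyMap ((HomologicalComplex.unopFunctor V c).map φ.op) i ≫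
        (HomologicalComplex.homologyUnop K i).hom :=
  congrArg Quiver.Hom.unop (HomologicalComplex.homologyOp_hom_naturality
    ((HomologicalComplex.unopFunctor V c).map φ.op) i)

lemma comp_inv_eq_inv_comp {V : Type*} [Category* V] {X₁ X₂ Y₁ Y₂ : V} {α : X₁ ≅ X₂}
    {β : Y₁ ≅ Y₂} {f : X₂ ⟶ Y₂} {g : X₁ ⟶ Y₁} (h : α.hom ≫ f = g ≫ β.hom) :
    f ≫ β.inv = α.inv ≫ g := by
  rw [Iso.comp_inv_eq, Category.assoc, Iso.eq_inv_comp, h]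

lemma homologyUnop_inv_naturality {V : Type*} [Category* V] [Abelian V] {ι : Type*}
    {c : ComplexShape ι} {K L : HomologicalComplex Vᵒᵖ c} (φ : K ⟶ L) (i : ι) :
    (HomologicalComplex.homologyMap φ i).unop ≫ (HomologicalComplex.homologyUnop K i).inv =
      (HomologicalComplex.homologyUnop L i).inv ≫
        HomologicalComplex.homologyMap ((HomologicalComplex.unopFunctor V c).map φ.op) i :=
  comp_inv_eq_inv_comp (homologyUnop_hom_naturality φ i)

lemma comp_square {V : Type*} [Category* V] {X₁ X₂ X₃ Y₁ Y₂ Y₃ : V} {a : X₁ ⟶ Y₁} {b : X₂ ⟶ Y₂}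
    {c : X₃ ⟶ Y₃} {f : X₁ ⟶ X₂} {g : X₂ ⟶ X₃} {f' : Y₁ ⟶ Y₂} {g' : Y₂ ⟶ Y₃}
    (h : a ≫ f' = f ≫ b) (h' : b ≫ g' = g ≫ c) : a ≫ f' ≫ g' = (f ≫ g) ≫ c := by
  rw [← Category.assoc, h, Category.assoc, h', Category.assoc]

variable {R : Type u} [CommRing R]

/-- The map of complexes `Hom(P, N) → Hom(P', N)` given by a chain map `P' → P`. -/
def linearYonedaMap {P P' : ChainComplex (ModuleCat.{u} R) ℕ} (φ : P' ⟶ P) (N : ModuleCat.{u} R) :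
    P.linearYonedaObj R N ⟶ P'.linearYonedaObj R N :=
  (HomologicalComplex.unopFunctor _ _).map
    ((((linearYoneda R (ModuleCat.{u} R)).obj N).rightOp.mapHomologicalComplex _).map φ).op

/-- The comparison is composed of the one for derived functors in the opposite category and the one
for homology of opposite complexes; both are natural. It lets the structure map of R/I act on Ext by
a chain lift. -/
lemma isoExt_hom_naturality {M M' : ModuleCat.{u} R} (f : M' ⟶ M) (P' : ProjectiveResolution M')
    (P : ProjectiveResolution M) (φ : P'.complex ⟶ P.complex)
    (comm : φ.f 0 ≫ P.π.f 0 = P'.π.f 0 ≫ f) (N : ModuleCat.{u} R) (i : ℕ) :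
    ((Ext R (ModuleCat.{u} R) i).map f.op).app N ≫ (P'.isoExt (R := R) i N).hom =
      (P.isoExt (R := R) i N).hom ≫
        HomologicalComplex.homologyMap (linearYonedaMap φ N) i := by
  let G := ((linearYoneda R (ModuleCat.{u} R)).obj N).rightOp
  have h1 := congrArg Quiver.Hom.unop
    (ProjectiveResolution.isoLeftDerivedObj_inv_naturality f P' P φ comm G i)
  exact comp_square (h1 : ((G.leftDerived i).map f).unop ≫ (P'.isoLeftDerivedObj G i).inv.unop =
      (P.isoLeftDerivedObj G i).inv.unop ≫
        (HomologicalComplex.homologyMap ((G.mapHomologicalComplex _).map φ) i).unop)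
    (homologyUnop_inv_naturality ((G.mapHomologicalComplex _).map φ) i)

end ExtNaturality

/-! ### Ext by projective and by injective resolutions -/

section ExtDouble

variable {R : Type u} [CommRing R] {p : ℕ} [Fact p.Prime] [CharP R p]

/-- The augmentation of a projective resolution. -/
def projAug {M : ModuleCat.{u} R} (P : ProjectiveResolution M) : P.complex.X 0 ⟶ M := P.π.f 0

lemma d_comp_projAug {M : ModuleCat.{u} R} (P : ProjectiveResolution M) :
    P.complex.d 1 0 ≫ projAug P = 0 := P.complex_d_comp_π_f_zero

lemma projAug_epi {M : ModuleCat.{u} R} (P : ProjectiveResolution M) : Epi (projAug P) :=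
  inferInstanceAs (Epi (P.π.f 0))

lemma exists_projAug_comp {M Z : ModuleCat.{u} R} (P : ProjectiveResolution M)
    {f : P.complex.X 0 ⟶ Z} (h : P.complex.d 1 0 ≫ f = 0) : ∃ g, projAug P ≫ g = f :=
  ⟨P.isColimitCokernelCofork.desc (CokernelCofork.ofπ f h),
    Cofork.IsColimit.π_desc' P.isColimitCokernelCofork f (by rw [h, zero_comp])⟩

lemma d_comp_projAug_comp {M Z : ModuleCat.{u} R} (P : ProjectiveResolution M) (g : M ⟶ Z) :
    P.complex.d 1 0 ≫ projAug P ≫ g = 0 := by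
  rw [← Category.assoc, d_comp_projAug, zero_comp]

/-- A resolution by injective modules is exact as a complex of objects. -/
lemma FrobRes.exists_lift {N : RFMod R p} (Q : FrobRes N) (l : ℕ) {Z : ModuleCat.{u} R}
    [Projective Z] {f : Z ⟶ (Q.obj (l + 1)).a} (h : f ≫ (Q.d (l + 1)).f = 0) :
    ∃ g, g ≫ (Q.d l).f = f := by
  let S : ShortComplex (ModuleCat.{u} R) := ShortComplex.mk (Q.d l).f (Q.d (l + 1)).f
    (ModuleCat.hom_ext (LinearMap.ext fun g => Q.dl_dl l g))
  have hS : S.Exact := (ShortComplex.moduleCat_exact_iff S).mpr fun z hz => (Q.exact l z).mp hz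
  exact ⟨hS.liftFromProjective f h, hS.liftFromProjective_comp f h⟩

lemma FrobRes.exists_lift_zero {N : RFMod R p} (Q : FrobRes N) {Z : ModuleCat.{u} R}
    [Projective Z] {f : Z ⟶ (Q.obj 0).a} (h : f ≫ (Q.d 0).f = 0) : ∃ g, g ≫ Q.ε.f = f := by
  let S : ShortComplex (ModuleCat.{u} R) := ShortComplex.mk Q.ε.f (Q.d 0).f
    (ModuleCat.hom_ext (LinearMap.ext fun g => (Q.exact₀ _).mpr ⟨g, rfl⟩))
  have hS : S.Exact := (ShortComplex.moduleCat_exact_iff S).mpr fun z hz => (Q.exact₀ z).mp hz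
  exact ⟨hS.liftFromProjective f h, hS.liftFromProjective_comp f h⟩

lemma FrobRes.mono_ε {N : RFMod R p} (Q : FrobRes N) : Mono Q.ε.f :=
  (ModuleCat.mono_iff_injective _).mpr Q.ε_injective

lemma FrobRes.ε_comp_d {N : RFMod R p} (Q : FrobRes N) : Q.ε.f ≫ (Q.d 0).f = 0 :=
  ModuleCat.hom_ext (LinearMap.ext fun g => (Q.exact₀ _).mpr ⟨g, rfl⟩)

lemma FrobRes.comp_ε_comp_d {N : RFMod R p} (Q : FrobRes N) {Z : ModuleCat.{u} R} (f : Z ⟶ N.a) :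
    (f ≫ Q.ε.f) ≫ (Q.d 0).f = 0 := by
  rw [Category.assoc, Q.ε_comp_d, comp_zero]

lemma FrobRes.d_comp_d {N : RFMod R p} (Q : FrobRes N) (l : ℕ) :
    (Q.d l).f ≫ (Q.d (l + 1)).f = 0 :=
  ModuleCat.hom_ext (LinearMap.ext fun g => Q.dl_dl l g)

variable {M : ModuleCat.{u} R} (P : ProjectiveResolution M) {N : RFMod R p} (Q : FrobRes N)

/-- The double complex of homomorphisms from a projective to an injective resolution. -/
def extDouble : DoubleComplex.{u} where
  X k l := P.complex.X k ⟶ (Q.obj l).a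
  h k l := Preadditive.leftComp _ (P.complex.d (k + 1) k)
  v k l := Preadditive.rightComp _ (Q.d l).f
  hh k l z := by
    change P.complex.d (k + 2) (k + 1) ≫ P.complex.d (k + 1) k ≫ z = 0
    rw [← Category.assoc, P.complex.d_comp_d, zero_comp]
  vv k l z := by
    change (z ≫ (Q.d l).f) ≫ (Q.d (l + 1)).f = 0
    rw [Category.assoc, Q.d_comp_d, comp_zero]
  comm k l z := by
    change P.complex.d (k + 1) k ≫ z ≫ (Q.d l).f = (P.complex.d (k + 1) k ≫ z) ≫ (Q.d l).f
    rw [Category.assoc]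

lemma extDouble_rowExact : (extDouble P Q).RowExact := fun k l z hz => by
  have : Injective (Q.obj l).a := (Module.injective_iff_injective_object R _).mp (Q.inj l)
  exact ⟨(P.exact_succ k).descToInjective z hz, (P.exact_succ k).comp_descToInjective z hz⟩

lemma extDouble_colExact : (extDouble P Q).ColExact := fun k l z hz => by
  have := P.projective k
  exact Q.exists_lift l hz

/-- The cocycles `g` and `f` represent the same extension class. -/
def ExtRep (j : ℕ) (g : M ⟶ (Q.obj j).a) (f : P.complex.X j ⟶ N.a) : Prop :=
  (extDouble P Q).Zigzag j 0 (projAug P ≫ g) j (f ≫ Q.ε.f)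

/-- Boundaries in the complex `Hom(P, N)`. -/
def ExtBdry (P : ProjectiveResolution M) (N : ModuleCat.{u} R) : ∀ j, (P.complex.X j ⟶ N) → Prop
  | 0, f => f = 0
  | j + 1, f => ∃ b, P.complex.d (j + 1) j ≫ b = f

/-- Boundaries in the complex `Hom(M, Q)`. -/
def HomBdry (M : ModuleCat.{u} R) {N : RFMod R p} (Q : FrobRes N) :
    ∀ j, (M ⟶ (Q.obj j).a) → Prop
  | 0, g => g = 0
  | j + 1, g => ∃ b, b ≫ (Q.d j).f = g

variable {P Q} {j : ℕ}

/-- Balancing of Ext: columns are exact by projectivity of the terms of `P`, rows by injectivity of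
those of `Q`. The next three lemmas complete the bijection between H^j(Hom(M, Q)) and H^j(Hom(P,
N)). -/
lemma ExtRep.exists_cocycle {g : M ⟶ (Q.obj j).a} (hg : g ≫ (Q.d j).f = 0) :
    ∃ f, P.complex.d (j + 1) j ≫ f = 0 ∧ ExtRep P Q j g f := by
  obtain ⟨w, hw, h1, h2⟩ := DoubleComplex.Zigzag.exists_end (extDouble_colExact P Q)
    (Nat.zero_add j) (projAug P ≫ g)
    (d_comp_projAug_comp P g)
    (show (projAug P ≫ g) ≫ (Q.d j).f = 0 by rw [Category.assoc, hg, comp_zero])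
  have := P.projective j
  obtain ⟨f, rfl⟩ := Q.exists_lift_zero (show (w : P.complex.X j ⟶ _) ≫ (Q.d 0).f = 0 from h2)
  have := Q.mono_ε
  refine ⟨f, (cancel_mono Q.ε.f).mp ?_, hw⟩
  rw [zero_comp, Category.assoc]
  exact h1

lemma ExtRep.exists_hom {f : P.complex.X j ⟶ N.a} (hf : P.complex.d (j + 1) j ≫ f = 0) :
    ∃ g, g ≫ (Q.d j).f = 0 ∧ ExtRep P Q j g f := by
  obtain ⟨u, hu, h1, h2⟩ := DoubleComplex.Zigzag.exists_start (extDouble_rowExact P Q)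
    (m := j) (f ≫ Q.ε.f)
    (show P.complex.d (j + 1) j ≫ f ≫ Q.ε.f = 0 by rw [← Category.assoc, hf, zero_comp])
    (Q.comp_ε_comp_d f)
  obtain ⟨g, rfl⟩ := exists_projAug_comp P
    (show P.complex.d 1 0 ≫ (u : P.complex.X 0 ⟶ _) = 0 from h1)
  have := projAug_epi P
  refine ⟨g, (cancel_epi (projAug P)).mp ?_, hu⟩
  rw [comp_zero, ← Category.assoc]
  exact h2

lemma ExtRep.homBdry {g : M ⟶ (Q.obj j).a} {f : P.complex.X j ⟶ N.a} (H : ExtRep P Q j g f)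
    (hf : ExtBdry P N.a j f) : HomBdry M Q j g := by
  have h1 : (extDouble P Q).StartBdry j (projAug P ≫ g) := by
    refine DoubleComplex.Zigzag.startBdry (extDouble_rowExact P Q) H ?_
    cases j with
    | zero =>
      obtain rfl : f = 0 := hf
      exact zero_comp
    | succ j =>
      obtain ⟨b, rfl⟩ := hf
      exact ⟨b ≫ Q.ε.f, (Category.assoc (P.complex.d (j + 1) j) b Q.ε.f).symm,
        Q.comp_ε_comp_d b⟩
  have := projAug_epi P
  cases j with
  | zero => exact (cancel_epi (projAug P)).mp (Eq.trans h1 comp_zero.symm)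
  | succ j =>
    obtain ⟨b, hb, hb'⟩ := h1
    obtain ⟨b, rfl⟩ := exists_projAug_comp P
      (show P.complex.d 1 0 ≫ (b : P.complex.X 0 ⟶ _) = 0 from hb')
    exact ⟨b, (cancel_epi (projAug P)).mp (Eq.trans (Category.assoc _ _ _).symm hb)⟩

lemma ExtRep.extBdry {g : M ⟶ (Q.obj j).a} {f : P.complex.X j ⟶ N.a} (H : ExtRep P Q j g f)
    (hg : HomBdry M Q j g) : ExtBdry P N.a j f := by
  have h1 : (extDouble P Q).EndBdry j (f ≫ Q.ε.f) := by
    refine DoubleComplex.Zigzag.endBdry (extDouble_colExact P Q) H ?_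
    cases j with
    | zero =>
      obtain rfl : g = 0 := hg
      exact comp_zero
    | succ j =>
      obtain ⟨b, rfl⟩ := hg
      exact ⟨projAug P ≫ b, Category.assoc (projAug P) b (Q.d j).f,
        d_comp_projAug_comp P b⟩
  have := Q.mono_ε
  cases j with
  | zero => exact (cancel_mono Q.ε.f).mp (Eq.trans h1 zero_comp.symm)
  | succ j =>
    obtain ⟨b, hb, hb'⟩ := h1
    have := P.projective j
    obtain ⟨b, rfl⟩ := Q.exists_lift_zero (show (b : P.complex.X j ⟶ _) ≫ (Q.d 0).f = 0 from hb')
    exact ⟨b, (cancel_mono Q.ε.f).mp (Eq.trans (Category.assoc _ _ _) hb)⟩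

lemma ExtRep.add {g g' : M ⟶ (Q.obj j).a} {f f' : P.complex.X j ⟶ N.a} (H : ExtRep P Q j g f)
    (H' : ExtRep P Q j g' f') : ExtRep P Q j (g + g') (f + f') := by
  rw [ExtRep, Preadditive.comp_add, Preadditive.add_comp]
  exact DoubleComplex.Zigzag.add H H'

lemma ExtRep.sub {g g' : M ⟶ (Q.obj j).a} {f f' : P.complex.X j ⟶ N.a} (H : ExtRep P Q j g f)
    (H' : ExtRep P Q j g' f') : ExtRep P Q j (g - g') (f - f') := by
  rw [ExtRep, Preadditive.comp_sub, Preadditive.sub_comp]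
  exact DoubleComplex.Zigzag.sub H H'

lemma ExtRep.sum {α : Type*} (s : Finset α) {g : α → (M ⟶ (Q.obj j).a)}
    {f : α → (P.complex.X j ⟶ N.a)} (H : ∀ a ∈ s, ExtRep P Q j (g a) (f a)) :
    ExtRep P Q j (∑ a ∈ s, g a) (∑ a ∈ s, f a) := by
  rw [ExtRep, Preadditive.comp_sum, Preadditive.sum_comp]
  exact DoubleComplex.Zigzag.sum s (Nat.zero_add j) H

lemma ExtRep.smul (a : R) {g : M ⟶ (Q.obj j).a} {f : P.complex.X j ⟶ N.a}
    (H : ExtRep P Q j g f) : ExtRep P Q j (a • g) (a • f) := by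
  rw [ExtRep, Linear.comp_smul, Linear.smul_comp]
  exact DoubleComplex.Zigzag.map (C := extDouble P Q) (C' := extDouble P Q)
    (fun k l => DistribSMul.toAddMonoidHom (P.complex.X k ⟶ (Q.obj l).a) a)
    (fun k l (z : P.complex.X k ⟶ (Q.obj l).a) =>
      (Linear.comp_smul _ _ _ (P.complex.d (k + 1) k) a z).symm)
    (fun k l (z : P.complex.X k ⟶ (Q.obj l).a) => (Linear.smul_comp _ _ _ a z (Q.d l).f).symm) H

lemma ExtRep.comp {M' : ModuleCat.{u} R} {P' : ProjectiveResolution M'} {θ : M' ⟶ M}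
    (φ : P'.complex ⟶ P.complex) (comm : φ.f 0 ≫ projAug P = projAug P' ≫ θ)
    {g : M ⟶ (Q.obj j).a} {f : P.complex.X j ⟶ N.a} (H : ExtRep P Q j g f) :
    ExtRep P' Q j (θ ≫ g) (φ.f j ≫ f) := by
  rw [ExtRep, ← Category.assoc, ← comm, Category.assoc, Category.assoc]
  exact DoubleComplex.Zigzag.map (C := extDouble P Q) (C' := extDouble P' Q)
    (fun k l => Preadditive.leftComp _ (φ.f k))
    (fun k l (z : P.complex.X k ⟶ (Q.obj l).a) =>
      show φ.f (k + 1) ≫ P.complex.d (k + 1) k ≫ z = P'.complex.d (k + 1) k ≫ φ.f k ≫ z by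
        rw [← Category.assoc, ← Category.assoc, φ.comm])
    (fun k l (z : P.complex.X k ⟶ (Q.obj l).a) => (Category.assoc (φ.f k) z (Q.d l).f).symm) H

end ExtDouble

/-! ### The maps Ψ on morphisms -/

section PsiMap

variable {R : Type u} [CommRing R] {p : ℕ} [Fact p.Prime] [CharP R p]

/-- The map `R¹ ⊗ M ⟶ N` attached to a map `M ⟶ N` to an `R[F]`-module. -/
def psiMap (N : RFMod R p) {M : ModuleCat.{u} R} (f : M ⟶ N.a) : (pull R p).obj M ⟶ N.a :=
  (pull R p).map f ≫ N.str

lemma psiMap_add (N : RFMod R p) {M : ModuleCat.{u} R} (f f' : M ⟶ N.a) :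
    psiMap N (f + f') = psiMap N f + psiMap N f' := by
  rw [psiMap, Functor.map_add, Preadditive.add_comp]
  rfl

/-- The map `psiMap` as a homomorphism of groups. -/
def psiMapHom (M : ModuleCat.{u} R) (N : RFMod R p) :
    (M ⟶ N.a) →+ ((pull R p).obj M ⟶ N.a) := AddMonoidHom.mk' (psiMap N) (psiMap_add N)

lemma psiMap_precomp (N : RFMod R p) {M M' : ModuleCat.{u} R} (h : M' ⟶ M) (f : M ⟶ N.a) :
    psiMap N (h ≫ f) = (pull R p).map h ≫ psiMap N f := by
  rw [psiMap, psiMap, Functor.map_comp, Category.assoc]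

lemma psiMap_postcomp {N N' : RFMod R p} (h : N ⟶ N') {M : ModuleCat.{u} R} (f : M ⟶ N.a) :
    psiMap N' (f ≫ h.f) = psiMap N f ≫ h.f := by
  rw [psiMap, psiMap, Functor.map_comp, Category.assoc, Category.assoc, h.h]

lemma psiMap_tau (N : RFMod R p) {M : ModuleCat.{u} R} (f : M ⟶ N.a) (m : M) :
    (psiMap N f).hom (tau M m) = N.action (f.hom m) := by
  rw [← delinearize_eq]
  rfl

lemma delinearize_psi (N : RFMod R p) {M : ModuleCat.{u} R} (f : M ⟶ N.a) :
    delinearize (psi N M) (show (homInto N.a).obj (op M) from f) = psiMap N f := by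
  rw [psi, delinearize_linearize]
  rfl

end PsiMap

/-! ### Frobenius pullback of projective resolutions -/

section PullResolution

variable {R : Type u} [CommRing R] {p : ℕ} [Fact p.Prime] [CharP R p]
  [PreservesFiniteLimits (pull R p)]

/-- The Frobenius pullback of a projective resolution. -/
abbrev pullRes {M : ModuleCat.{u} R} (P : ProjectiveResolution M) :
    ProjectiveResolution ((pull R p).obj M) := (pull R p).mapProjectiveResolution P

lemma projAug_pullRes {M : ModuleCat.{u} R} (P : ProjectiveResolution M) :
    projAug (pullRes (p := p) P) = (pull R p).map (projAug P) := by
  have h := HomologicalComplex.singleMapHomologicalComplex_hom_app_self (pull R p)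
    (ComplexShape.down ℕ) 0 M
  have h' : ((HomologicalComplex.singleMapHomologicalComplex (pull R p)
      (ComplexShape.down ℕ) 0).hom.app M).f 0 = 𝟙 ((pull R p).obj M) :=
    h.trans ((Category.comp_id _).trans ((pull R p).map_id M))
  exact (congrArg ((pull R p).map (projAug P) ≫ ·) h').trans (Category.comp_id _)

/-- Ψ commutes with precomposition and with postcomposition by `R[F]`-morphisms, hence maps the
double complex of P to that of R¹ ⊗ P. -/
lemma ExtRep.psi {M : ModuleCat.{u} R} {P : ProjectiveResolution M} {N : RFMod R p}
    {Q : FrobRes N} {j : ℕ} {g : M ⟶ (Q.obj j).a} {f : P.complex.X j ⟶ N.a}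
    (H : ExtRep P Q j g f) :
    ExtRep (pullRes P) Q j (psiMap (Q.obj j) g) (psiMap N f) := by
  have h1 : projAug (pullRes P) ≫ psiMap (Q.obj j) g = psiMap (Q.obj j) (projAug P ≫ g) :=
    (congrArg (· ≫ psiMap (Q.obj j) g) (projAug_pullRes P)).trans (psiMap_precomp _ _ _).symm
  have h2 : psiMap N f ≫ Q.ε.f = psiMap (Q.obj 0) (f ≫ Q.ε.f) := (psiMap_postcomp _ _).symm
  have key := DoubleComplex.Zigzag.map (C := extDouble P Q) (C' := extDouble (pullRes P) Q)
    (fun k l => psiMapHom (P.complex.X k) (Q.obj l))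
    (fun k l (z : P.complex.X k ⟶ (Q.obj l).a) =>
      psiMap_precomp (Q.obj l) (P.complex.d (k + 1) k) z)
    (fun k l (z : P.complex.X k ⟶ (Q.obj l).a) => psiMap_postcomp (Q.d l) z) H
  exact Eq.mp (congrArg₂ (fun v w => (extDouble (pullRes P) Q).Zigzag j 0 v j w)
    h1.symm h2.symm) key

end PullResolution

/-! ### Extension classes, and Ψ on Ext -/

section ExtClass

variable {R : Type u} [CommRing R] {p : ℕ} [Fact p.Prime] [CharP R p]
  {M N : ModuleCat.{u} R} {P : ProjectiveResolution M} {j : ℕ}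

/-- The cocycle `f` in `Hom(P, N)` represents the extension class `w`. -/
def ExtClass (P : ProjectiveResolution M) (N : ModuleCat.{u} R) (j : ℕ) (f : P.complex.X j ⟶ N)
    (w : extMod M N j) : Prop :=
  HasClass (P.complex.linearYonedaObj R N) j f ((P.isoExt (R := R) j N).hom.hom w)

lemma ExtClass.d_comp {f : P.complex.X j ⟶ N} {w : extMod M N j} (H : ExtClass P N j f w) :
    P.complex.d (j + 1) j ≫ f = 0 :=
  HasClass.d_eq_zero H (j + 1)

lemma ExtClass.exists_rep (P : ProjectiveResolution M) (w : extMod M N j) :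
    ∃ f, ExtClass P N j f w :=
  HasClass.exists_rep (K := P.complex.linearYonedaObj R N) ((P.isoExt (R := R) j N).hom.hom w)

lemma ExtClass.exists_of_d_comp {f : P.complex.X j ⟶ N} (h : P.complex.d (j + 1) j ≫ f = 0) :
    ∃ w, ExtClass P N j f w := by
  obtain ⟨w, hw⟩ := HasClass.exists_of_d_eq_zero (K := P.complex.linearYonedaObj R N) (i := j)
    (z := f) (fun k => by
      by_cases hk : j + 1 = k
      · subst hk
        exact h
      · rw [(P.complex.linearYonedaObj R N).shape j k hk]
        rfl)
  refine ⟨(P.isoExt (R := R) j N).inv.hom w, ?_⟩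
  have h1 : (P.isoExt (R := R) j N).hom.hom ((P.isoExt (R := R) j N).inv.hom w) = w :=
    LinearMap.congr_fun (congrArg ModuleCat.Hom.hom (P.isoExt (R := R) j N).inv_hom_id) w
  rw [ExtClass, h1]
  exact hw

lemma ExtClass.add {f f' : P.complex.X j ⟶ N} {w w' : extMod M N j} (H : ExtClass P N j f w)
    (H' : ExtClass P N j f' w') : ExtClass P N j (f + f') (w + w') := by
  rw [ExtClass, map_add]
  exact HasClass.add H H'

lemma ExtClass.sub {f f' : P.complex.X j ⟶ N} {w w' : extMod M N j} (H : ExtClass P N j f w)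
    (H' : ExtClass P N j f' w') : ExtClass P N j (f - f') (w - w') := by
  rw [ExtClass, map_sub]
  exact HasClass.sub H H'

lemma ExtClass.smul (a : R) {f : P.complex.X j ⟶ N} {w : extMod M N j} (H : ExtClass P N j f w) :
    ExtClass P N j (a • f) (a • w) := by
  rw [ExtClass, map_smul]
  exact HasClass.smul a H

lemma ExtClass.sum {α : Type*} (s : Finset α) {f : α → (P.complex.X j ⟶ N)}
    {w : α → extMod M N j} (H : ∀ a ∈ s, ExtClass P N j (f a) (w a)) :
    ExtClass P N j (∑ a ∈ s, f a) (∑ a ∈ s, w a) := by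
  rw [ExtClass, map_sum]
  exact HasClass.sum s H

lemma isoExt_hom_injective (P : ProjectiveResolution M) (N : ModuleCat.{u} R) (j : ℕ) :
    Function.Injective (P.isoExt (R := R) j N).hom.hom :=
  (P.isoExt (R := R) j N).toLinearEquiv.injective

lemma ExtClass.unique {f : P.complex.X j ⟶ N} {w w' : extMod M N j} (H : ExtClass P N j f w)
    (H' : ExtClass P N j f w') : w = w' :=
  isoExt_hom_injective P N j (HasClass.unique H H')

lemma ExtClass.zero_iff {f : P.complex.X j ⟶ N} : ExtClass P N j f 0 ↔ ExtBdry P N j f := by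
  rw [ExtClass, map_zero]
  constructor
  · intro h
    obtain ⟨i, b, hb⟩ := HasClass.exists_of_zero h
    by_cases hi : i + 1 = j
    · subst hi
      exact ⟨b, hb⟩
    · rw [(P.complex.linearYonedaObj R N).shape i j hi] at hb
      have hf : f = 0 := hb.symm
      cases j with
      | zero => exact hf
      | succ j => exact ⟨0, by rw [comp_zero, hf]⟩
  · intro h
    cases j with
    | zero =>
      obtain rfl : f = 0 := h
      exact HasClass.zero
    | succ j =>
      obtain ⟨b, rfl⟩ := h
      exact HasClass.of_d (K := P.complex.linearYonedaObj R N) (i := j + 1) (j := j) b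

lemma ExtClass.eq_zero {f : P.complex.X j ⟶ N} {w : extMod M N j} (H : ExtClass P N j f w)
    (h : ExtBdry P N j f) : w = 0 :=
  H.unique (ExtClass.zero_iff.mpr h)

lemma ExtClass.comp {M' : ModuleCat.{u} R} {P' : ProjectiveResolution M'} {θ : M' ⟶ M}
    (φ : P'.complex ⟶ P.complex) (comm : φ.f 0 ≫ projAug P = projAug P' ≫ θ)
    {f : P.complex.X j ⟶ N} {w : extMod M N j} (H : ExtClass P N j f w) :
    ExtClass P' N j (φ.f j ≫ f) ((((Ext R (ModuleCat.{u} R) j).map θ.op).app N).hom w) := by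
  have h1 := HasClass.map (linearYonedaMap φ N) H
  have h2 := LinearMap.congr_fun (congrArg ModuleCat.Hom.hom
    (isoExt_hom_naturality θ P' P φ comm N j)) w
  exact Eq.mp (congrArg (HasClass (P'.complex.linearYonedaObj R N) j (φ.f j ≫ f)) h2.symm) h1

lemma ExtClass.psi [PreservesFiniteLimits (pull R p)] {N : RFMod R p} {f : (projectiveResolution M).complex.X j ⟶ N.a}
    {w : extMod M N.a j} (H : ExtClass (projectiveResolution M) N.a j f w) :
    ExtClass (pullRes (projectiveResolution M)) N.a j (psiMap N f)
      (delinearize (psiExt N M j) w) := by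
  have h1 := HasClass.homologyLift (psiComplex N (projectiveResolution M).complex) H
  let e := ((pull R p).mapProjectiveResolution (projectiveResolution M)).isoExt (R := R) j N.a
  have h2 : delinearize (psiExt N M j) w = e.inv.hom
      (delinearize (homologyLift (psiComplex N (projectiveResolution M).complex) j)
        (((projectiveResolution M).isoExt (R := R) j N.a).hom.hom w)) := rfl
  have h3 : ∀ z, e.hom.hom (e.inv.hom z) = z := fun z =>
    LinearMap.congr_fun (congrArg ModuleCat.Hom.hom e.inv_hom_id) z
  have h4 := (congrArg e.hom.hom h2).trans (h3 _)
  exact Eq.mp (congrArg (HasClass _ j (psiMap N f)) h4.symm) h1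

variable {κ : Type} [Fintype κ]

lemma FrobBasis.exists_psiMap (B : FrobBasis R p κ) {N : RFMod R p} (hN : IsUnitRF N)
    (f : (pull R p).obj M ⟶ N.a) : ∃ f' : κ → (M ⟶ N.a), f = ∑ i, B.val i • psiMap N (f' i) := by
  have := B.isIso_psi hN M
  obtain ⟨f', hf'⟩ := B.exists_eq_sum_of_isIso (psi N M)
    (show (homInto N.a).obj (op ((pull R p).obj M)) from f)
  exact ⟨f', hf'.trans (Finset.sum_congr rfl fun i _ =>
    congrArg (B.val i • ·) (delinearize_psi N (f' i)))⟩

lemma FrobBasis.psiMap_eq_zero (B : FrobBasis R p κ) {N : RFMod R p} (hN : IsUnitRF N)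
    {f : κ → (M ⟶ N.a)} (h : ∑ i, B.val i • psiMap N (f i) = 0) (i : κ) : f i = 0 := by
  have := B.isIso_psi hN M
  exact B.eq_zero_of_isIso (psi N M) (m := f) ((Finset.sum_congr rfl fun i _ =>
    congrArg (B.val i • ·) (delinearize_psi N (f i))).trans h) i

lemma FrobBasis.psiMap_injective (B : FrobBasis R p κ) {N : RFMod R p} (hN : IsUnitRF N)
    {f f' : κ → (M ⟶ N.a)} (h : ∑ i, B.val i • psiMap N (f i) = ∑ i, B.val i • psiMap N (f' i))
    (i : κ) : f i = f' i := by
  refine sub_eq_zero.mp (B.psiMap_eq_zero hN (f := fun i => f i - f' i) ?_ i)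
  rw [← sub_eq_zero, ← Finset.sum_sub_distrib] at h
  refine Eq.trans (Finset.sum_congr rfl fun i _ => ?_) h
  rw [← smul_sub]
  exact congrArg (B.val i • ·) (map_sub (psiMapHom _ N) _ _)

lemma precomp_sum_psiMap (B : FrobBasis R p κ) (N : RFMod R p) {M' : ModuleCat.{u} R}
    (d : M' ⟶ M) (f : κ → (M ⟶ N.a)) :
    (pull R p).map d ≫ ∑ i, B.val i • psiMap N (f i) =
      ∑ i, B.val i • psiMap N (d ≫ f i) := by
  rw [Preadditive.comp_sum]
  refine Finset.sum_congr rfl fun i _ => ?_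
  rw [Linear.comp_smul, psiMap_precomp]

/-- For a unit module `N`, the maps `Ψ` induce an isomorphism on extension groups. -/
lemma FrobBasis.isIso_psiExt [PreservesFiniteLimits (pull R p)] (B : FrobBasis R p κ) {N : RFMod R p} (hN : IsUnitRF N)
    (M : ModuleCat.{u} R) (j : ℕ) : IsIso (psiExt N M j) := by
  refine B.isIso_of _ (fun w => ?_) fun w hw i => ?_
  · obtain ⟨f, hf⟩ := ExtClass.exists_rep (pullRes (projectiveResolution M)) w
    obtain ⟨f', rfl⟩ := B.exists_psiMap hN f
    have h1 := (precomp_sum_psiMap B N _ f').symm.trans hf.d_comp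
    choose w' hw' using fun i => ExtClass.exists_of_d_comp (B.psiMap_eq_zero hN h1 i)
    exact ⟨w', hf.unique (ExtClass.sum _ fun i _ => ((hw' i).psi).smul _)⟩
  · choose f hf using fun i => ExtClass.exists_rep (projectiveResolution M) (w i)
    refine (hf i).eq_zero ?_
    have h1 : ExtClass (pullRes (projectiveResolution M)) N.a j
        (∑ i, B.val i • psiMap N (f i)) 0 :=
      hw ▸ ExtClass.sum _ fun i _ => ((hf i).psi).smul _
    have h2 := ExtClass.zero_iff.mp h1
    cases j with
    | zero => exact B.psiMap_eq_zero hN h2 i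
    | succ j =>
      obtain ⟨b, hb⟩ := h2
      obtain ⟨b', rfl⟩ := B.exists_psiMap hN b
      refine ⟨b' i, ?_⟩
      have h3 := (precomp_sum_psiMap B N
        ((projectiveResolution M).complex.d (j + 1) j) b').symm.trans hb
      exact B.psiMap_injective hN h3 i

end ExtClass

/-! ### Local cohomology generated by an extension group -/

section Generated

variable {R : Type u} [CommRing R] {p : ℕ} [Fact p.Prime] [CharP R p] {κ : Type} [Fintype κ]

variable (p) in
/-- The element `1` of `R/I`. -/
def quotOne (I : Ideal R) : (RFMod.quot p I).a := quotMap p I (ringOne R p)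

lemma quot_action_one (I : Ideal R) : (RFMod.quot p I).action (quotOne p I) = quotOne p I := by
  refine (quotMap_action I (ringOne R p)).symm.trans (congrArg (quotMap p I) ?_)
  exact (RFMod.ring_action (R := R) 1).trans (one_pow (M := R) p)

lemma exists_smul_quotOne {I : Ideal R} (m : (RFMod.quot p I).a) : ∃ a : R, m = a • quotOne p I := by
  obtain ⟨a, rfl⟩ := quotMap_surjective I m
  refine ⟨a, Eq.trans (congrArg (quotMap p I) ?_) (map_smul (quotMap p I) (show R from a) _)⟩
  exact (mul_one (show R from a)).symm

lemma quot_hom_ext {I : Ideal R} {Z : ModuleCat.{u} R} {G G' : (RFMod.quot p I).a ⟶ Z}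
    (h : G.hom (quotOne p I) = G'.hom (quotOne p I)) : G = G' := by
  refine ModuleCat.hom_ext (LinearMap.ext fun m => ?_)
  obtain ⟨a, rfl⟩ := exists_smul_quotOne m
  rw [map_smul, map_smul, h]

lemma exists_quot_hom {I : Ideal R} {Z : ModuleCat.{u} R} {g : Z} (hg : ∀ a ∈ I, a • g = 0) :
    ∃ G : (RFMod.quot p I).a ⟶ Z, G.hom (quotOne p I) = g := by
  let G : R ⧸ I →ₗ[R] Z := Submodule.liftQ I (LinearMap.toSpanSingleton R Z g) hg
  exact ⟨ModuleCat.ofHom G, (Submodule.liftQ_apply I _ (1 : R)).trans (one_smul R g)⟩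

lemma hom_sum_smul_tau (B : FrobBasis R p κ) {M Z : ModuleCat.{u} R} (θ : (pull R p).obj M ⟶ Z)
    (m : κ → M) : θ.hom (∑ i, B.val i • tau M (m i)) = ∑ i, B.val i • delinearize θ (m i) := by
  rw [map_sum]
  refine Finset.sum_congr rfl fun i _ => ?_
  rw [map_smul, delinearize_eq]

variable {N : RFMod R p} {Q : FrobRes N} {I : Ideal R} {j : ℕ}

/-- The element `g` of the resolution and the extension class `w` correspond to each other. -/
def ExtMatch (Q : FrobRes N) (I : Ideal R) (j : ℕ) (w : extMod (RFMod.quot p I).a N.a j)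
    (g : (Q.obj j).a) : Prop :=
  ∃ (G : (RFMod.quot p I).a ⟶ (Q.obj j).a)
    (f : (projectiveResolution (RFMod.quot p I).a).complex.X j ⟶ N.a),
    G.hom (quotOne p I) = g ∧ G ≫ (Q.d j).f = 0 ∧
      ExtClass (projectiveResolution (RFMod.quot p I).a) N.a j f w ∧
      ExtRep (projectiveResolution (RFMod.quot p I).a) Q j G f

/-- Evaluation at 1 identifies homomorphisms from R/I with elements killed by `I`, which is level
zero of the Frobenius filtration. -/
lemma FrobRes.KillBdry.of_homBdry {I : Ideal R} {G : (RFMod.quot p I).a ⟶ (Q.obj j).a}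
    (h : HomBdry (RFMod.quot p I).a Q j G) : Q.KillBdry I 0 j (G.hom (quotOne p I)) := by
  cases j with
  | zero =>
    obtain rfl : G = 0 := h
    rfl
  | succ j =>
    obtain ⟨b, rfl⟩ := h
    refine ⟨b.hom (quotOne p I), fun a ha => ?_, rfl⟩
    rw [pow_zero, pow_one, ← map_smul, quot_smul_eq_zero ha, map_zero]

lemma FrobRes.KillBdry.homBdry {I : Ideal R} {G : (RFMod.quot p I).a ⟶ (Q.obj j).a}
    (h : Q.KillBdry I 0 j (G.hom (quotOne p I))) : HomBdry (RFMod.quot p I).a Q j G := by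
  cases j with
  | zero => exact quot_hom_ext (Eq.trans h rfl)
  | succ j =>
    obtain ⟨g, hg, h2⟩ := h
    obtain ⟨b, rfl⟩ := exists_quot_hom (p := p) (I := I) (g := g) fun a ha => by
      have := hg a ha
      rwa [pow_zero, pow_one] at this
    exact ⟨b, quot_hom_ext h2⟩

/-- The element 1 ⊗ 1 of R¹ ⊗ R/I is killed by p-th powers of elements of `I`, which raises the
level to one. -/
lemma FrobRes.KillBdry.of_homBdry_pull {I : Ideal R}
    {G : (pull R p).obj (RFMod.quot p I).a ⟶ (Q.obj j).a}
    (h : HomBdry ((pull R p).obj (RFMod.quot p I).a) Q j G) :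
    Q.KillBdry I 1 j (G.hom (tau _ (quotOne p I))) := by
  cases j with
  | zero =>
    obtain rfl : G = 0 := h
    rfl
  | succ j =>
    obtain ⟨b, rfl⟩ := h
    refine ⟨b.hom (tau _ (quotOne p I)), fun a ha => ?_, rfl⟩
    rw [pow_one, ← map_smul, ← frobenius_def, ← LinearMap.map_smulₛₗ, quot_smul_eq_zero ha,
      map_zero, map_zero]

/-- The hypothesis says that a difference of classes in Ext(R¹ ⊗ R/I, N) vanishes. Transported to
the injective side, this difference becomes a boundary, and evaluating at 1 ⊗ 1 gives the claim. -/
lemma ExtMatch.frob [PreservesFiniteLimits (pull R p)] (B : FrobBasis R p κ)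
    {w : extMod (RFMod.quot p I).a N.a j} {w' : κ → extMod (RFMod.quot p I).a N.a j}
    {g : (Q.obj j).a} {g' : κ → (Q.obj j).a} (H : ExtMatch Q I j w g)
    (H' : ∀ i, ExtMatch Q I j (w' i) (g' i))
    (h : (extStr (RFMod.quot p I) N.a j).hom w =
      ∑ i, B.val i • delinearize (psiExt N (RFMod.quot p I).a j) (w' i)) :
    Q.KillBdry I 1 j (g - ∑ i, B.val i • (Q.obj j).action (g' i)) := by
  obtain ⟨G, f, rfl, -, hc, hr⟩ := H
  choose G' f' hg' _ hc' hr' using H'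
  obtain rfl : g' = fun i => (G' i).hom (quotOne p I) := funext fun i => (hg' i).symm
  let P := projectiveResolution (RFMod.quot p I).a
  -- A lift of the structure map to resolutions represents the map it induces on Ext.
  let φ := ProjectiveResolution.lift (RFMod.quot p I).str (pullRes P) P
  have comm : φ.f 0 ≫ projAug P = projAug (pullRes P) ≫ (RFMod.quot p I).str :=
    ProjectiveResolution.lift_commutes_zero _ _ _
  have h1 := (ExtRep.comp φ comm hr).sub
    (ExtRep.sum Finset.univ fun i _ => ((hr' i).psi).smul (B.val i))
  have h2 := (ExtClass.comp φ comm hc).sub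
    (ExtClass.sum Finset.univ fun i _ => ((hc' i).psi).smul (B.val i))
  have h3 := h1.homBdry (ExtClass.zero_iff.mp (Eq.mp (congrArg _ (sub_eq_zero.mpr h)) h2))
  have h4 := FrobRes.KillBdry.of_homBdry_pull h3
  refine Eq.mp (congrArg (Q.KillBdry I 1 j) ?_) h4
  rw [ModuleCat.hom_sub, LinearMap.sub_apply, ModuleCat.hom_sum, LinearMap.sum_apply]
  refine congrArg₂ (· - ·) ?_ (Finset.sum_congr rfl fun i _ => ?_)
  · refine congrArg G.hom ?_
    exact (delinearize_eq (RFMod.quot p I).str (quotOne p I)).symm.trans (quot_action_one I)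
  · exact congrArg (B.val i • ·) (psiMap_tau (Q.obj j) (G' i) (quotOne p I))

/-- The unit module generated by an extension group is local cohomology. -/
theorem nonempty_generated_iso [IsNoetherianRing R] [PreservesFiniteLimits (pull R p)]
    (B : FrobBasis R p κ) (Q : FrobRes N) (hN : IsUnitRF N) (hQ : ∀ l, IsUnitRF (Q.obj l))
    {s : ℕ} (y : Fin s → R) (hy : Ideal.span (Set.range y) = I)
    (β : extMod (RFMod.quot p I).a N.a j ⟶ (pull R p).obj (extMod (RFMod.quot p I).a N.a j))
    (hβ : β ≫ psiExt N (RFMod.quot p I).a j = extStr (RFMod.quot p I) N.a j) :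
    Nonempty (RFMod.generated β ≅ N.localCohomology y j) := by
  refine Q.nonempty_colim_iso B (fun n => IsIso.id (pullIter p (extMod (RFMod.quot p I).a N.a j) (n + 1))) hN hQ hy
    (fun w g => ExtMatch Q I j w g) ?_ ?_ ?_ ?_ ?_ ?_ ?_ ?_
  · rintro w g w' g' ⟨G, f, rfl, h1, h2, h3⟩ ⟨G', f', rfl, h1', h2', h3'⟩
    exact ⟨G + G', f + f', rfl, by rw [Preadditive.add_comp, h1, h1', add_zero], h2.add h2',
      h3.add h3'⟩
  · rintro a w g ⟨G, f, rfl, h1, h2, h3⟩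
    exact ⟨a • G, a • f, rfl, by rw [Linear.smul_comp, h1, smul_zero], h2.smul a, h3.smul a⟩
  · intro w
    obtain ⟨f, hf⟩ := ExtClass.exists_rep (projectiveResolution (RFMod.quot p I).a) w
    obtain ⟨G, h1, h2⟩ := ExtRep.exists_hom (Q := Q) hf.d_comp
    exact ⟨_, G, f, rfl, h1, hf, h2⟩
  · rintro w g ⟨G, f, rfl, h1, h2, h3⟩
    refine ⟨fun a ha => ?_, LinearMap.congr_fun (congrArg ModuleCat.Hom.hom h1) (quotOne p I)⟩
    rw [pow_zero, pow_one, ← map_smul, quot_smul_eq_zero ha, map_zero]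
  · intro g hg hd
    obtain ⟨G, rfl⟩ := exists_quot_hom (p := p) (I := I) (g := g) fun a ha => by
      have := hg a ha
      rwa [pow_zero, pow_one] at this
    have h1 : G ≫ (Q.d j).f = 0 := quot_hom_ext (Eq.trans hd rfl)
    obtain ⟨f, h2, h3⟩ := ExtRep.exists_cocycle (Q := Q)
      (P := projectiveResolution (RFMod.quot p I).a) h1
    obtain ⟨w, hw⟩ := ExtClass.exists_of_d_comp h2
    exact ⟨w, G, f, rfl, h1, hw, h3⟩
  · rintro g ⟨G, f, rfl, h1, h2, h3⟩
    exact FrobRes.KillBdry.of_homBdry (h3.homBdry (ExtClass.zero_iff.mp h2))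
  · rintro w g ⟨G, f, rfl, h1, h2, h3⟩ hb
    exact h2.eq_zero (h3.extBdry hb.homBdry)
  · intro w w' g g' hw h h'
    refine ExtMatch.frob B h h' ?_
    rw [Functor.ofSequence_map_homOfLE_succ] at hw
    have hw' : β.hom w = ∑ i, B.val i • tau _ (w' i) := hw
    rw [← hβ]
    exact (congrArg (psiExt N (RFMod.quot p I).a j).hom hw').trans
      (hom_sum_smul_tau B (psiExt N (RFMod.quot p I).a j) w')

end Generated

/-! ### Duality data for a complete regular local ring -/

section Main

open IsLocalRing RingTheory.Sequence

lemma exists_span_range_eq_ofList {R : Type u} [CommRing R] {rs : List R} {n : ℕ}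
    (h : rs.length = n) : ∃ x : Fin n → R, Ideal.span (Set.range x) = Ideal.ofList rs := by
  subst h
  refine ⟨rs.get, ?_⟩
  rw [Set.range_list_get]

/-- The duality data of a complete regular local ring, with the injective hull of the residue
field carrying the structure of the top local cohomology module. -/
lemma exists_dualData {R : Type u} [CommRing R] [IsRegularLocalRing R]
    [IsAdicComplete (maximalIdeal R) R] {p : ℕ} [Fact p.Prime] [CharP R p] {κ : Type} [Fintype κ]
    (B : FrobBasis R p κ) {n : ℕ} (hn : ringKrullDim R = n) {r : ℕ} {x : Fin r → R}
    (hx : Ideal.span (Set.range x) = maximalIdeal R) {E : ModuleCat.{u} R}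
    (hE : Module.Injective R E) (e : E ≅ ((RFMod.ring R p).localCohomology x n).a) :
    ∃ x' : Fin n → R, Ideal.span (Set.range x') = maximalIdeal R ∧
      Nonempty (DualData x' (((RFMod.ring R p).localCohomology x n).transport e)) := by
  obtain ⟨-, rs, hlen, hmax, hrs⟩ := exists_regular_list hn
  obtain ⟨x', hx'⟩ := exists_span_range_eq_ofList hlen
  have : IsAdicComplete (Ideal.ofList rs) R := by rwa [hmax]
  obtain ⟨α⟩ := B.nonempty_localCohomology_iso (RFMod.ring R p) x x'
    (hx.trans (hx'.trans hmax).symm) n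
  exact ⟨x', hx'.trans hmax, nonempty_dualData B x' hlen hx' hrs hE
    (((RFMod.ring R p).localCohomology x n).transportIso e ≪≫ α)⟩

end Main

end FrobeniusModules

end

/-- The map β is given by its composite with Ψ on Ext; as Ψ is bijective, this determines it.
Degrees i > n, where the partner degree n - i is negative, appear as a vanishing statement. -/
theorem mainTheorem11 {R : Type u} [CommRing R] [IsRegularLocalRing R]
    [IsAdicComplete (IsLocalRing.maximalIdeal R) R]
    (p : ℕ) [Fact p.Prime] [CharP R p] (hF : (frobenius R p).Finite)
    (n : ℕ) (hn : ringKrullDim R = n)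
    (I : Ideal R)
    {r s : ℕ} (x : Fin r → R) (hx : Ideal.span (Set.range x) = IsLocalRing.maximalIdeal R)
    (y : Fin s → R) (hy : Ideal.span (Set.range y) = I)
    (E : ModuleCat.{u} R) (hE : IsInjectiveHull (R := R) (IsLocalRing.ResidueField R) E) :
    Nonempty (E ≅ ((RFMod.ring R p).localCohomology x n).a) ∧
    ∀ e : E ≅ ((RFMod.ring R p).localCohomology x n).a,
      (∀ i, IsUnitRF (extMatlisDual e ((RFMod.quot p I).localCohomology x i))) ∧
      (∀ i j, i + j = n →
        Nonempty (extMatlisDual e ((RFMod.quot p I).localCohomology x i) ≅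
          (RFMod.ring R p).localCohomology y j)) ∧
      (∀ i, n < i → IsZero (extMatlisDual e ((RFMod.quot p I).localCohomology x i)).a) ∧
      (∀ d c : ℕ, ringKrullDim (R ⧸ I) = d → I.height = c →
        Nonempty (extMatlisDual e ((RFMod.quot p I).localCohomology x d) ≅
          (RFMod.ring R p).localCohomology y c) ∧
        ∃ _ : PreservesFiniteLimits (pull R p),
          IsIso (psiExt (RFMod.ring R p) (RFMod.quot p I).a c) ∧
          ∀ β : extMod (RFMod.quot p I).a (RFMod.ring R p).a c ⟶
              (pull R p).obj (extMod (RFMod.quot p I).a (RFMod.ring R p).a c),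
            β ≫ psiExt (RFMod.ring R p) (RFMod.quot p I).a c =
              extStr (RFMod.quot p I) (RFMod.ring R p).a c →
            Nonempty (RFMod.generated β ≅ (RFMod.ring R p).localCohomology y c)) := by
  obtain ⟨_, ⟨B⟩⟩ := exists_frobBasis hF hn
  obtain ⟨-, rs, hlen, hmax, hrs⟩ := exists_regular_list hn
  refine ⟨?_, fun e => ?_⟩
  · obtain ⟨α⟩ := hE.nonempty_equiv hmax
      (isDualizing_homology B x (hx.trans hmax.symm) hrs hlen)
    exact ⟨α.symm.toModuleIso⟩
  -- The resolution needs exactly n generators of the maximal ideal, whereas `x` may be longer;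
  -- local cohomology is moved from one family to the other.
  obtain ⟨x', hx', ⟨T⟩⟩ := exists_dualData B hn hx hE.1 e
  have hiso : ∀ i, Nonempty ((RFMod.quot p I).localCohomology x i ≅
      (RFMod.quot p I).localCohomology x' i) := fun i =>
    B.nonempty_localCohomology_iso (RFMod.quot p I) x x' (hx.trans hx'.symm) i
  have hdual : ∀ i j, i + j = n →
      Nonempty (extMatlisDual e ((RFMod.quot p I).localCohomology x i) ≅
        (RFMod.ring R p).localCohomology y j) := fun i j hij => by
    obtain ⟨α⟩ := hiso i
    exact T.nonempty_dual_iso B hij y hy α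
  refine ⟨fun i => B.isUnitRF_dual T.unit_E _, hdual, fun i hi => ?_, fun d c hd hc => ?_⟩
  · obtain ⟨α⟩ := hiso i
    let γ : ((RFMod.quot p I).localCohomology x i).a ≃ₗ[R]
        ((RFMod.quot p I).localCohomology x' i).a :=
      ((Endofunctor.Algebra.forget _).mapIso α).toLinearEquiv
    exact B.isZero_dual _ fun m => γ.injective
      ((localCohomology_eq_zero_of_lt x' _ hi (γ m)).trans (map_zero γ).symm)
  -- This equality makes d and c complementary degrees, so the top local cohomology of R/I is dual
  -- to local cohomology in degree c.
  · have hcd : c + d = n := height_add_ringKrullDim_quotient hx' hn T.vanish hc hd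
    have hlim := B.preservesFiniteLimits
    refine ⟨hdual d c (by omega), hlim, B.isIso_psiExt B.isUnitRF_ring _ c, fun β hβ => ?_⟩
    exact nonempty_generated_iso B (T.res B) B.isUnitRF_ring
      (fun l => B.isUnitRF_dualObj T.unit T.unit_E n l) y hy β hβ
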